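/- **Setting.** Let $n_x,n_y,n_z\ge 2$ and let $G$ be the nearest-neighbour graph of the box-shaped cubic lattice with vertex set $\mathbf V=\prod_{d\in\{x,y,z\}}\{0,\dots,n_d-1\}$; its faces are the unit squares and its cells the unit cubes of the lattice. Every edge is given an orientation ("$i$ points to $j$") whose restriction to each two-dimensional slice is that of the square-lattice compact encoding: each face is either *even* (its four oriented edges circulate around it) or *odd* (its edges touch head to head or tail to tail at each of its vertices), and in every slice the even and odd faces form a checkerboard. A cell is *odd* if all six of its faces are odd. An *isolated odd face* is an odd face on the boundary of the box that is not a face of an odd cell. For each isolated odd face one edge of that face is chosen. **The encoding.** Let $M_G$ be the group generated by central phases $\{\pm1,\pm \mathrm i\}$ (multiplying as complex numbers), the directed edges $e_{ij}$ and the vertices $v_j$ of $G$, subject to $e_{ij}^2=v_j^2=1$, $e_{ij}=-e_{ji}$, $[v_i,v_j]=[e_{ij},v_k]=[e_{ij},e_{kl}]=0$, $e_{ij}v_j=-v_je_{ij}$, $e_{ij}e_{jk}=-e_{jk}e_{ij}$ for distinct $i,j,k,l$ (where $[a,b]=0$ means $ab=ba$). Let $\mathcal C_G\le M_G$ be the subgroup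 of the elements $\mathrm i^{\ell}e_{i_0i_1}e_{i_1i_2}\cdots e_{i_{\ell-1}i_\ell}$, $i_\ell=i_0$, over closed walks with $\ell$ edges. Place one qubit on each vertex and one on each odd face. The cubic compact encoding is the representation $\sigma$ of $M_G$ on the Hilbert space of these qubits in which the phases act as scalars, $\sigma(v_j)=Z_j$, and, whenever $i$ points to $j$, $\sigma(e_{ij})=\pm X_iY_jP(i,j)$ and $\sigma(e_{ji})=-\sigma(e_{ij})$. Here $P(i,j)$ acts with $X$, $Y$ or $Z$, according as the edge is parallel to the $x$, $y$ or $z$ axis, on the qubit of every odd face containing the edge; the sign is $-$ if the edge was chosen for an isolated odd face and $+$ otherwise. With $N$ the number of qubits, $M=|\mathbf V|$, $S=\sigma(\mathcal C_G)$ and $D(S)$ the minimum size of a generating set of $S$, the *disparity* is $\Delta=N-M-D(S)$. **Theorem.** For every such lattice, orientation and choice of edges, the representation $\sigma$ exists and $-1\notin\sigma(\mathcal C_G)$. Let $OCV$ be the number of odd corner vertices, i.e. of corner vertices of the box for which the cell at that corner is odd. Then $$\Delta=\frac{OCV}{2}-1\in\{-1,0,1,3\}.$$ -/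

import Mathlib

namespace CompactEncoding

noncomputable section

/-! ### The group of a fermionic graph, its cycle group, and the disparity -/

section Graph

variable {V : Type*} (G : SimpleGraph V)

/-- Generators of `M_G`: the phases `i ^ k` (that is `1, i, -1, -i`), the directed edges `e_{ij}`
(a dart with `fst = i`, `snd = j`) and the vertices `v_j`. -/
inductive Gen where
  | phase (k : ZMod 4) : Gen
  | edge (e : G.Dart) : Gen
  | vert (v : V) : Gen

variable {G} in
/-- The letter of the free group that belongs to a generator. -/
def letter (g : Gen G) : FreeGroup (Gen G) := FreeGroup.of g

open Gen in
/-- The relators of `M_G`. The phases are central and multiply like complex numbers; a relation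
`x = y` is written as the relator `x * y⁻¹`, and `-1` is `phase 2`. -/
inductive IsRelator : FreeGroup (Gen G) → Prop where
  | phase_mul (k l : ZMod 4) :
      IsRelator (letter (phase k) * letter (phase l) * (letter (phase (k + l)))⁻¹)
  | phase_central (k : ZMod 4) (g : Gen G) :
      IsRelator (letter (phase k) * letter g * (letter g * letter (phase k))⁻¹)
  | edge_sq (e : G.Dart) : IsRelator (letter (edge e) * letter (edge e))
  | vert_sq (v : V) : IsRelator (letter (vert v) * letter (vert v))
  | edge_symm (e : G.Dart) :
      IsRelator (letter (edge e) * (letter (phase 2) * letter (edge e.symm))⁻¹)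
  | vert_comm_vert (u v : V) :
      IsRelator (letter (vert u) * letter (vert v) * (letter (vert v) * letter (vert u))⁻¹)
  | edge_comm_vert (e : G.Dart) (v : V) (h₁ : v ≠ e.fst) (h₂ : v ≠ e.snd) :
      IsRelator (letter (edge e) * letter (vert v) * (letter (vert v) * letter (edge e))⁻¹)
  | edge_comm_edge (e f : G.Dart) (h₁ : e.fst ≠ f.fst) (h₂ : e.fst ≠ f.snd)
      (h₃ : e.snd ≠ f.fst) (h₄ : e.snd ≠ f.snd) :
      IsRelator (letter (edge e) * letter (edge f) * (letter (edge f) * letter (edge e))⁻¹)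
  | edge_anticomm_vert (e : G.Dart) :
      IsRelator (letter (edge e) * letter (vert e.snd) *
        (letter (phase 2) * (letter (vert e.snd) * letter (edge e)))⁻¹)
  | edge_anticomm_edge (e f : G.Dart) (h₁ : e.snd = f.fst) (h₂ : e.fst ≠ f.snd) :
      IsRelator (letter (edge e) * letter (edge f) *
        (letter (phase 2) * (letter (edge f) * letter (edge e)))⁻¹)

/-- The finitely presented group `M_G` of the graph `G`. -/
abbrev MG : Type _ := PresentedGroup {w : FreeGroup (Gen G) | IsRelator G w}

variable {G}

/-- The class of a generator in `M_G`. -/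
def gen (g : Gen G) : MG G := PresentedGroup.of g

/-- The element `i ^ ℓ * e_{i₁ i₂} * e_{i₂ i₃} * ⋯` of `M_G` attached to a closed walk with
`ℓ` edges. -/
def cycleElement {v : V} (w : G.Walk v v) : MG G :=
  gen (Gen.phase (w.length : ZMod 4)) * (w.darts.map fun e => gen (Gen.edge e)).prod

variable (G) in
/-- The group `C_G` of directed cycles. -/
def cycleGroup : Subgroup (MG G) :=
  Subgroup.closure {x | ∃ (v : V) (w : G.Walk v v), x = cycleElement w}

/-- The least number of generators of a (finitely generated) group. -/
def minGenerators (X : Type*) [Group X] : ℕ :=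
  sInf {k | ∃ s : Finset X, Subgroup.closure (s : Set X) = ⊤ ∧ s.card = k}

/-- Operators on the Hilbert space of a finite system of qubits labelled by `Q`, as matrices in
the computational basis. -/
abbrev QubitOp (Q : Type*) : Type _ := Matrix (Q → Fin 2) (Q → Fin 2) ℂ

variable {Q : Type*} [Fintype Q] [DecidableEq Q]

/-- The group `S = σ(C_G)`. -/
def stabilizerGroup (σ : MG G →* QubitOp Q) : Subgroup (QubitOp Q)ˣ :=
  (cycleGroup G).map σ.toHomUnits

/-- The disparity `Δ = N - M - D(S)`: `N` qubits, `M` modes (the vertices of `G`), and `D(S)` the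
least number of generators of `S`. -/
def disparity [Fintype V] (σ : MG G →* QubitOp Q) : ℤ :=
  (Fintype.card Q : ℤ) - Fintype.card V - minGenerators (stabilizerGroup σ)

end Graph

/-! ### Pauli operators -/

def pauliX : Matrix (Fin 2) (Fin 2) ℂ := !![0, 1; 1, 0]
def pauliY : Matrix (Fin 2) (Fin 2) ℂ := !![0, -Complex.I; Complex.I, 0]
def pauliZ : Matrix (Fin 2) (Fin 2) ℂ := !![1, 0; 0, -1]

/-- The tensor product over all qubits `q` of the single-qubit operators `P q`. -/
def tensorOp {Q : Type*} [Fintype Q] (P : Q → Matrix (Fin 2) (Fin 2) ℂ) : QubitOp Q :=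
  Matrix.of fun a b => ∏ q, P q (a q) (b q)

/-! ### The box-shaped cubic lattice -/

/-- Vertices of the box with `n d` vertices along the axis `d`. -/
abbrev Vertex (n : Fin 3 → ℕ) : Type := (d : Fin 3) → Fin (n d)

section Lattice

variable {n : Fin 3 → ℕ}

/-- `v` is the next vertex after `u` in the positive direction of the axis `d`. -/
def IsStep (d : Fin 3) (u v : Vertex n) : Prop :=
  (u d).val + 1 = (v d).val ∧ ∀ k, k ≠ d → u k = v k

variable (n) in
/-- The graph of the lattice: nearest neighbours are adjacent. -/
def lattice : SimpleGraph (Vertex n) where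
  Adj u v := ∃ d, IsStep d u v ∨ IsStep d v u
  symm := ⟨fun _ _ ⟨d, h⟩ => ⟨d, h.symm⟩⟩
  loopless := ⟨fun _ ⟨_, h⟩ => by rcases h with h | h <;> exact absurd h.1 (by omega)⟩

/-- The axis along which an edge `{u, v}` is aligned. -/
def edgeAxis (u v : Vertex n) : Fin 3 :=
  if u 0 ≠ v 0 then 0 else if u 1 ≠ v 1 then 1 else 2

variable (n) in
/-- Unit square faces: a normal axis and the vertex with the least coordinates. -/
abbrev Face : Type :=
  {p : Fin 3 × Vertex n // ∀ d, d ≠ p.1 → (p.2 d).val + 1 < n d}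

/-- The axis normal to the face. -/
def Face.normal (f : Face n) : Fin 3 := f.1.1

/-- The vertex of the face with the least coordinates. -/
def Face.base (f : Face n) : Vertex n := f.1.2

/-- The four vertices of a face. -/
def Face.verts (f : Face n) : Set (Vertex n) :=
  {v | v f.normal = f.base f.normal ∧
    ∀ d, d ≠ f.normal → (v d).val = (f.base d).val ∨ (v d).val = (f.base d).val + 1}

variable (n) in
/-- Unit cubic cells, given by the vertex with the least coordinates. -/
abbrev Cell : Type := {p : Vertex n // ∀ d, (p d).val + 1 < n d}

/-- The eight vertices of a cell. -/
def Cell.verts (c : Cell n) : Set (Vertex n) :=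
  {v | ∀ d, (v d).val = (c.1 d).val ∨ (v d).val = (c.1 d).val + 1}

/-- `o u v` says that the edge between `u` and `v` points from `u` to `v`: every edge points in
exactly one direction. -/
structure IsOrientation (o : Vertex n → Vertex n → Prop) : Prop where
  adj : ∀ u v, o u v → (lattice n).Adj u v
  xor : ∀ u v, (lattice n).Adj u v → (o u v ↔ ¬ o v u)

/-- A face is even if its edges circulate around it. -/
def IsEvenFace (o : Vertex n → Vertex n → Prop) (f : Face n) : Prop :=
  ∀ u v w, u ∈ f.verts → v ∈ f.verts → w ∈ f.verts →
    (lattice n).Adj u v → (lattice n).Adj v w → u ≠ w → (o u v ↔ o v w)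

/-- A face is odd if its edges touch head to head or tail to tail. -/
def IsOddFace (o : Vertex n → Vertex n → Prop) (f : Face n) : Prop :=
  ∀ u v w, u ∈ f.verts → v ∈ f.verts → w ∈ f.verts →
    (lattice n).Adj u v → (lattice n).Adj v w → u ≠ w → (o u v ↔ o w v)

/-- Orientations whose restriction to every two-dimensional slice is that of the square-lattice
compact encoding: every face is even or odd, and the even and odd faces of each slice form a
checkerboard, i.e. of two faces of a slice that share an edge exactly one is odd. -/
structure IsCompactOrientation (o : Vertex n → Vertex n → Prop) : Prop extends
    IsOrientation o where
  even_or_odd : ∀ f : Face n, IsEvenFace o f ∨ IsOddFace o f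
  checkerboard : ∀ (f g : Face n) (d : Fin 3), f.normal = g.normal → d ≠ f.normal →
    IsStep d f.base g.base → (IsOddFace o f ↔ ¬ IsOddFace o g)

/-- A cell is odd if all six of its faces are odd. -/
def IsOddCell (o : Vertex n → Vertex n → Prop) (c : Cell n) : Prop :=
  ∀ f : Face n, f.verts ⊆ c.verts → IsOddFace o f

/-- Odd faces on the boundary of the box that are not faces of an odd cell. -/
structure IsIsolatedOddFace (o : Vertex n → Vertex n → Prop) (f : Face n) : Prop where
  odd : IsOddFace o f
  boundary : (f.base f.normal).val = 0 ∨ (f.base f.normal).val + 1 = n f.normal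
  isolated : ∀ c : Cell n, IsOddCell o c → ¬ f.verts ⊆ c.verts

/-- A choice, for every isolated odd face, of an edge `(i, j)` of that face with `i` pointing to
`j`. The values of `pick` at other faces are irrelevant. -/
def IsEdgeChoice (o : Vertex n → Vertex n → Prop) (pick : Face n → Vertex n × Vertex n) : Prop :=
  ∀ f, IsIsolatedOddFace o f →
    (pick f).1 ∈ f.verts ∧ (pick f).2 ∈ f.verts ∧ o (pick f).1 (pick f).2

/-- Corner vertices of the box. -/
def IsCorner (v : Vertex n) : Prop := ∀ d, (v d).val = 0 ∨ (v d).val + 1 = n d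

/-- Corner vertices for which the cell at that corner is odd. -/
def IsOddCorner (o : Vertex n → Vertex n → Prop) (v : Vertex n) : Prop :=
  IsCorner v ∧ ∃ c : Cell n, v ∈ c.verts ∧ IsOddCell o c

/-- The number `OCV` of odd corner vertices. -/
def oddCornerCount (o : Vertex n → Vertex n → Prop) : ℕ := Nat.card {v : Vertex n // IsOddCorner o v}

/-! ### The cubic compact encoding -/

/-- One qubit for each vertex and one for each odd face. -/
abbrev Qubit (o : Vertex n → Vertex n → Prop) : Type := Vertex n ⊕ {f : Face n // IsOddFace o f}

instance (o : Vertex n → Vertex n → Prop) : Fintype (Qubit o) := Fintype.ofFinite _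

instance (o : Vertex n → Vertex n → Prop) : DecidableEq (Qubit o) := Classical.decEq _

/-- `P = X, Y, Z` for edges along the axes `x, y, z`. -/
def axisPauli : Fin 3 → Matrix (Fin 2) (Fin 2) ℂ := ![pauliX, pauliY, pauliZ]

/-- The operator `Z_v`. -/
def vertexOp (o : Vertex n → Vertex n → Prop) (v : Vertex n) : QubitOp (Qubit o) :=
  tensorOp fun
    | Sum.inl u => if u = v then pauliZ else 1
    | Sum.inr _ => 1

open Classical in
/-- The operator `X_i Y_j P(i,j)`, where `P(i,j)` acts with `P` on the qubit of every odd face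
adjacent to the edge `(i,j)`. -/
def unsignedEdgeOp (o : Vertex n → Vertex n → Prop) (i j : Vertex n) : QubitOp (Qubit o) :=
  tensorOp fun
    | Sum.inl u => if u = i then pauliX else if u = j then pauliY else 1
    | Sum.inr f => if i ∈ f.1.verts ∧ j ∈ f.1.verts then axisPauli (edgeAxis i j) else 1

open Classical in
/-- The operator of the edge `(i,j)` for `i` pointing to `j`: `-X_i Y_j P(i,j)` if the edge was
chosen for some isolated odd face, and `X_i Y_j P(i,j)` otherwise. -/
def orientedEdgeOp (o : Vertex n → Vertex n → Prop) (pick : Face n → Vertex n × Vertex n)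
    (i j : Vertex n) : QubitOp (Qubit o) :=
  if ∃ f, IsIsolatedOddFace o f ∧ pick f = (i, j) then -unsignedEdgeOp o i j
  else unsignedEdgeOp o i j

open Classical in
/-- The operators prescribed for the generators of `M_G`. -/
def generatorOp (o : Vertex n → Vertex n → Prop) (pick : Face n → Vertex n × Vertex n) :
    Gen (lattice n) → QubitOp (Qubit o)
  | Gen.phase k => (Complex.I ^ k.val) • 1
  | Gen.vert v => vertexOp o v
  | Gen.edge e =>
      if o e.fst e.snd then orientedEdgeOp o pick e.fst e.snd
      else -orientedEdgeOp o pick e.snd e.fst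

/-- `σ` is the representation of `M_G` with the prescribed values on the generators. -/
def IsCubicEncoding (o : Vertex n → Vertex n → Prop) (pick : Face n → Vertex n × Vertex n)
    (σ : MG (lattice n) →* QubitOp (Qubit o)) : Prop :=
  ∀ g, σ (gen g) = generatorOp o pick g

end Lattice

end

end CompactEncoding

open CompactEncoding

/-!
Along every line of the lattice the edges alternate between two types, and the orientation of an
edge is read off its type and the parity of its endpoint. A face is odd when its two axes have the
same type at its base, and a cell is odd when all three have, so odd faces and odd cells are
products of segments.

A cycle is determined up to a phase by its set of edges mod 2, and no phase except `1` is a cycle: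
there is a representation of `M_G` by Majorana operators (Jordan–Wigner) which sends every cycle
to `1`. Hence the cycle group has `2 ^ (E - V + 1)` elements, with `E` and `V` the numbers of
edges and vertices.

It remains to find the cycles with scalar image. Commuting with every one-qubit operator forces
the edge set to be *balanced*: parallel edges of an odd face occur together (test on the face
qubit), and the edges at the lowest vertex of an odd cell, possibly truncated by the boundary of
the box, sum to zero (test on the vertex qubit). All balanced sets come from products of two loops
around opposite faces of an odd cell and from loops around isolated odd faces, and both are sent
to `1`; for the latter this uses the signs of the chosen edges. So `-1` is not in the image, which
is an elementary abelian `2`-group whose rank is found by counting balanced sets. All the counts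
are sums of products over the three axes of numbers of edges of a given type, and these combine to
`2 (Δ + 1) = OCV`.
-/

namespace CompactEncoding

noncomputable section

/-! ### Tensor products of one-qubit operators -/

section Tensor

variable {Q : Type*} [Fintype Q]

theorem tensorOp_mul [DecidableEq Q] (P R : Q → Matrix (Fin 2) (Fin 2) ℂ) :
    tensorOp P * tensorOp R = tensorOp fun q => P q * R q := by
  ext a b
  simp only [tensorOp, Matrix.mul_apply, Matrix.of_apply]
  rw [Finset.prod_univ_sum, Fintype.piFinset_univ]
  simp [Finset.prod_mul_distrib]

theorem tensorOp_smul (ε : Q → ℂ) (P : Q → Matrix (Fin 2) (Fin 2) ℂ) :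
    tensorOp (fun q => ε q • P q) = (∏ q, ε q) • tensorOp P := by
  ext a b
  simp [tensorOp, Finset.prod_mul_distrib]

theorem tensorOp_one : tensorOp (fun _ : Q => (1 : Matrix (Fin 2) (Fin 2) ℂ)) = 1 := by
  ext a b
  simp only [tensorOp, Matrix.of_apply, Matrix.one_apply]
  by_cases h : a = b
  · simp [h]
  · obtain ⟨q, hq⟩ := Function.ne_iff.mp h
    rw [if_neg h]
    exact Finset.prod_eq_zero (Finset.mem_univ q) (by simp [hq])

theorem tensorOp_eq_one {P : Q → Matrix (Fin 2) (Fin 2) ℂ} (h : ∀ q, P q = 1) :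
    tensorOp P = 1 := by
  rw [show P = fun _ => 1 from funext h, tensorOp_one]

theorem tensorOp_commute [DecidableEq Q] {P R : Q → Matrix (Fin 2) (Fin 2) ℂ}
    (h : ∀ q, P q * R q = R q * P q) :
    tensorOp P * tensorOp R = tensorOp R * tensorOp P := by
  rw [tensorOp_mul, tensorOp_mul, funext h]

theorem tensorOp_eq_neg {P R : Q → Matrix (Fin 2) (Fin 2) ℂ} (q₀ : Q) (h₀ : P q₀ = -R q₀)
    (h : ∀ q, q ≠ q₀ → P q = R q) : tensorOp P = -tensorOp R := by
  classical
  have : P = fun q => (if q = q₀ then (-1 : ℂ) else 1) • R q := by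
    funext q
    by_cases hq : q = q₀
    · subst hq; simp [h₀]
    · simp [hq, h q hq]
  rw [this, tensorOp_smul]
  simp

theorem tensorOp_anticommute [DecidableEq Q] {P R : Q → Matrix (Fin 2) (Fin 2) ℂ} (q₀ : Q)
    (h₀ : P q₀ * R q₀ = -(R q₀ * P q₀)) (h : ∀ q, q ≠ q₀ → P q * R q = R q * P q) :
    tensorOp P * tensorOp R = -(tensorOp R * tensorOp P) := by
  rw [tensorOp_mul, tensorOp_mul]
  exact tensorOp_eq_neg q₀ h₀ h

end Tensor

theorem pauliX_sq : pauliX * pauliX = 1 := by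
  ext i j; fin_cases i <;> fin_cases j <;> simp [pauliX, Matrix.mul_apply]

theorem pauliY_sq : pauliY * pauliY = 1 := by
  ext i j; fin_cases i <;> fin_cases j <;> simp [pauliY, Matrix.mul_apply]

theorem pauliZ_sq : pauliZ * pauliZ = 1 := by
  ext i j; fin_cases i <;> fin_cases j <;> simp [pauliZ, Matrix.mul_apply]

theorem pauliX_mul_pauliY : pauliX * pauliY = -(pauliY * pauliX) := by
  ext i j; fin_cases i <;> fin_cases j <;> simp [pauliX, pauliY, Matrix.mul_apply]

theorem pauliX_mul_pauliZ : pauliX * pauliZ = -(pauliZ * pauliX) := by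
  ext i j; fin_cases i <;> fin_cases j <;> simp [pauliX, pauliZ, Matrix.mul_apply]

theorem pauliY_mul_pauliZ : pauliY * pauliZ = -(pauliZ * pauliY) := by
  ext i j; fin_cases i <;> fin_cases j <;> simp [pauliZ, pauliY, Matrix.mul_apply]

theorem axisPauli_sq (a : Fin 3) : axisPauli a * axisPauli a = 1 := by
  fin_cases a <;> simp [axisPauli, pauliX_sq, pauliY_sq, pauliZ_sq]

theorem axisPauli_anticomm {a b : Fin 3} (h : a ≠ b) :
    axisPauli a * axisPauli b = -(axisPauli b * axisPauli a) := by
  fin_cases a <;> fin_cases b <;>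
    simp_all [axisPauli, pauliX_mul_pauliY, pauliX_mul_pauliZ, pauliY_mul_pauliZ]

/-! ### Homomorphisms out of `M_G` -/

section GraphGroup

variable {V : Type*} {G : SimpleGraph V}

/-- The values `F g` satisfy the defining relations of `M_G`. The relation `phase_zero`, which
holds automatically in a group, is what makes the phases invertible in a monoid. -/
structure SatisfiesRelations {R : Type*} [Monoid R] (F : Gen G → R) : Prop where
  phase_zero : F (.phase 0) = 1
  phase_mul : ∀ k l, F (.phase k) * F (.phase l) = F (.phase (k + l))
  phase_central : ∀ k g, F (.phase k) * F g = F g * F (.phase k)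
  edge_sq : ∀ e, F (.edge e) * F (.edge e) = 1
  vert_sq : ∀ v, F (.vert v) * F (.vert v) = 1
  edge_symm : ∀ e, F (.edge e) = F (.phase 2) * F (.edge e.symm)
  vert_comm_vert : ∀ u v, F (.vert u) * F (.vert v) = F (.vert v) * F (.vert u)
  edge_comm_vert : ∀ (e : G.Dart) (v : V), v ≠ e.fst → v ≠ e.snd →
    F (.edge e) * F (.vert v) = F (.vert v) * F (.edge e)
  edge_comm_edge : ∀ e f : G.Dart, e.fst ≠ f.fst → e.fst ≠ f.snd → e.snd ≠ f.fst →
    e.snd ≠ f.snd → F (.edge e) * F (.edge f) = F (.edge f) * F (.edge e)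
  edge_anticomm_vert : ∀ e : G.Dart,
    F (.edge e) * F (.vert e.snd) = F (.phase 2) * (F (.vert e.snd) * F (.edge e))
  edge_anticomm_edge : ∀ e f : G.Dart, e.snd = f.fst → e.fst ≠ f.snd →
    F (.edge e) * F (.edge f) = F (.phase 2) * (F (.edge f) * F (.edge e))

namespace SatisfiesRelations

variable {R : Type*} [Monoid R] {F : Gen G → R}

theorem phase_mul_phase_neg (hF : SatisfiesRelations F) (k : ZMod 4) :
    F (.phase k) * F (.phase (-k)) = 1 := by
  rw [hF.phase_mul, add_neg_cancel, hF.phase_zero]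

variable (hF : SatisfiesRelations F)

/-- The value `F g` as a unit: the generators of `M_G` are invertible by the relations. -/
def unit : Gen G → Rˣ
  | .phase k => ⟨F (.phase k), F (.phase (-k)), hF.phase_mul_phase_neg k,
      by simpa only [neg_neg] using hF.phase_mul_phase_neg (-k)⟩
  | .edge e => ⟨F (.edge e), F (.edge e), hF.edge_sq e, hF.edge_sq e⟩
  | .vert v => ⟨F (.vert v), F (.vert v), hF.vert_sq v, hF.vert_sq v⟩

theorem val_unit (g : Gen G) : (hF.unit g : R) = F g := by
  rcases g with k | e | v <;> rfl

theorem lift_unit_eq_one {r : FreeGroup (Gen G)} (hr : IsRelator G r) :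
    FreeGroup.lift hF.unit r = 1 := by
  cases hr <;>
    simp only [letter, map_mul, map_inv, FreeGroup.lift_apply_of, mul_inv_eq_one, Units.ext_iff,
      Units.val_mul, Units.val_one, hF.val_unit]
  case phase_mul k l => exact hF.phase_mul k l
  case phase_central k g => exact hF.phase_central k g
  case edge_sq e => exact hF.edge_sq e
  case vert_sq v => exact hF.vert_sq v
  case edge_symm e => exact hF.edge_symm e
  case vert_comm_vert u v => exact hF.vert_comm_vert u v
  case edge_comm_vert e v h₁ h₂ => exact hF.edge_comm_vert e v h₁ h₂
  case edge_comm_edge e f h₁ h₂ h₃ h₄ => exact hF.edge_comm_edge e f h₁ h₂ h₃ h₄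
  case edge_anticomm_vert e => exact hF.edge_anticomm_vert e
  case edge_anticomm_edge e f h₁ h₂ => exact hF.edge_anticomm_edge e f h₁ h₂

/-- The homomorphism on `M_G` with the prescribed values on the generators. -/
def lift : MG G →* R :=
  (Units.coeHom R).comp (PresentedGroup.toGroup fun _ hr => hF.lift_unit_eq_one hr)

theorem lift_gen (g : Gen G) : hF.lift (gen g) = F g := by
  rw [← hF.val_unit g]
  exact congrArg Units.val (PresentedGroup.toGroup.of fun _ hr => hF.lift_unit_eq_one hr)

end SatisfiesRelations

theorem satisfiesRelations_gen : SatisfiesRelations (gen : Gen G → MG G) := by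
  have eq_of_relator : ∀ {x y : FreeGroup (Gen G)}, IsRelator G (x * y⁻¹) →
      PresentedGroup.mk {w | IsRelator G w} x = PresentedGroup.mk _ y :=
    fun h => PresentedGroup.mk_eq_mk_of_mul_inv_mem h
  have one_of_relator : ∀ {x : FreeGroup (Gen G)}, IsRelator G x →
      PresentedGroup.mk {w | IsRelator G w} x = 1 :=
    fun h => PresentedGroup.one_of_mem h
  exact
    { phase_zero := by
        have h : gen (.phase 0) * gen (.phase 0) = (gen (.phase (0 + 0)) : MG G) :=
          eq_of_relator (.phase_mul 0 0)
        rwa [add_zero, mul_eq_left] at h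
      phase_mul := fun k l => eq_of_relator (.phase_mul k l)
      phase_central := fun k g => eq_of_relator (.phase_central k g)
      edge_sq := fun e => one_of_relator (.edge_sq e)
      vert_sq := fun v => one_of_relator (.vert_sq v)
      edge_symm := fun e => eq_of_relator (.edge_symm e)
      vert_comm_vert := fun u v => eq_of_relator (.vert_comm_vert u v)
      edge_comm_vert := fun e v h₁ h₂ => eq_of_relator (.edge_comm_vert e v h₁ h₂)
      edge_comm_edge := fun e f h₁ h₂ h₃ h₄ => eq_of_relator (.edge_comm_edge e f h₁ h₂ h₃ h₄)
      edge_anticomm_vert := fun e => eq_of_relator (.edge_anticomm_vert e)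
      edge_anticomm_edge := fun e f h₁ h₂ => eq_of_relator (.edge_anticomm_edge e f h₁ h₂) }

theorem mem_of_forall_gen_mem {H : Subgroup (MG G)} (h : ∀ g, gen g ∈ H) (x : MG G) : x ∈ H :=
  PresentedGroup.generated_by _ H h x

theorem gen_phase_comm (k : ZMod 4) (x : MG G) : gen (.phase k) * x = x * gen (.phase k) := by
  have : x ∈ Subgroup.centralizer {(gen (.phase k) : MG G)} :=
    mem_of_forall_gen_mem (fun g => Subgroup.mem_centralizer_singleton_iff.mpr
      (satisfiesRelations_gen.phase_central k g).symm) x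
  exact (Subgroup.mem_centralizer_singleton_iff.mp this).symm

/-! ### The quotient of `M_G` by the phases -/

variable (G) in
/-- The central subgroup of phases of `M_G`. -/
def phaseSubgroup : Subgroup (MG G) where
  carrier := {g | ∃ k, g = gen (.phase k)}
  mul_mem' := by
    rintro _ _ ⟨k, rfl⟩ ⟨l, rfl⟩
    exact ⟨k + l, satisfiesRelations_gen.phase_mul k l⟩
  one_mem' := ⟨0, satisfiesRelations_gen.phase_zero.symm⟩
  inv_mem' := by
    rintro _ ⟨k, rfl⟩
    exact ⟨-k, inv_eq_of_mul_eq_one_right (satisfiesRelations_gen.phase_mul_phase_neg k)⟩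

theorem gen_phase_mem_phaseSubgroup (k : ZMod 4) : gen (.phase k) ∈ phaseSubgroup G := ⟨k, rfl⟩

instance : (phaseSubgroup G).Normal where
  conj_mem := by
    rintro _ ⟨k, rfl⟩ g
    exact ⟨k, by rw [← gen_phase_comm, mul_inv_cancel_right]⟩

variable (G) in
/-- The quotient of `M_G` by the phases. -/
abbrev PhaseQuotient : Type _ := MG G ⧸ phaseSubgroup G

theorem mk_gen_phase (k : ZMod 4) : ((gen (.phase k) : MG G) : PhaseQuotient G) = 1 :=
  (QuotientGroup.eq_one_iff _).mpr (gen_phase_mem_phaseSubgroup k)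

theorem mk_eq_of_eq_phase_mul {g h : MG G} {k : ZMod 4} (e : g = gen (.phase k) * h) :
    (g : PhaseQuotient G) = h := by
  rw [e, QuotientGroup.mk_mul, mk_gen_phase, one_mul]

theorem mk_edge_symm (e : G.Dart) :
    ((gen (.edge e.symm) : MG G) : PhaseQuotient G) = (gen (.edge e) : MG G) :=
  (mk_eq_of_eq_phase_mul (satisfiesRelations_gen.edge_symm e)).symm

theorem mk_edge_comm_vert (e : G.Dart) (v : V) :
    ((gen (.edge e) * gen (.vert v) : MG G) : PhaseQuotient G) =
      (gen (.vert v) * gen (.edge e) : MG G) := by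
  have comm_snd : ∀ e : G.Dart, ((gen (.edge e) * gen (.vert e.snd) : MG G) : PhaseQuotient G) =
      (gen (.vert e.snd) * gen (.edge e) : MG G) := fun e =>
    mk_eq_of_eq_phase_mul (satisfiesRelations_gen.edge_anticomm_vert e)
  by_cases h₂ : v = e.snd
  · exact h₂ ▸ comm_snd e
  by_cases h₁ : v = e.fst
  · subst h₁
    have := comm_snd e.symm
    rwa [QuotientGroup.mk_mul, QuotientGroup.mk_mul, mk_edge_symm] at this
  · rw [satisfiesRelations_gen.edge_comm_vert e v h₁ h₂]

theorem mk_edge_comm_edge (e f : G.Dart) :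
    ((gen (.edge e) * gen (.edge f) : MG G) : PhaseQuotient G) =
      (gen (.edge f) * gen (.edge e) : MG G) := by
  have comm_of_consecutive : ∀ e f : G.Dart, e.snd = f.fst →
      ((gen (.edge e) * gen (.edge f) : MG G) : PhaseQuotient G) =
        (gen (.edge f) * gen (.edge e) : MG G) := by
    intro e f h
    by_cases h' : e.fst = f.snd
    · have : e.symm = f := by ext <;> simp [h, h']
      rw [← this, QuotientGroup.mk_mul, QuotientGroup.mk_mul, mk_edge_symm]
    · exact mk_eq_of_eq_phase_mul (satisfiesRelations_gen.edge_anticomm_edge e f h h')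
  by_cases h₁ : e.snd = f.fst
  · exact comm_of_consecutive e f h₁
  by_cases h₂ : e.snd = f.snd
  · simpa only [QuotientGroup.mk_mul, mk_edge_symm] using comm_of_consecutive e f.symm h₂
  by_cases h₃ : e.fst = f.fst
  · simpa only [QuotientGroup.mk_mul, mk_edge_symm] using comm_of_consecutive e.symm f h₃
  by_cases h₄ : e.fst = f.snd
  · simpa only [QuotientGroup.mk_mul, mk_edge_symm] using comm_of_consecutive e.symm f.symm h₄
  · rw [satisfiesRelations_gen.edge_comm_edge e f h₃ h₄ h₁ h₂]

theorem mk_gen_comm (g h : Gen G) :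
    ((gen g * gen h : MG G) : PhaseQuotient G) = (gen h * gen g : MG G) := by
  rcases g with k | e | u
  · rw [gen_phase_comm]
  · rcases h with l | f | v
    · rw [gen_phase_comm]
    · exact mk_edge_comm_edge e f
    · exact mk_edge_comm_vert e v
  · rcases h with l | f | v
    · rw [gen_phase_comm]
    · exact (mk_edge_comm_vert f u).symm
    · rw [satisfiesRelations_gen.vert_comm_vert]

theorem mk_comm (x y : MG G) : (x : PhaseQuotient G) * y = y * x := by
  have mem_of_gen : ∀ {a : PhaseQuotient G}, (∀ g, (gen g : MG G) * a = a * (gen g : MG G)) →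
      ∀ x : MG G, (x : PhaseQuotient G) * a = a * x := fun {a} h x =>
    Subgroup.mem_centralizer_singleton_iff.mp (mem_of_forall_gen_mem
      (H := (Subgroup.centralizer {a}).comap (QuotientGroup.mk' _))
      (fun g => Subgroup.mem_centralizer_singleton_iff.mpr (h g)) x)
  exact mem_of_gen (fun g => (mem_of_gen (fun h => mk_gen_comm h g) y).symm) x

instance : CommGroup (PhaseQuotient G) where
  mul_comm a b := by
    induction a using QuotientGroup.induction_on
    induction b using QuotientGroup.induction_on
    exact mk_comm _ _

theorem mk_gen_sq (g : Gen G) : ((gen g : MG G) : PhaseQuotient G) ^ 2 = 1 := by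
  rw [sq, ← QuotientGroup.mk_mul]
  rcases g with k | e | v
  · rw [QuotientGroup.mk_mul, mk_gen_phase, mul_one]
  · rw [satisfiesRelations_gen.edge_sq, QuotientGroup.mk_one]
  · rw [satisfiesRelations_gen.vert_sq, QuotientGroup.mk_one]

theorem mk_sq (x : MG G) : (x : PhaseQuotient G) ^ 2 = 1 :=
  mem_of_forall_gen_mem (H := ((powMonoidHom 2).comp (QuotientGroup.mk' (phaseSubgroup G))).ker)
    mk_gen_sq x

end GraphGroup

/-! ### The phases meet the cycle group trivially -/

section PowersOfI

open Complex

theorem I_pow_val_add (k l : ZMod 4) : I ^ k.val * I ^ l.val = I ^ (k + l).val := by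
  rw [← pow_add, ZMod.val_add, ← I_pow_eq_pow_mod]

theorem I_pow_val_natCast (m : ℕ) : I ^ (m : ZMod 4).val = I ^ m := by
  rw [ZMod.val_natCast, ← I_pow_eq_pow_mod]

theorem I_pow_val_two : I ^ (2 : ZMod 4).val = -1 := by
  rw [show (2 : ZMod 4).val = 2 from rfl, I_sq]

theorem eq_zero_of_I_pow_val_eq_one {k : ZMod 4} (h : I ^ k.val = 1) : k = 0 := by
  fin_cases k
  · rfl
  · have : I ^ 1 = 1 := h
    simp [Complex.ext_iff] at this
  · have : I ^ 2 = 1 := h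
    norm_num [Complex.ext_iff] at this
  · have : I ^ 3 = 1 := h
    simp [Complex.ext_iff, I_pow_three] at this

end PowersOfI

section Anticommuting

variable {R : Type*} [Ring R] {a b c d : R}

theorem mul_mul_mul_comm_of_anticomm (hac : a * c = -(c * a)) (had : a * d = -(d * a))
    (hbc : b * c = -(c * b)) (hbd : b * d = -(d * b)) : a * b * (c * d) = c * d * (a * b) :=
  calc a * b * (c * d) = a * (b * c) * d := by noncomm_ring
    _ = -(a * c * (b * d)) := by rw [hbc]; noncomm_ring
    _ = -(c * (a * d) * b) := by rw [hac, hbd]; noncomm_ring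
    _ = c * d * (a * b) := by rw [had]; noncomm_ring

theorem mul_mul_mul_anticomm (hab : a * b = -(b * a)) (hac : a * c = -(c * a))
    (hbc : b * c = -(c * b)) : a * b * (b * c) = -(b * c * (a * b)) :=
  calc a * b * (b * c) = -(b * (a * (b * c))) := by rw [hab]; noncomm_ring
    _ = b * (a * c) * b := by rw [hbc]; noncomm_ring
    _ = -(b * c * (a * b)) := by rw [hac]; noncomm_ring

end Anticommuting

section Majorana

variable {V : Type*} [LinearOrder V] [Fintype V]

/-- The Jordan–Wigner Majorana operator: one of a family of pairwise anticommuting involutions. -/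
def majorana (v : V) : QubitOp V :=
  tensorOp fun u => if u < v then pauliZ else if u = v then pauliX else 1

/-- The fermionic parity `Z_v`. -/
def parityOp (v : V) : QubitOp V :=
  tensorOp fun u => if u = v then pauliZ else 1

/-- The image `-i γ_u γ_v` of the directed edge `(u, v)`. -/
def majoranaPair (u v : V) : QubitOp V := (-Complex.I) • (majorana u * majorana v)

theorem majorana_sq (v : V) : majorana v * majorana v = 1 := by
  rw [majorana, tensorOp_mul]
  refine tensorOp_eq_one fun q => ?_
  split_ifs <;> simp [pauliZ_sq, pauliX_sq]

theorem majorana_anticomm {u v : V} (h : u ≠ v) :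
    majorana u * majorana v = -(majorana v * majorana u) := by
  wlog huv : u < v generalizing u v
  · rw [this h.symm (h.lt_of_le' (not_lt.mp huv)), neg_neg]
  refine tensorOp_anticommute u ?_ fun q hq => ?_
  · simp [huv, pauliX_mul_pauliZ]
  · rcases lt_or_gt_of_ne hq with h' | h'
    · simp [h', h'.trans huv]
    · simp [hq, not_lt_of_gt h']

theorem parityOp_sq (v : V) : parityOp v * parityOp v = 1 := by
  rw [parityOp, tensorOp_mul]
  refine tensorOp_eq_one fun q => ?_
  split_ifs <;> simp [pauliZ_sq]

theorem parityOp_comm (u v : V) : parityOp u * parityOp v = parityOp v * parityOp u := by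
  refine tensorOp_commute fun q => ?_
  split_ifs <;> simp

theorem majorana_comm_parityOp {u v : V} (h : u ≠ v) :
    majorana u * parityOp v = parityOp v * majorana u := by
  refine tensorOp_commute fun q => ?_
  by_cases h₁ : q = v
  · subst h₁
    by_cases h₂ : q < u <;> simp [h₂, h.symm]
  · simp [h₁]

theorem majorana_anticomm_parityOp (v : V) :
    majorana v * parityOp v = -(parityOp v * majorana v) := by
  refine tensorOp_anticommute v ?_ fun q hq => ?_
  · simp [pauliX_mul_pauliZ]
  · simp [hq]

theorem majoranaPair_symm {u v : V} (h : u ≠ v) : majoranaPair u v = -majoranaPair v u := by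
  rw [majoranaPair, majoranaPair, majorana_anticomm h, smul_neg]

theorem majoranaPair_mul_majoranaPair (u v w : V) :
    majoranaPair u v * majoranaPair v w = (-Complex.I) • majoranaPair u w := by
  rw [majoranaPair, majoranaPair, majoranaPair, smul_mul_smul_comm, mul_assoc,
    ← mul_assoc (majorana v), majorana_sq, one_mul, smul_smul]

theorem majoranaPair_self (v : V) : majoranaPair v v = (-Complex.I) • 1 := by
  rw [majoranaPair, majorana_sq]

theorem majoranaPair_sq {u v : V} (h : u ≠ v) : majoranaPair u v * majoranaPair u v = 1 := by
  nth_rewrite 2 [majoranaPair_symm h]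
  rw [mul_neg, majoranaPair_mul_majoranaPair, majoranaPair_self, smul_smul]
  simp

theorem majoranaPair_comm_parityOp {u v w : V} (hu : w ≠ u) (hv : w ≠ v) :
    majoranaPair u v * parityOp w = parityOp w * majoranaPair u v := by
  rw [majoranaPair, smul_mul_assoc, mul_smul_comm, mul_assoc, majorana_comm_parityOp hv.symm,
    ← mul_assoc, majorana_comm_parityOp hu.symm, mul_assoc]

theorem majoranaPair_anticomm_parityOp {u v : V} (h : u ≠ v) :
    majoranaPair u v * parityOp v = -(parityOp v * majoranaPair u v) := by
  rw [majoranaPair, smul_mul_assoc, mul_smul_comm, mul_assoc, majorana_anticomm_parityOp, mul_neg,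
    ← mul_assoc, majorana_comm_parityOp h, mul_assoc, smul_neg]

variable {G : SimpleGraph V}

/-- The values on the generators of `M_G` of the Majorana representation. -/
def majoranaGen : Gen G → QubitOp V
  | .phase k => (Complex.I ^ k.val) • 1
  | .edge e => majoranaPair e.fst e.snd
  | .vert v => parityOp v

theorem majoranaGen_phase_two : majoranaGen (.phase 2 : Gen G) = -1 := by
  rw [majoranaGen, I_pow_val_two, neg_one_smul]

variable (G) in
theorem satisfiesRelations_majoranaGen : SatisfiesRelations (majoranaGen (G := G)) where
  phase_zero := by simp [majoranaGen]
  phase_mul k l := by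
    simp only [majoranaGen, smul_mul_smul_comm, mul_one, I_pow_val_add]
  phase_central k g := by simp [majoranaGen]
  edge_sq e := majoranaPair_sq e.adj.ne
  vert_sq v := parityOp_sq v
  edge_symm e := by
    rw [majoranaGen_phase_two, neg_one_mul]
    exact majoranaPair_symm e.adj.ne
  vert_comm_vert := parityOp_comm
  edge_comm_vert _ _ := majoranaPair_comm_parityOp
  edge_comm_edge e f h₁ h₂ h₃ h₄ := by
    simp only [majoranaGen, majoranaPair, smul_mul_smul_comm]
    rw [mul_mul_mul_comm_of_anticomm (majorana_anticomm h₁) (majorana_anticomm h₂)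
      (majorana_anticomm h₃) (majorana_anticomm h₄)]
  edge_anticomm_vert e := by
    rw [majoranaGen_phase_two, neg_one_mul]
    exact majoranaPair_anticomm_parityOp e.adj.ne
  edge_anticomm_edge e f h₁ h₂ := by
    have h₃ : e.fst ≠ f.fst := h₁ ▸ e.adj.ne
    rw [majoranaGen_phase_two, neg_one_mul]
    simp only [majoranaGen, majoranaPair, smul_mul_smul_comm, h₁]
    rw [mul_mul_mul_anticomm (majorana_anticomm h₃) (majorana_anticomm h₂)
      (majorana_anticomm f.adj.ne), smul_neg]

theorem prod_majoranaGen_darts {u v : V} (w : G.Walk u v) :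
    (w.darts.map fun e => majoranaGen (.edge e)).prod =
      (-Complex.I) ^ w.length • (majorana u * majorana v) := by
  induction w with
  | nil => simp [majorana_sq]
  | @cons a b c h p ih =>
    rw [SimpleGraph.Walk.darts_cons, List.map_cons, List.prod_cons, ih, majoranaGen, majoranaPair,
      smul_mul_smul_comm, mul_assoc, ← mul_assoc (majorana b), majorana_sq, one_mul,
      SimpleGraph.Walk.length_cons, pow_succ']

theorem lift_majoranaGen_cycleElement {v : V} (w : G.Walk v v) :
    (satisfiesRelations_majoranaGen G).lift (cycleElement w) = 1 := by
  rw [cycleElement, map_mul, map_list_prod, List.map_map]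
  simp only [Function.comp_def, SatisfiesRelations.lift_gen, prod_majoranaGen_darts, majorana_sq]
  rw [majoranaGen, I_pow_val_natCast, smul_mul_smul_comm, mul_one, ← mul_pow]
  simp

end Majorana

section Cycles

variable {V : Type*} {G : SimpleGraph V}

theorem eq_zero_of_gen_phase_mem_cycleGroup [Finite V] {k : ZMod 4}
    (hk : gen (.phase k) ∈ cycleGroup G) : k = 0 := by
  have := Fintype.ofFinite V
  let _ : LinearOrder V := LinearOrder.lift' (Fintype.equivFin V) (Fintype.equivFin V).injective
  let ρ := (satisfiesRelations_majoranaGen G).lift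
  have cycles_le_ker : cycleGroup G ≤ ρ.toHomUnits.ker := by
    rw [cycleGroup, Subgroup.closure_le]
    rintro _ ⟨v, w, rfl⟩
    exact Units.ext (lift_majoranaGen_cycleElement w)
  have hρ : ρ (gen (.phase k)) = 1 := congrArg Units.val (MonoidHom.mem_ker.mp (cycles_le_ker hk))
  rw [SatisfiesRelations.lift_gen, majoranaGen] at hρ
  refine eq_zero_of_I_pow_val_eq_one ?_
  simpa using congrFun (congrFun hρ 0) 0

theorem eq_one_of_mk_eq_one [Finite V] {c : MG G} (hc : c ∈ cycleGroup G)
    (h : (c : PhaseQuotient G) = 1) : c = 1 := by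
  obtain ⟨k, rfl⟩ := (QuotientGroup.eq_one_iff c).mp h
  rw [eq_zero_of_gen_phase_mem_cycleGroup hc, satisfiesRelations_gen.phase_zero]

theorem sq_eq_one_of_mem_cycleGroup [Finite V] {c : MG G} (hc : c ∈ cycleGroup G) : c ^ 2 = 1 :=
  eq_one_of_mk_eq_one (pow_mem hc 2) (by rw [QuotientGroup.mk_pow, mk_sq])

/-! ### The cycle group as a group of edge sets -/

theorem eqOn_cycleGroup {R : Type*} [Monoid R] {α β : MG G →* R}
    (hp : ∀ k, α (gen (.phase k)) = β (gen (.phase k)))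
    (he : ∀ e, α (gen (.edge e)) = β (gen (.edge e))) : Set.EqOn α β (cycleGroup G) := by
  suffices cycleGroup G ≤ α.eqLocus β from fun c hc => this hc
  rw [cycleGroup, Subgroup.closure_le]
  rintro _ ⟨v, w, rfl⟩
  change α (cycleElement w) = β (cycleElement w)
  simp only [cycleElement, map_mul, hp, map_list_prod, List.map_map, Function.comp_def, he]

variable {E : Type*}

variable (G E) in
/-- A labelling of the undirected edges of `G` by the elements of `E`, given on darts. -/
structure EdgeLabelling where
  label : G.Dart → E
  surjective : Function.Surjective label
  eq_iff : ∀ e f, label e = label f ↔ f = e ∨ f = e.symm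

variable (L : EdgeLabelling G E)

theorem EdgeLabelling.label_symm (e : G.Dart) : L.label e.symm = L.label e :=
  ((L.eq_iff _ _).mpr (Or.inr rfl)).symm

/-- A dart that represents the undirected edge with the given label. -/
def EdgeLabelling.dart (x : E) : G.Dart := Function.surjInv L.surjective x

theorem EdgeLabelling.dart_label (e : G.Dart) :
    L.dart (L.label e) = e ∨ L.dart (L.label e) = e.symm :=
  (L.eq_iff e _).mp (Function.surjInv_eq L.surjective (L.label e)).symm

theorem fun_add_self (z : E → ZMod 2) : z + z = 0 :=
  funext fun _ => CharTwo.add_self_eq_zero _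

theorem ofAdd_mul_self (z : E → ZMod 2) :
    Multiplicative.ofAdd z * Multiplicative.ofAdd z = 1 := by
  rw [← ofAdd_add, fun_add_self, ofAdd_zero]

theorem mk_gen_edge_dart_label (e : G.Dart) :
    ((gen (.edge (L.dart (L.label e))) : MG G) : PhaseQuotient G) = (gen (.edge e) : MG G) := by
  rcases L.dart_label e with h | h
  · rw [h]
  · rw [h, mk_edge_symm]

variable [DecidableEq E]

/-- The values of `edgeHom` on the generators. -/
def edgeGen : Gen G → Multiplicative (E → ZMod 2)
  | .edge e => Multiplicative.ofAdd (Pi.single (L.label e) 1)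
  | .phase _ | .vert _ => 1

theorem satisfiesRelations_edgeGen : SatisfiesRelations (edgeGen L) where
  phase_zero := rfl
  phase_mul _ _ := mul_one 1
  phase_central _ _ := mul_comm _ _
  edge_sq _ := ofAdd_mul_self _
  vert_sq _ := mul_one 1
  edge_symm e := by simp [edgeGen, L.label_symm]
  vert_comm_vert _ _ := rfl
  edge_comm_vert _ _ _ _ := mul_comm _ _
  edge_comm_edge _ _ _ _ _ _ := mul_comm _ _
  edge_anticomm_vert _ := (mul_comm _ _).trans (one_mul _).symm
  edge_anticomm_edge _ _ _ _ := (mul_comm _ _).trans (one_mul _).symm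

/-- The homomorphism that counts, modulo two, how often each undirected edge occurs. -/
def edgeHom : MG G →* Multiplicative (E → ZMod 2) := (satisfiesRelations_edgeGen L).lift

theorem edgeHom_phase (k : ZMod 4) : edgeHom L (gen (.phase k)) = 1 :=
  (satisfiesRelations_edgeGen L).lift_gen _

theorem edgeHom_edge (e : G.Dart) :
    edgeHom L (gen (.edge e)) = Multiplicative.ofAdd (Pi.single (L.label e) 1) :=
  (satisfiesRelations_edgeGen L).lift_gen _

/-- The product of the edges in a given set, which is a section of `edgeHom` modulo phases. -/
def edgeSection [Fintype E] : Multiplicative (E → ZMod 2) →* PhaseQuotient G where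
  toFun z := ∏ x, ((gen (.edge (L.dart x)) : MG G) : PhaseQuotient G) ^
    (Multiplicative.toAdd z x).val
  map_one' := by simp
  map_mul' z z' := by
    rw [← Finset.prod_mul_distrib]
    refine Finset.prod_congr rfl fun x _ => ?_
    rw [← pow_add, toAdd_mul, Pi.add_apply, ZMod.val_add, ← pow_eq_pow_mod _ (mk_sq _)]

theorem edgeSection_edge [Fintype E] (e : G.Dart) :
    edgeSection L (Multiplicative.ofAdd (Pi.single (L.label e) 1)) = (gen (.edge e) : MG G) := by
  change ∏ x, _ ^ (Pi.single (M := fun _ => ZMod 2) (L.label e) 1 x).val = _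
  rw [Finset.prod_eq_single (L.label e)]
  · rw [Pi.single_eq_same, ZMod.val_one, pow_one, mk_gen_edge_dart_label]
  · intro x _ hx
    rw [Pi.single_eq_of_ne hx, ZMod.val_zero, pow_zero]
  · simp

theorem eq_one_of_edgeHom_eq_one [Finite V] [Finite E] {c : MG G} (hc : c ∈ cycleGroup G)
    (h : edgeHom L c = 1) : c = 1 := by
  have := Fintype.ofFinite E
  have section_edgeHom : (edgeSection L).comp (edgeHom L) c = QuotientGroup.mk' _ c := by
    refine eqOn_cycleGroup (fun k => ?_) (fun e => ?_) hc
    · rw [MonoidHom.comp_apply, edgeHom_phase, map_one]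
      exact (mk_gen_phase k).symm
    · rw [MonoidHom.comp_apply, edgeHom_edge, edgeSection_edge]
      rfl
  rw [MonoidHom.comp_apply, h, map_one] at section_edgeHom
  exact eq_one_of_mk_eq_one hc section_edgeHom.symm

theorem edgeHom_injOn [Finite V] [Finite E] : Set.InjOn (edgeHom L) (cycleGroup G) :=
  fun c hc d hd h => mul_inv_eq_one.mp (eq_one_of_edgeHom_eq_one L (mul_mem hc (inv_mem hd))
    (by rw [map_mul, map_inv, h, mul_inv_cancel]))

end Cycles

/-! ### The cycle space -/

section CycleSpace

variable {V : Type*} {G : SimpleGraph V} {E : Type*} [DecidableEq E] (L : EdgeLabelling G E)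

/-- The edges of a walk, counted modulo two. -/
def edgeVec {u v : V} (w : G.Walk u v) : E → ZMod 2 :=
  (w.darts.map fun e => Pi.single (M := fun _ => ZMod 2) (L.label e) 1).sum

theorem edgeVec_cons {u v w : V} (h : G.Adj u v) (p : G.Walk v w) :
    edgeVec L (SimpleGraph.Walk.cons h p) =
      Pi.single (L.label ⟨(u, v), h⟩) 1 + edgeVec L p := by
  simp [edgeVec]

theorem edgeVec_apply {u v : V} (w : G.Walk u v) (e : E) :
    edgeVec L w e = (w.darts.map L.label).count e := by
  induction w with
  | nil => simp [edgeVec]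
  | cons h p ih =>
    rw [edgeVec_cons, Pi.add_apply, ih, SimpleGraph.Walk.darts_cons, List.map_cons,
      List.count_cons, Nat.cast_add, add_comm, Pi.single_apply]
    simp only [beq_iff_eq, @eq_comm _ e, Nat.cast_ite, Nat.cast_one, Nat.cast_zero]

theorem edgeVec_apply_of_nodup {u v : V} {w : G.Walk u v} (h : (w.darts.map L.label).Nodup)
    (e : E) : edgeVec L w e = if e ∈ w.darts.map L.label then 1 else 0 := by
  rw [edgeVec_apply, h.count, Nat.cast_ite, Nat.cast_one, Nat.cast_zero]

theorem edgeVec_append {u v w : V} (p : G.Walk u v) (q : G.Walk v w) :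
    edgeVec L (p.append q) = edgeVec L p + edgeVec L q := by
  simp [edgeVec, SimpleGraph.Walk.darts_append]

theorem edgeVec_reverse {u v : V} (p : G.Walk u v) : edgeVec L p.reverse = edgeVec L p := by
  simp [edgeVec, SimpleGraph.Walk.darts_reverse, Function.comp_def, L.label_symm, List.sum_reverse]

theorem edgeHom_cycleElement {v : V} (w : G.Walk v v) :
    edgeHom L (cycleElement w) = Multiplicative.ofAdd (edgeVec L w) := by
  rw [cycleElement, map_mul, edgeHom_phase, one_mul, map_list_prod, edgeVec, ofAdd_list_prod,
    List.map_map, List.map_map]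
  simp only [Function.comp_def, edgeHom_edge]

/-- The subspace of `E → ZMod 2` that corresponds to a subgroup of `M_G`. -/
def edgeSpace (H : Subgroup (MG G)) : Submodule (ZMod 2) (E → ZMod 2) :=
  AddSubgroup.toZModSubmodule 2 (Subgroup.toAddSubgroup' (H.map (edgeHom L)))

theorem mem_edgeSpace {H : Subgroup (MG G)} {z : E → ZMod 2} :
    z ∈ edgeSpace L H ↔ ∃ c ∈ H, edgeHom L c = Multiplicative.ofAdd z := Iff.rfl

theorem edgeVec_mem_edgeSpace {v : V} (w : G.Walk v v) :
    edgeVec L w ∈ edgeSpace L (cycleGroup G) :=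
  (mem_edgeSpace L).mpr
    ⟨cycleElement w, Subgroup.subset_closure ⟨_, _, rfl⟩, edgeHom_cycleElement L w⟩

theorem card_eq_card_edgeSpace [Finite V] [Finite E] {H : Subgroup (MG G)}
    (hH : H ≤ cycleGroup G) : Nat.card H = Nat.card (edgeSpace L H) := by
  refine Nat.card_congr (Equiv.ofBijective
    (fun c => ⟨Multiplicative.toAdd (edgeHom L c.1), c.1, c.2, rfl⟩) ⟨?_, ?_⟩)
  · intro c d h
    exact Subtype.ext (edgeHom_injOn L (hH c.2) (hH d.2) (congrArg Subtype.val h))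
  · rintro ⟨z, c, hc, h⟩
    exact ⟨⟨c, hc⟩, Subtype.ext h⟩

/-- The linear map that sends a vertex `v` to the walk `p v` from the root to `v`. -/
def spread [Fintype V] {r : V} (p : ∀ v, G.Walk r v) : (V → ZMod 2) →ₗ[ZMod 2] (E → ZMod 2) :=
  Fintype.linearCombination (ZMod 2) fun v => edgeVec L (p v)

theorem spread_single [Fintype V] [DecidableEq V] {r : V} (p : ∀ v, G.Walk r v) (v : V) :
    spread L p (Pi.single v 1) = edgeVec L (p v) := by
  rw [spread, Fintype.linearCombination_apply_single, one_smul]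

variable [Fintype E] [DecidableEq V]

/-- The map that sends an edge to the sum of its ends. -/
def boundary : (E → ZMod 2) →ₗ[ZMod 2] (V → ZMod 2) :=
  Fintype.linearCombination (ZMod 2) fun x =>
    Pi.single (L.dart x).fst 1 + Pi.single (L.dart x).snd 1

theorem boundary_single (e : G.Dart) :
    boundary L (Pi.single (L.label e) 1) = Pi.single e.fst 1 + Pi.single e.snd 1 := by
  rw [boundary, Fintype.linearCombination_apply_single, one_smul]
  rcases L.dart_label e with h | h
  · rw [h]
  · rw [h, add_comm]; rfl

theorem boundary_edgeVec {u v : V} (w : G.Walk u v) :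
    boundary L (edgeVec L w) = Pi.single u 1 + Pi.single v 1 := by
  induction w with
  | nil => simp [edgeVec, fun_add_self]
  | @cons a b c h p ih =>
    rw [edgeVec_cons, map_add, boundary_single, ih]
    change Pi.single a 1 + Pi.single b 1 + _ = _
    rw [add_assoc, ← add_assoc (Pi.single b 1), fun_add_self, zero_add]

theorem edgeSpace_cycleGroup_le : edgeSpace L (cycleGroup G) ≤ LinearMap.ker (boundary L) := by
  suffices cycleGroup G ≤ Subgroup.comap (edgeHom L)
      (AddSubgroup.toSubgroup (LinearMap.ker (boundary L)).toAddSubgroup) by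
    rintro z ⟨c, hc, hz⟩
    have := this hc
    rwa [Subgroup.mem_comap, hz] at this
  rw [cycleGroup, Subgroup.closure_le]
  rintro _ ⟨v, w, rfl⟩
  rw [SetLike.mem_coe, Subgroup.mem_comap, edgeHom_cycleElement]
  change boundary L (edgeVec L w) = 0
  rw [boundary_edgeVec, fun_add_self]

theorem add_spread_boundary_mem [Fintype V] {r : V} (p : ∀ v, G.Walk r v) (z : E → ZMod 2) :
    z + spread L p (boundary L z) ∈ edgeSpace L (cycleGroup G) := by
  have single_mem : ∀ x, Pi.single x 1 + spread L p (boundary L (Pi.single x 1)) ∈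
      edgeSpace L (cycleGroup G) := by
    intro x
    obtain ⟨e, rfl⟩ := L.surjective x
    have closed := edgeVec_mem_edgeSpace L
      ((p e.fst).append (SimpleGraph.Walk.cons e.adj (p e.snd).reverse))
    rw [edgeVec_append, edgeVec_cons, edgeVec_reverse, add_left_comm] at closed
    rw [boundary_single, map_add, spread_single, spread_single]
    exact closed
  have hz : z = ∑ x, z x • Pi.single (M := fun _ => ZMod 2) x 1 := by
    simpa using pi_eq_sum_univ' z
  have : z + spread L p (boundary L z) =
      ∑ x, z x • (Pi.single (M := fun _ => ZMod 2) x 1 +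
        spread L p (boundary L (Pi.single x 1))) := by
    simp only [smul_add, Finset.sum_add_distrib, ← map_smul, ← map_sum, ← hz]
  rw [this]
  exact Submodule.sum_mem _ fun x _ => Submodule.smul_mem _ _ (single_mem x)

theorem edgeSpace_cycleGroup [Finite V] (hG : G.Connected) :
    edgeSpace L (cycleGroup G) = LinearMap.ker (boundary L) := by
  have := Fintype.ofFinite V
  refine le_antisymm (edgeSpace_cycleGroup_le L) fun z hz => ?_
  obtain ⟨r⟩ := hG.nonempty
  have := add_spread_boundary_mem L (fun v => (hG.preconnected r v).some) z
  rwa [LinearMap.mem_ker.mp hz, map_zero, add_zero] at this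

end CycleSpace

section CycleRank

variable {V : Type*} [Fintype V] [DecidableEq V]

variable (V) in
/-- The sum of the coefficients of a combination of vertices. -/
def augmentation : (V → ZMod 2) →ₗ[ZMod 2] ZMod 2 :=
  Fintype.linearCombination (ZMod 2) fun _ => 1

theorem augmentation_single (v : V) (a : ZMod 2) : augmentation V (Pi.single v a) = a := by
  rw [augmentation, Fintype.linearCombination_apply_single, smul_eq_mul, mul_one]

variable {G : SimpleGraph V} {E : Type*} [Fintype E] (L : EdgeLabelling G E)

theorem augmentation_comp_boundary : augmentation V ∘ₗ boundary L = 0 := by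
  classical
  refine LinearMap.pi_ext' fun x => LinearMap.ext_ring ?_
  obtain ⟨e, rfl⟩ := L.surjective x
  simp only [LinearMap.comp_apply, LinearMap.single_apply, boundary_single, map_add,
    augmentation_single, LinearMap.zero_apply]
  exact CharTwo.add_self_eq_zero _

theorem boundary_spread [DecidableEq E] {r : V} (p : ∀ v, G.Walk r v) (f : V → ZMod 2) :
    boundary L (spread L p f) = Pi.single r (augmentation V f) + f := by
  rw [spread, augmentation, Fintype.linearCombination_apply, Fintype.linearCombination_apply,
    map_sum]
  simp only [map_smul, boundary_edgeVec, smul_add, Finset.sum_add_distrib, ← Finset.sum_smul]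
  congr 1
  · ext v
    rcases eq_or_ne v r with rfl | h <;> simp [*]
  · simpa using (pi_eq_sum_univ' f).symm

theorem range_boundary (hG : G.Connected) :
    LinearMap.range (boundary L) = LinearMap.ker (augmentation V) := by
  classical
  refine le_antisymm ?_ fun f hf => ?_
  · rw [LinearMap.range_le_ker_iff, augmentation_comp_boundary]
  · obtain ⟨r⟩ := hG.nonempty
    refine ⟨spread L (fun v => (hG.preconnected r v).some) f, ?_⟩
    rw [boundary_spread, LinearMap.mem_ker.mp hf, Pi.single_zero, zero_add]

theorem finrank_ker_boundary (hG : G.Connected) :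
    Module.finrank (ZMod 2) (LinearMap.ker (boundary L)) + Fintype.card V = Fintype.card E + 1 := by
  have augmentation_surjective : Function.Surjective (augmentation V) :=
    fun a => ⟨Pi.single hG.nonempty.some a, augmentation_single _ a⟩
  have rank_boundary := LinearMap.finrank_range_add_finrank_ker (boundary L)
  have rank_augmentation := LinearMap.finrank_range_add_finrank_ker (augmentation V)
  rw [LinearMap.range_eq_top.mpr augmentation_surjective, ← range_boundary L hG, finrank_top,
    Module.finrank_self, Module.finrank_fintype_fun_eq_card] at rank_augmentation
  rw [Module.finrank_fintype_fun_eq_card] at rank_boundary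
  omega

end CycleRank

theorem card_cycleGroup {V : Type*} [Fintype V] {G : SimpleGraph V} {E : Type*} [Fintype E]
    (L : EdgeLabelling G E) (hG : G.Connected) :
    ∃ k, Nat.card (cycleGroup G) = 2 ^ k ∧ k + Fintype.card V = Fintype.card E + 1 := by
  classical
  refine ⟨_, ?_, finrank_ker_boundary L hG⟩
  rw [card_eq_card_edgeSpace L le_rfl, edgeSpace_cycleGroup L hG,
    Module.natCard_eq_pow_finrank (K := ZMod 2), Nat.card_zmod]

/-! ### Generators of elementary abelian groups -/

theorem minGenerators_eq_rank (X : Type*) [Group X] [hX : Group.FG X] :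
    minGenerators X = Group.rank X := by
  classical
  obtain ⟨s, hs, hclosure⟩ := Group.rank_spec X
  refine le_antisymm (Nat.sInf_le ⟨s, hclosure, hs⟩) (le_csInf ⟨_, s, hclosure, hs⟩ ?_)
  rintro _ ⟨t, ht, rfl⟩
  exact Group.rank_le ht

theorem rank_le_finrank {p : ℕ} [Fact p.Prime] {X : Type*} [CommGroup X] [Finite X]
    [Module (ZMod p) (Additive X)] : Group.rank X ≤ Module.finrank (ZMod p) (Additive X) := by
  classical
  have : Module.Finite (ZMod p) (Additive X) := Module.Finite.of_finite
  let b := Module.finBasis (ZMod p) (Additive X)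
  let s : Finset X := Finset.univ.image fun i => Additive.toMul (b i)
  have span_le : Submodule.span (ZMod p) (Set.range b) ≤
      AddSubgroup.toZModSubmodule p (Subgroup.toAddSubgroup (Subgroup.closure (s : Set X))) := by
    rw [Submodule.span_le]
    rintro _ ⟨i, rfl⟩
    have hi : Additive.toMul (b i) ∈ (s : Set X) := by simp [s]
    exact (Subgroup.subset_closure hi : Additive.toMul (b i) ∈ Subgroup.closure (s : Set X))
  rw [b.span_eq] at span_le
  have closure_eq : Subgroup.closure (s : Set X) = ⊤ :=
    eq_top_iff.mpr fun x _ => span_le (Submodule.mem_top (x := Additive.ofMul x))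
  calc Group.rank X ≤ s.card := Group.rank_le closure_eq
    _ ≤ (Finset.univ : Finset (Fin _)).card := Finset.card_image_le
    _ = _ := Finset.card_fin _

theorem finrank_eq_of_natCard_eq_pow {p k : ℕ} [Fact p.Prime] {X : Type*} [AddCommGroup X]
    [Finite X] [Module (ZMod p) X] (hk : Nat.card X = p ^ k) : Module.finrank (ZMod p) X = k := by
  have card_eq : Nat.card X = Nat.card (ZMod p) ^ Module.finrank (ZMod p) X :=
    Module.natCard_eq_pow_finrank
  rw [Nat.card_zmod] at card_eq
  exact Nat.pow_right_injective (Fact.out : p.Prime).two_le (card_eq.symm.trans hk)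

theorem rank_eq_of_card_eq_pow {p k : ℕ} [Fact p.Prime] {X : Type*} [CommGroup X] [Finite X]
    (h : ∀ x : X, x ^ p = 1) (hk : Nat.card X = p ^ k) : Group.rank X = k := by
  let _ : Module (ZMod p) (Additive X) := AddCommGroup.zmodModule h
  have finrank_eq := finrank_eq_of_natCard_eq_pow (X := Additive X) hk
  refine le_antisymm (rank_le_finrank.trans finrank_eq.le) ?_
  have := card_dvd_exponent_pow_rank' X h
  rwa [hk, Nat.pow_dvd_pow_iff_le_right (Fact.out : p.Prime).one_lt] at this

theorem mul_comm_of_sq_eq_one {X : Type*} [Group X] (h : ∀ x : X, x ^ 2 = 1) (a b : X) :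
    a * b = b * a := by
  have inv_eq : ∀ x : X, x⁻¹ = x := fun x => inv_eq_of_mul_eq_one_right (sq x ▸ h x)
  rw [← inv_eq (a * b), mul_inv_rev, inv_eq, inv_eq]

theorem minGenerators_of_card_eq {X : Type*} [Group X] (h : ∀ x : X, x ^ 2 = 1) {k : ℕ}
    (hk : Nat.card X = 2 ^ k) : minGenerators X = k := by
  let _ : CommGroup X := { mul_comm := mul_comm_of_sq_eq_one h }
  have : Finite X := Nat.finite_of_card_ne_zero (by rw [hk]; positivity)
  rw [minGenerators_eq_rank, rank_eq_of_card_eq_pow h hk]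

/-! ### Steps and faces -/

section Box

variable {n : Fin 3 → ℕ} {o : Vertex n → Vertex n → Prop} {d a b : Fin 3}
variable {t u u' v v' w : Vertex n}

theorem exists_third_axis : ∀ {a b : Fin 3}, a ≠ b →
    ∃ k, k ≠ a ∧ k ≠ b ∧ ∀ d, d = a ∨ d = b ∨ d = k := by decide

theorem exists_other_axes : ∀ k : Fin 3, ∃ a b, a ≠ b ∧ k ≠ a ∧ k ≠ b ∧
    ∀ d, d = a ∨ d = b ∨ d = k := by decide

theorem axis_cases : ∀ {a b k : Fin 3}, a ≠ b → a ≠ k → b ≠ k →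
    ∀ d, d = a ∨ d = b ∨ d = k := by decide

theorem eq_third_axis : ∀ {a b k l : Fin 3}, a ≠ b → a ≠ k → b ≠ k → a ≠ l → b ≠ l → k = l := by
  decide

/-- The sum of the coordinates of a vertex, whose parity decides how edges of a given type are
oriented at that vertex. -/
def coordSum (v : Vertex n) : ℕ := ∑ d, (v d).val

theorem vertex_ext (h : ∀ d, (u d).val = (v d).val) : u = v := funext fun d => Fin.ext (h d)

theorem IsStep.val_eq (h : IsStep d u v) {k : Fin 3} (hk : k ≠ d) : (v k).val = (u k).val := by
  rw [h.2 k hk]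

theorem IsStep.val_add_one (h : IsStep d u v) : (v d).val = (u d).val + 1 := h.1.symm

theorem IsStep.lt (h : IsStep d u v) : (u d).val + 1 < n d := by
  rw [h.1]; exact (v d).isLt

theorem IsStep.coordSum_eq (h : IsStep d u v) : coordSum v = coordSum u + 1 := by
  have val_eq : ∀ k, (v k).val = (u k).val + if k = d then 1 else 0 := by
    intro k
    split_ifs with hk
    · rw [hk, h.val_add_one]
    · rw [h.val_eq hk, add_zero]
  simp [coordSum, val_eq, Finset.sum_add_distrib]

theorem exists_pos_of_coordSum_pos (h : 0 < coordSum u) : ∃ d, 0 < (u d).val := by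
  obtain ⟨d, -, hd⟩ := Finset.exists_ne_zero_of_sum_ne_zero h.ne'
  exact ⟨d, Nat.pos_of_ne_zero hd⟩

theorem IsStep.adj (h : IsStep d u v) : (lattice n).Adj u v := ⟨d, Or.inl h⟩

/-- The neighbour of `u` in the positive direction of the axis `d`. -/
def shift (u : Vertex n) (d : Fin 3) (h : (u d).val + 1 < n d) : Vertex n :=
  Function.update u d ⟨(u d).val + 1, h⟩

theorem isStep_shift (u : Vertex n) (d : Fin 3) (h : (u d).val + 1 < n d) :
    IsStep d u (shift u d h) :=
  ⟨by simp [shift], fun k hk => by simp [shift, hk]⟩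

theorem exists_isStep (h : (u d).val + 1 < n d) : ∃ v, IsStep d u v := ⟨_, isStep_shift u d h⟩

theorem exists_isStep_of_pos (h : 0 < (v d).val) : ∃ u, IsStep d u v := by
  refine ⟨Function.update v d ⟨(v d).val - 1, by omega⟩, ?_, fun k hk => by simp [hk]⟩
  simp only [Function.update_self]
  omega

theorem IsStep.eq_of_left (h : IsStep d u v) (h' : IsStep d u v') : v = v' :=
  vertex_ext fun k => by
    by_cases hk : k = d
    · rw [hk, h.val_add_one, h'.val_add_one]
    · rw [h.val_eq hk, h'.val_eq hk]

theorem IsStep.eq_of_right (h : IsStep d u v) (h' : IsStep d u' v) : u = u' :=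
  vertex_ext fun k => by
    by_cases hk : k = d
    · rw [hk, ← Nat.add_right_cancel_iff (n := 1), h.1, h'.1]
    · rw [← h.val_eq hk, h'.val_eq hk]

theorem IsStep.axis_eq {d' : Fin 3} (h : IsStep d u v) (h' : IsStep d' u v) : d = d' := by
  by_contra hne
  have := h.val_add_one
  have := h'.val_eq hne
  omega

theorem edgeAxis_comm (u v : Vertex n) : edgeAxis u v = edgeAxis v u := by
  simp only [edgeAxis, ne_comm]

theorem IsStep.edgeAxis_eq (h : IsStep d u v) : edgeAxis u v = d := by
  have apply_ne : u d ≠ v d := fun e => by have := h.1; rw [e] at this; omega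
  have apply_eq := h.2
  fin_cases d
  · simp_all [edgeAxis]
  · simp_all [edgeAxis, apply_eq 0 (by decide)]
  · simp_all [edgeAxis, apply_eq 0 (by decide), apply_eq 1 (by decide)]

theorem IsStep.of_square (h : IsStep a u v) (hu : IsStep b u u') (hv : IsStep b v v')
    (hab : a ≠ b) : IsStep a u' v' := by
  refine ⟨?_, fun k hk => Fin.ext ?_⟩
  · have := h.val_add_one
    have := hu.val_eq hab
    have := hv.val_eq hab
    omega
  · have := h.val_eq hk
    by_cases hkb : k = b
    · subst hkb
      have := hu.val_add_one
      have := hv.val_add_one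
      omega
    · have := hu.val_eq hkb
      have := hv.val_eq hkb
      omega

theorem IsStep.exists_square (h : IsStep a u v) (hu : IsStep b u u') (hab : a ≠ b) :
    ∃ v', IsStep b v v' ∧ IsStep a u' v' := by
  obtain ⟨v', hv'⟩ := exists_isStep (u := v) (d := b) (by rw [h.val_eq hab.symm]; exact hu.lt)
  exact ⟨v', hv', h.of_square hu hv' hab⟩

theorem IsStep.of_square_back (h : IsStep a u v) (hu : IsStep b u' u) (hv : IsStep b v' v)
    (hab : a ≠ b) : IsStep a u' v' := by
  obtain ⟨w, hw⟩ := exists_isStep (u := u') (d := a) (by rw [← hu.val_eq hab]; exact h.lt)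
  obtain ⟨x, hx, hux⟩ := hw.exists_square hu hab
  obtain rfl := h.eq_of_left hux
  rwa [hv.eq_of_right hx]

theorem face_ext {f g : Face n} (h : f.normal = g.normal)
    (hb : ∀ d, (f.base d).val = (g.base d).val) : f = g :=
  Subtype.ext (Prod.ext h (vertex_ext hb))

theorem Face.base_mem_verts (f : Face n) : f.base ∈ f.verts :=
  ⟨rfl, fun _ _ => Or.inl rfl⟩

theorem Face.lt (f : Face n) (h : d ≠ f.normal) : (f.base d).val + 1 < n d := f.2 d h

theorem Face.vert_ext {f : Face n} (hab : a ≠ b) (ha : a ≠ f.normal) (hb : b ≠ f.normal)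
    (hu : u ∈ f.verts) (hv : v ∈ f.verts) (hua : (u a).val = (v a).val)
    (hub : (u b).val = (v b).val) : u = v := by
  refine vertex_ext fun d => ?_
  rcases axis_cases hab ha hb d with rfl | rfl | rfl
  · exact hua
  · exact hub
  · rw [hu.1, hv.1]

theorem Face.mem_verts_of_isStep {f : Face n} (h : IsStep d u v) (hd : d ≠ f.normal)
    (hu : u ∈ f.verts) (hb : (u d).val = (f.base d).val) : v ∈ f.verts := by
  refine ⟨Fin.ext (by rw [h.val_eq hd.symm, hu.1]), fun k hk => ?_⟩
  by_cases hkd : k = d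
  · subst hkd
    right; rw [h.val_add_one, hb]
  · rw [h.val_eq hkd]; exact hu.2 k hk

theorem exists_face_of_lt (hab : a ≠ b) (ha : (u a).val + 1 < n a) (hb : (u b).val + 1 < n b) :
    ∃ f : Face n, f.base = u ∧ a ≠ f.normal ∧ b ≠ f.normal := by
  obtain ⟨k, hka, hkb, hk⟩ := exists_third_axis hab
  refine ⟨⟨(k, u), fun d hd => ?_⟩, rfl, hka.symm, hkb.symm⟩
  rcases hk d with rfl | rfl | rfl
  · exact ha
  · exact hb
  · exact absurd rfl hd

/-! ### The types of the edges -/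

theorem IsOrientation.not_iff (ho : IsOrientation o) (h : (lattice n).Adj u v) :
    ¬ o u v ↔ o v u := by
  have := ho.xor u v h
  tauto

theorem IsCompactOrientation.flip (ho : IsCompactOrientation o) (hab : a ≠ b)
    (h : IsStep a u v) (hu : IsStep b u u') (hv : IsStep b v v') : o u v ↔ ¬ o u' v' := by
  have h' := h.of_square hu hv hab
  obtain ⟨f, rfl, ha, hb⟩ := exists_face_of_lt hab h.lt hu.lt
  have mu := f.base_mem_verts
  have mv : v ∈ f.verts := Face.mem_verts_of_isStep h ha mu rfl
  have mu' : u' ∈ f.verts := Face.mem_verts_of_isStep hu hb mu rfl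
  have mv' : v' ∈ f.verts := Face.mem_verts_of_isStep hv hb mv (h.val_eq hab.symm)
  have base_ne : f.base ≠ v' := by
    rintro e
    have := h'.val_add_one
    have := hu.val_eq hab
    rw [e] at this
    omega
  have v_ne : v ≠ u' := by
    rintro rfl
    have := h.val_add_one
    have := hu.val_eq hab
    omega
  rcases ho.even_or_odd f with hf | hf
  · have e₁ := hf f.base v v' mu mv mv' h.adj hv.adj base_ne
    have e₂ := hf v v' u' mv mv' mu' hv.adj h'.adj.symm v_ne
    rw [ho.not_iff h'.adj, e₁, e₂]
  · have e₁ := hf f.base v v' mu mv mv' h.adj hv.adj base_ne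
    have e₂ := hf v v' u' mv mv' mu' hv.adj h'.adj.symm v_ne
    rw [e₁, ← e₂, ho.not_iff hv.adj]

theorem IsCompactOrientation.isOddFace_iff_base (ho : IsCompactOrientation o) (f : Face n)
    (hab : a ≠ b) (ha : a ≠ f.normal) (hb : b ≠ f.normal)
    (hv : IsStep a f.base v) (hw : IsStep b f.base w) :
    IsOddFace o f ↔ (o f.base v ↔ o f.base w) := by
  have mu := f.base_mem_verts
  have mv : v ∈ f.verts := Face.mem_verts_of_isStep hv ha mu rfl
  have mw : w ∈ f.verts := Face.mem_verts_of_isStep hw hb mu rfl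
  have ne : v ≠ w := by
    rintro rfl
    exact hab (hv.axis_eq hw)
  have xv := ho.xor _ _ hv.adj
  have xw := ho.xor _ _ hw.adj
  constructor
  · intro hf
    have := hf v f.base w mv mu mw hv.adj.symm hw.adj ne
    tauto
  · intro h
    refine (ho.even_or_odd f).resolve_left fun hf => ?_
    have := hf v f.base w mv mu mw hv.adj.symm hw.adj ne
    tauto

theorem IsCompactOrientation.straight_of_isStep (ho : IsCompactOrientation o) (hab : a ≠ b)
    (huv : IsStep a u v) (hvw : IsStep a v w) (hu : IsStep b u u') : o u v ↔ o v w := by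
  obtain ⟨v', hv, huv'⟩ := huv.exists_square hu hab
  obtain ⟨f, rfl, hfa, hfb⟩ := exists_face_of_lt hab huv.lt hu.lt
  obtain ⟨g, rfl, hga, hgb⟩ := exists_face_of_lt hab hvw.lt hv.lt
  have odd_f := ho.isOddFace_iff_base f hab hfa hfb huv hu
  have odd_g := ho.isOddFace_iff_base g hab hga hgb hvw hv
  have odd_f_iff := ho.checkerboard f g a (eq_third_axis hab hfa hfb hga hgb) hfa huv
  have := ho.flip hab.symm hu huv huv'
  tauto

theorem IsCompactOrientation.straight (ho : IsCompactOrientation o) (hn : ∀ d, 2 ≤ n d)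
    (huv : IsStep d u v) (hvw : IsStep d v w) : o u v ↔ o v w := by
  obtain ⟨b, -, -, hdb, -⟩ := exists_other_axes d
  by_cases hb : (u b).val + 1 < n b
  · obtain ⟨u', hu'⟩ := exists_isStep hb
    exact ho.straight_of_isStep hdb huv hvw hu'
  · have pos : 0 < (u b).val := by have := hn b; omega
    obtain ⟨u', hu⟩ := exists_isStep_of_pos pos
    obtain ⟨v', hv⟩ := exists_isStep_of_pos (v := v) (by rwa [huv.val_eq hdb.symm])
    obtain ⟨w', hw⟩ := exists_isStep_of_pos (v := w)
      (by rwa [hvw.val_eq hdb.symm, huv.val_eq hdb.symm])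
    have huv' := huv.of_square_back hu hv hdb
    have hvw' := hvw.of_square_back hv hw hdb
    have straight' := ho.straight_of_isStep hdb huv' hvw' hu
    have flip_uv := ho.flip hdb huv' hu hv
    have flip_vw := ho.flip hdb hvw' hv hw
    tauto

/-- The type, `0` or `1`, of an edge along the axis `d` whose lower end has the coordinate `x` on
that axis. The orientations of the theorem are those in which, for some `c`, the edges of one type
leave each vertex and the edges of the other type enter it. -/
def edgeType (c : Fin 3 → ℕ) (d : Fin 3) (x : ℕ) : ℕ := (x + c d) % 2

/-- The orientation `o` is given by the types of the edges: the edges that leave `u` are those whose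
type is not the parity of `u`. -/
def IsTypedBy (o : Vertex n → Vertex n → Prop) (c : Fin 3 → ℕ) : Prop :=
  ∀ d u v, IsStep d u v → (o u v ↔ edgeType c d (u d).val ≠ coordSum u % 2)

theorem edgeType_lt (c : Fin 3 → ℕ) (d : Fin 3) (x : ℕ) : edgeType c d x < 2 :=
  Nat.mod_lt _ (by norm_num)

theorem ne_iff_of_straight {c : Fin 3 → ℕ} (h : IsStep d t u) :
    edgeType c d (t d).val ≠ coordSum t % 2 ↔ edgeType c d (u d).val ≠ coordSum u % 2 := by
  rw [edgeType, edgeType, h.val_add_one, h.coordSum_eq]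
  omega

theorem ne_iff_of_flip {c : Fin 3 → ℕ} (h : IsStep b t u) (hab : a ≠ b) :
    edgeType c a (t a).val ≠ coordSum t % 2 ↔ ¬ edgeType c a (u a).val ≠ coordSum u % 2 := by
  have := edgeType_lt c a (t a).val
  rw [h.val_eq hab, h.coordSum_eq]
  omega

theorem IsCompactOrientation.exists_isTypedBy (ho : IsCompactOrientation o)
    (hn : ∀ d, 2 ≤ n d) : ∃ c, IsTypedBy o c := by
  classical
  let z : Vertex n := fun d => ⟨0, by have := hn d; omega⟩
  have hz : ∀ d, (z d).val + 1 < n d := fun d => hn d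
  refine ⟨fun d => if o z (shift z d (hz d)) then 1 else 0, ?_⟩
  intro d u v h
  induction hs : coordSum u generalizing u v with
  | zero =>
    obtain rfl : u = z := vertex_ext fun k =>
      Finset.sum_eq_zero_iff.mp hs k (Finset.mem_univ k)
    rw [h.eq_of_left (isStep_shift z d (hz d)), edgeType]
    split_ifs with h' <;> simp [h', z]
  | succ m ih =>
    obtain ⟨k, hk⟩ := exists_pos_of_coordSum_pos (by rw [hs]; exact m.succ_pos)
    obtain ⟨t, ht⟩ := exists_isStep_of_pos hk
    have coordSum_t : coordSum t = m := Nat.succ.inj (ht.coordSum_eq.symm.trans hs)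
    rw [← hs]
    by_cases hdk : d = k
    · subst hdk
      rw [← ho.straight hn ht h, ih t u ht coordSum_t, ← ne_iff_of_straight ht, coordSum_t]
    · obtain ⟨w, hw⟩ := exists_isStep_of_pos (v := v) (d := k)
        (by rwa [h.val_eq (Ne.symm hdk)])
      have htw := h.of_square_back ht hw hdk
      have flip_tw := ho.flip hdk htw ht hw
      rw [ih t w htw coordSum_t, ← coordSum_t, ne_iff_of_flip ht hdk, not_iff_not] at flip_tw
      exact flip_tw.symm

end Box

section Typed

variable {n : Fin 3 → ℕ} {o : Vertex n → Vertex n → Prop} {c : Fin 3 → ℕ}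
variable {i j k l : Vertex n}

/-- The coordinate, along the axis of the edge, of the lower end of an edge. -/
def edgeLow (i j : Vertex n) : ℕ :=
  min (i (edgeAxis i j)).val (j (edgeAxis i j)).val

/-- The type of the edge between `i` and `j`. -/
def dartType (c : Fin 3 → ℕ) (i j : Vertex n) : ℕ := edgeType c (edgeAxis i j) (edgeLow i j)

theorem edgeLow_comm (i j : Vertex n) : edgeLow i j = edgeLow j i := by
  rw [edgeLow, edgeLow, edgeAxis_comm, min_comm]

theorem dartType_comm (c : Fin 3 → ℕ) (i j : Vertex n) : dartType c i j = dartType c j i := by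
  rw [dartType, dartType, edgeAxis_comm, edgeLow_comm]

theorem dartType_lt (c : Fin 3 → ℕ) (i j : Vertex n) : dartType c i j < 2 := edgeType_lt _ _ _

theorem isStep_or_isStep (h : (lattice n).Adj i j) :
    IsStep (edgeAxis i j) i j ∨ IsStep (edgeAxis i j) j i := by
  obtain ⟨d, h | h⟩ := h
  · left; rwa [h.edgeAxis_eq]
  · right; rwa [edgeAxis_comm, h.edgeAxis_eq]

theorem IsStep.edgeLow_eq {d : Fin 3} (h : IsStep d i j) : edgeLow i j = (i d).val := by
  rw [edgeLow, h.edgeAxis_eq, h.val_add_one]; omega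

theorem val_eq_of_adj (h : (lattice n).Adj i j) {d : Fin 3} (hd : d ≠ edgeAxis i j) :
    (i d).val = (j d).val := by
  rcases isStep_or_isStep h with h | h
  · exact (h.val_eq hd).symm
  · exact h.val_eq hd

theorem val_axis_of_adj (h : (lattice n).Adj i j) :
    ((i (edgeAxis i j)).val = edgeLow i j ∧ (j (edgeAxis i j)).val = edgeLow i j + 1) ∨
    ((j (edgeAxis i j)).val = edgeLow i j ∧ (i (edgeAxis i j)).val = edgeLow i j + 1) := by
  rw [edgeLow]
  rcases isStep_or_isStep h with h | h
  · have := h.val_add_one; omega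
  · have := h.val_add_one; omega

theorem edgeLow_add_one_lt (h : (lattice n).Adj i j) : edgeLow i j + 1 < n (edgeAxis i j) := by
  have := val_axis_of_adj h
  have := (i (edgeAxis i j)).isLt
  have := (j (edgeAxis i j)).isLt
  omega

theorem coordSum_of_adj (h : (lattice n).Adj i j) : coordSum i % 2 ≠ coordSum j % 2 := by
  rcases isStep_or_isStep h with h | h
  · have := h.coordSum_eq; omega
  · have := h.coordSum_eq; omega

theorem IsTypedBy.iff_dartType (ho : IsOrientation o) (hc : IsTypedBy o c)
    (h : (lattice n).Adj i j) : o i j ↔ dartType c i j ≠ coordSum i % 2 := by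
  rcases isStep_or_isStep h with hs | hs
  · rw [hc _ _ _ hs, dartType, hs.edgeLow_eq]
  · rw [ho.xor _ _ h, hc _ _ _ hs, dartType_comm, dartType, hs.edgeAxis_eq, hs.edgeLow_eq]
    have := coordSum_of_adj h
    have := edgeType_lt c (edgeAxis i j) (j (edgeAxis i j)).val
    omega

theorem Face.axis_ne_normal {f : Face n} (h : (lattice n).Adj i j) (hi : i ∈ f.verts)
    (hj : j ∈ f.verts) : edgeAxis i j ≠ f.normal := by
  intro e
  have := val_axis_of_adj h
  rw [e, hi.1, hj.1] at this
  omega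

theorem Face.edgeLow_eq {f : Face n} (h : (lattice n).Adj i j) (hi : i ∈ f.verts)
    (hj : j ∈ f.verts) : edgeLow i j = (f.base (edgeAxis i j)).val := by
  have axis_ne := Face.axis_ne_normal h hi hj
  have := val_axis_of_adj h
  have := hi.2 _ axis_ne
  have := hj.2 _ axis_ne
  omega

theorem Face.eq_of_perpendicular {f g : Face n} (h : (lattice n).Adj i j)
    (h' : (lattice n).Adj k l) (hne : edgeAxis i j ≠ edgeAxis k l)
    (fi : i ∈ f.verts) (fj : j ∈ f.verts) (fk : k ∈ f.verts) (fl : l ∈ f.verts)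
    (gi : i ∈ g.verts) (gj : j ∈ g.verts) (gk : k ∈ g.verts) (gl : l ∈ g.verts) : f = g := by
  have hf := Face.axis_ne_normal h fi fj
  have hf' := Face.axis_ne_normal h' fk fl
  have normal_eq : f.normal = g.normal := eq_third_axis hne hf hf'
    (Face.axis_ne_normal h gi gj) (Face.axis_ne_normal h' gk gl)
  refine face_ext normal_eq fun d => ?_
  rcases axis_cases hne hf hf' d with rfl | rfl | rfl
  · rw [← Face.edgeLow_eq h fi fj, ← Face.edgeLow_eq h gi gj]
  · rw [← Face.edgeLow_eq h' fk fl, ← Face.edgeLow_eq h' gk gl]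
  · rw [← fi.1, normal_eq, ← gi.1]

theorem Face.exists_common_vertex {f : Face n} (h : (lattice n).Adj i j)
    (h' : (lattice n).Adj k l) (hne : edgeAxis i j ≠ edgeAxis k l)
    (fi : i ∈ f.verts) (fj : j ∈ f.verts) (fk : k ∈ f.verts) (fl : l ∈ f.verts) :
    i = k ∨ i = l ∨ j = k ∨ j = l := by
  have hf := Face.axis_ne_normal h fi fj
  have hf' := Face.axis_ne_normal h' fk fl
  have := Face.edgeLow_eq h fi fj
  have := Face.edgeLow_eq h' fk fl
  have := val_axis_of_adj h
  have := val_axis_of_adj h'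
  have := val_eq_of_adj h hne.symm
  have := val_eq_of_adj h' hne
  have := fi.2 _ hf'
  have := fk.2 _ hf
  by_cases e₁ : (i (edgeAxis i j)).val = (k (edgeAxis i j)).val <;>
    by_cases e₂ : (i (edgeAxis k l)).val = (k (edgeAxis k l)).val
  · exact Or.inl (Face.vert_ext hne hf hf' fi fk e₁ e₂)
  · exact Or.inr (Or.inl (Face.vert_ext hne hf hf' fi fl (by omega) (by omega)))
  · exact Or.inr (Or.inr (Or.inl (Face.vert_ext hne hf hf' fj fk (by omega) (by omega))))
  · exact Or.inr (Or.inr (Or.inr (Face.vert_ext hne hf hf' fj fl (by omega) (by omega))))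

theorem isOddFace_iff_edgeType (ho : IsCompactOrientation o) (hc : IsTypedBy o c) (f : Face n)
    {a b : Fin 3} (hab : a ≠ b) (ha : a ≠ f.normal) (hb : b ≠ f.normal) :
    IsOddFace o f ↔ edgeType c a (f.base a).val = edgeType c b (f.base b).val := by
  have hv := isStep_shift f.base a (f.lt ha)
  have hw := isStep_shift f.base b (f.lt hb)
  rw [ho.isOddFace_iff_base f hab ha hb hv hw, hc _ _ _ hv, hc _ _ _ hw]
  have := edgeType_lt c a (f.base a).val
  have := edgeType_lt c b (f.base b).val
  omega

theorem isOddFace_iff (ho : IsCompactOrientation o) (hc : IsTypedBy o c) (f : Face n) :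
    IsOddFace o f ↔ ∀ a b, a ≠ f.normal → b ≠ f.normal →
      edgeType c a (f.base a).val = edgeType c b (f.base b).val := by
  constructor
  · intro h a b ha hb
    by_cases hab : a = b
    · rw [hab]
    · exact (isOddFace_iff_edgeType ho hc f hab ha hb).mp h
  · intro h
    obtain ⟨a, b, hab, ha, hb, -⟩ := exists_other_axes f.normal
    exact (isOddFace_iff_edgeType ho hc f hab ha.symm hb.symm).mpr (h a b ha.symm hb.symm)

theorem dartType_eq_of_isOddFace (ho : IsCompactOrientation o) (hc : IsTypedBy o c) {f : Face n}
    (hf : IsOddFace o f) (h : (lattice n).Adj i j) (h' : (lattice n).Adj k l)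
    (fi : i ∈ f.verts) (fj : j ∈ f.verts) (fk : k ∈ f.verts) (fl : l ∈ f.verts) :
    dartType c i j = dartType c k l := by
  rw [dartType, dartType, Face.edgeLow_eq h fi fj, Face.edgeLow_eq h' fk fl]
  exact (isOddFace_iff ho hc f).mp hf _ _ (Face.axis_ne_normal h fi fj)
    (Face.axis_ne_normal h' fk fl)

theorem edgeAxis_ne_of_dartType_eq (hj : (lattice n).Adj i j) (hk : (lattice n).Adj i k)
    (hjk : j ≠ k) (ht : dartType c i j = dartType c i k) : edgeAxis i j ≠ edgeAxis i k := by
  intro e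
  have hj' := val_axis_of_adj hj
  have hk' := val_axis_of_adj hk
  rw [dartType, dartType, edgeType, edgeType, ← e] at ht
  rw [← e] at hk'
  have low_eq : edgeLow i j = edgeLow i k := by omega
  refine hjk (vertex_ext fun d => ?_)
  by_cases hd : d = edgeAxis i j
  · rw [hd]; omega
  · rw [← val_eq_of_adj hj hd, ← val_eq_of_adj hk (e ▸ hd)]

theorem exists_face_of_adj (hj : (lattice n).Adj i j) (hk : (lattice n).Adj i k)
    (hne : edgeAxis i j ≠ edgeAxis i k) :
    ∃ f : Face n, i ∈ f.verts ∧ j ∈ f.verts ∧ k ∈ f.verts := by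
  have base_val : ∀ d, ((i ⊓ j ⊓ k : Vertex n) d).val = min (min (i d).val (j d).val) (k d).val :=
    fun d => by simp only [Pi.inf_apply, Fin.coe_min]
  have := val_axis_of_adj hj
  have := val_axis_of_adj hk
  have := val_eq_of_adj hj hne.symm
  have := val_eq_of_adj hk hne
  have ltj := edgeLow_add_one_lt hj
  have ltk := edgeLow_add_one_lt hk
  have base_axis : ((i ⊓ j ⊓ k : Vertex n) (edgeAxis i j)).val = edgeLow i j := by
    rw [base_val]; omega
  have base_axis' : ((i ⊓ j ⊓ k : Vertex n) (edgeAxis i k)).val = edgeLow i k := by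
    rw [base_val]; omega
  obtain ⟨f, hbase, ha, hb⟩ := exists_face_of_lt (u := i ⊓ j ⊓ k) hne
    (by rwa [base_axis]) (by rwa [base_axis'])
  have val_eq_j := val_eq_of_adj hj ha.symm
  have val_eq_k := val_eq_of_adj hk hb.symm
  refine ⟨f, ⟨Fin.ext ?_, ?_⟩, ⟨Fin.ext ?_, ?_⟩, ⟨Fin.ext ?_, ?_⟩⟩ <;> rw [hbase]
  any_goals rw [base_val]; omega
  all_goals
    intro d hd
    rcases axis_cases hne ha hb d with rfl | rfl | rfl
    · rw [base_axis]; omega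
    · rw [base_axis']; omega
    · exact absurd rfl hd

theorem exists_isOddFace_of_dartType_eq (ho : IsCompactOrientation o) (hc : IsTypedBy o c)
    (hj : (lattice n).Adj i j) (hk : (lattice n).Adj i k) (hjk : j ≠ k)
    (ht : dartType c i j = dartType c i k) :
    ∃ f : Face n, IsOddFace o f ∧ i ∈ f.verts ∧ j ∈ f.verts ∧ k ∈ f.verts := by
  have hne := edgeAxis_ne_of_dartType_eq hj hk hjk ht
  obtain ⟨f, fi, fj, fk⟩ := exists_face_of_adj hj hk hne
  refine ⟨f, ?_, fi, fj, fk⟩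
  rwa [isOddFace_iff_edgeType ho hc f hne (Face.axis_ne_normal hj fi fj)
    (Face.axis_ne_normal hk fi fk), ← Face.edgeLow_eq hj fi fj, ← Face.edgeLow_eq hk fi fk]

end Typed

/-! ### The edge operators satisfy the relations of `M_G` -/

section Encoding

variable {n : Fin 3 → ℕ} {o : Vertex n → Vertex n → Prop} {c : Fin 3 → ℕ}
variable {i j k l : Vertex n}

open Classical in
/-- The one-qubit factors of the operator of the edge `(i, j)`. -/
def edgePauli (o : Vertex n → Vertex n → Prop) (i j : Vertex n) :
    Qubit o → Matrix (Fin 2) (Fin 2) ℂ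
  | Sum.inl u => if u = i then pauliX else if u = j then pauliY else 1
  | Sum.inr f => if i ∈ f.1.verts ∧ j ∈ f.1.verts then axisPauli (edgeAxis i j) else 1

theorem unsignedEdgeOp_eq (i j : Vertex n) :
    unsignedEdgeOp o i j = tensorOp (edgePauli o i j) := by
  rw [unsignedEdgeOp]
  congr 1

theorem unsignedEdgeOp_sq (i j : Vertex n) : unsignedEdgeOp o i j * unsignedEdgeOp o i j = 1 := by
  rw [unsignedEdgeOp_eq, tensorOp_mul]
  refine tensorOp_eq_one fun q => ?_
  rcases q with u | f <;> simp only [edgePauli] <;> split_ifs <;>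
    simp [pauliX_sq, pauliY_sq, axisPauli_sq]

theorem unsignedEdgeOp_comm (h : (lattice n).Adj i j) (h' : (lattice n).Adj k l)
    (hik : i ≠ k) (hil : i ≠ l) (hjk : j ≠ k) (hjl : j ≠ l) :
    unsignedEdgeOp o i j * unsignedEdgeOp o k l = unsignedEdgeOp o k l * unsignedEdgeOp o i j := by
  rw [unsignedEdgeOp_eq, unsignedEdgeOp_eq]
  refine tensorOp_commute fun q => ?_
  rcases q with u | f
  · simp only [edgePauli]
    split_ifs <;> simp_all
  · simp only [edgePauli]
    split_ifs with hf hf' <;> try simp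
    by_cases hne : edgeAxis i j = edgeAxis k l
    · rw [hne]
    · rcases Face.exists_common_vertex h h' hne hf.1 hf.2 hf'.1 hf'.2 with e | e | e | e
      · exact absurd e hik
      · exact absurd e hil
      · exact absurd e hjk
      · exact absurd e hjl

/- The edges have different types, hence no odd face in common: they anticommute at `j` only. -/
theorem unsignedEdgeOp_anticomm_of_head_tail (ho : IsCompactOrientation o) (hc : IsTypedBy o c)
    (hij : o i j) (hjl : o j l) (hil : i ≠ l) :
    unsignedEdgeOp o i j * unsignedEdgeOp o j l =
      -(unsignedEdgeOp o j l * unsignedEdgeOp o i j) := by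
  have h := ho.adj _ _ hij
  have h' := ho.adj _ _ hjl
  have type_ne : dartType c i j ≠ dartType c j l := by
    have := (hc.iff_dartType ho.toIsOrientation h).mp hij
    have := (hc.iff_dartType ho.toIsOrientation h').mp hjl
    have := coordSum_of_adj h
    have := dartType_lt c i j
    have := dartType_lt c j l
    omega
  rw [unsignedEdgeOp_eq, unsignedEdgeOp_eq]
  refine tensorOp_anticommute (Sum.inl j) ?_ fun q hq => ?_
  · simp [edgePauli, h.ne', pauliX_mul_pauliY]
  · rcases q with u | f
    · have : u ≠ j := fun e => hq (by rw [e])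
      simp only [edgePauli]
      split_ifs <;> simp_all
    · simp only [edgePauli]
      split_ifs with hf hf' <;> try simp
      exact absurd (dartType_eq_of_isOddFace ho hc f.2 h h' hf.1 hf.2 hf'.1 hf'.2) type_ne

theorem unsignedEdgeOp_anticomm_of_face (h : (lattice n).Adj i j) (h' : (lattice n).Adj k l)
    (hne : edgeAxis i j ≠ edgeAxis k l) {f : Face n} (hf : IsOddFace o f)
    (fi : i ∈ f.verts) (fj : j ∈ f.verts) (fk : k ∈ f.verts) (fl : l ∈ f.verts)
    (hv : ∀ u, edgePauli o i j (Sum.inl u) * edgePauli o k l (Sum.inl u) =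
      edgePauli o k l (Sum.inl u) * edgePauli o i j (Sum.inl u)) :
    unsignedEdgeOp o i j * unsignedEdgeOp o k l =
      -(unsignedEdgeOp o k l * unsignedEdgeOp o i j) := by
  rw [unsignedEdgeOp_eq, unsignedEdgeOp_eq]
  refine tensorOp_anticommute (Sum.inr ⟨f, hf⟩) ?_ fun q hq => ?_
  · simp [edgePauli, fi, fj, fk, fl, axisPauli_anticomm hne]
  · rcases q with u | g
    · exact hv u
    · simp only [edgePauli]
      split_ifs with hg hg' <;> try simp
      exact absurd (congrArg Sum.inr (Subtype.ext (Face.eq_of_perpendicular h h' hne hg.1 hg.2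
        hg'.1 hg'.2 fi fj fk fl))) hq

/- Edges that leave a common vertex have equal types and span an odd face: they commute at all
vertices, and anticommute at the qubit of that face. The same holds for edges that enter it. -/
theorem unsignedEdgeOp_anticomm_of_tail_tail (ho : IsCompactOrientation o) (hc : IsTypedBy o c)
    (hij : o i j) (hil : o i l) (hjl : j ≠ l) :
    unsignedEdgeOp o i j * unsignedEdgeOp o i l =
      -(unsignedEdgeOp o i l * unsignedEdgeOp o i j) := by
  have h := ho.adj _ _ hij
  have h' := ho.adj _ _ hil
  have type_eq : dartType c i j = dartType c i l := by
    have := (hc.iff_dartType ho.toIsOrientation h).mp hij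
    have := (hc.iff_dartType ho.toIsOrientation h').mp hil
    have := dartType_lt c i j
    have := dartType_lt c i l
    omega
  obtain ⟨f, hf, fi, fj, fl⟩ := exists_isOddFace_of_dartType_eq ho hc h h' hjl type_eq
  refine unsignedEdgeOp_anticomm_of_face h h' (edgeAxis_ne_of_dartType_eq h h' hjl type_eq)
    hf fi fj fi fl fun u => ?_
  simp only [edgePauli]
  split_ifs <;> simp_all

theorem unsignedEdgeOp_anticomm_of_head_head (ho : IsCompactOrientation o) (hc : IsTypedBy o c)
    (hij : o i j) (hkj : o k j) (hik : i ≠ k) :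
    unsignedEdgeOp o i j * unsignedEdgeOp o k j =
      -(unsignedEdgeOp o k j * unsignedEdgeOp o i j) := by
  have h := ho.adj _ _ hij
  have h' := ho.adj _ _ hkj
  have type_eq : dartType c j i = dartType c j k := by
    rw [dartType_comm, dartType_comm c j]
    have := (hc.iff_dartType ho.toIsOrientation h).mp hij
    have := (hc.iff_dartType ho.toIsOrientation h').mp hkj
    have := coordSum_of_adj h
    have := coordSum_of_adj h'
    have := dartType_lt c i j
    have := dartType_lt c k j
    omega
  obtain ⟨f, hf, fj, fi, fk⟩ := exists_isOddFace_of_dartType_eq ho hc h.symm h'.symm hik type_eq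
  have axis_ne := edgeAxis_ne_of_dartType_eq h.symm h'.symm hik type_eq
  rw [edgeAxis_comm, edgeAxis_comm j] at axis_ne
  refine unsignedEdgeOp_anticomm_of_face h h' axis_ne hf fi fj fk fj fun u => ?_
  simp only [edgePauli]
  have := h.ne
  have := h'.ne
  split_ifs <;> simp_all

theorem unsignedEdgeOp_anticomm (ho : IsCompactOrientation o) (hc : IsTypedBy o c)
    (hij : o i j) (hkl : o k l) (h : (i = k ∧ j ≠ l) ∨ (j = l ∧ i ≠ k) ∨ (j = k ∧ i ≠ l) ∨
      (i = l ∧ j ≠ k)) :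
    unsignedEdgeOp o i j * unsignedEdgeOp o k l =
      -(unsignedEdgeOp o k l * unsignedEdgeOp o i j) := by
  rcases h with ⟨rfl, hne⟩ | ⟨rfl, hne⟩ | ⟨rfl, hne⟩ | ⟨rfl, hne⟩
  · exact unsignedEdgeOp_anticomm_of_tail_tail ho hc hij hkl hne
  · exact unsignedEdgeOp_anticomm_of_head_head ho hc hij hkl hne
  · exact unsignedEdgeOp_anticomm_of_head_tail ho hc hij hkl hne
  · rw [unsignedEdgeOp_anticomm_of_head_tail ho hc hkl hij hne.symm, neg_neg]

theorem vertexOp_sq (v : Vertex n) : vertexOp o v * vertexOp o v = 1 := by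
  rw [vertexOp, tensorOp_mul]
  refine tensorOp_eq_one fun q => ?_
  rcases q with u | f
  · simp only
    split_ifs <;> simp [pauliZ_sq]
  · simp

theorem vertexOp_comm (u v : Vertex n) :
    vertexOp o u * vertexOp o v = vertexOp o v * vertexOp o u := by
  refine tensorOp_commute fun q => ?_
  rcases q with u | f
  · simp only
    split_ifs <;> simp
  · simp

theorem unsignedEdgeOp_comm_vertexOp {v : Vertex n} (hi : v ≠ i) (hj : v ≠ j) :
    unsignedEdgeOp o i j * vertexOp o v = vertexOp o v * unsignedEdgeOp o i j := by
  rw [unsignedEdgeOp_eq]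
  refine tensorOp_commute fun q => ?_
  rcases q with u | f
  · simp only [edgePauli]
    split_ifs <;> simp_all
  · simp

theorem unsignedEdgeOp_anticomm_vertexOp {v : Vertex n} (hij : i ≠ j) (h : v = i ∨ v = j) :
    unsignedEdgeOp o i j * vertexOp o v = -(vertexOp o v * unsignedEdgeOp o i j) := by
  rw [unsignedEdgeOp_eq]
  refine tensorOp_anticommute (Sum.inl v) ?_ fun q hq => ?_
  · rcases h with rfl | rfl
    · simp [edgePauli, pauliX_mul_pauliZ]
    · simp [edgePauli, hij.symm, pauliY_mul_pauliZ]
  · rcases q with u | f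
    · have : u ≠ v := fun e => hq (by rw [e])
      simp [this]
    · simp

variable (pick : Face n → Vertex n × Vertex n)

open Classical in
/-- The sign of the operator of an edge: `-1` if it was chosen for an isolated odd face. -/
def pickSign (o : Vertex n → Vertex n → Prop) (pick : Face n → Vertex n × Vertex n)
    (i j : Vertex n) : ℂ :=
  if ∃ f, IsIsolatedOddFace o f ∧ pick f = (i, j) then -1 else 1

theorem orientedEdgeOp_eq (i j : Vertex n) :
    orientedEdgeOp o pick i j = pickSign o pick i j • unsignedEdgeOp o i j := by
  rw [orientedEdgeOp, pickSign]
  split_ifs <;> simp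

theorem pickSign_mul_self (i j : Vertex n) :
    pickSign o pick i j * pickSign o pick i j = 1 := by
  rw [pickSign]
  split_ifs <;> simp

theorem exists_generatorOp_edge (ho : IsOrientation o) (e : (lattice n).Dart) :
    ∃ (s : ℂ) (i j : Vertex n), s * s = 1 ∧ o i j ∧
      ((i = e.fst ∧ j = e.snd) ∨ (i = e.snd ∧ j = e.fst)) ∧
      generatorOp o pick (.edge e) = s • unsignedEdgeOp o i j := by
  by_cases h : o e.fst e.snd
  · refine ⟨pickSign o pick e.fst e.snd, e.fst, e.snd, pickSign_mul_self _ _ _, h,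
      Or.inl ⟨rfl, rfl⟩, ?_⟩
    simp [generatorOp, h, orientedEdgeOp_eq]
  · refine ⟨-pickSign o pick e.snd e.fst, e.snd, e.fst, ?_, (ho.not_iff e.adj).mp h,
      Or.inr ⟨rfl, rfl⟩, ?_⟩
    · rw [neg_mul_neg, pickSign_mul_self]
    · simp [generatorOp, h, orientedEdgeOp_eq]

theorem generatorOp_phase_two : generatorOp o pick (.phase 2) = -1 := by
  rw [generatorOp, I_pow_val_two, neg_one_smul]

theorem generatorOp_edge_symm (ho : IsOrientation o) (e : (lattice n).Dart) :
    generatorOp o pick (.edge e) = -generatorOp o pick (.edge e.symm) := by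
  by_cases h : o e.fst e.snd
  · have h' : ¬ o e.snd e.fst := (ho.xor _ _ e.adj).mp h
    simp [generatorOp, h, h']
  · have h' := (ho.not_iff e.adj).mp h
    simp [generatorOp, h, h']

theorem generatorOp_edge_sq (ho : IsOrientation o) (e : (lattice n).Dart) :
    generatorOp o pick (.edge e) * generatorOp o pick (.edge e) = 1 := by
  obtain ⟨s, i, j, hs, -, -, h⟩ := exists_generatorOp_edge pick ho e
  rw [h, smul_mul_smul_comm, hs, unsignedEdgeOp_sq, one_smul]

theorem generatorOp_edge_comm_vertexOp (ho : IsOrientation o) (e : (lattice n).Dart)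
    (v : Vertex n) (hfst : v ≠ e.fst) (hsnd : v ≠ e.snd) :
    generatorOp o pick (.edge e) * vertexOp o v = vertexOp o v * generatorOp o pick (.edge e) := by
  obtain ⟨s, i, j, -, -, hij, h⟩ := exists_generatorOp_edge pick ho e
  rw [h, smul_mul_assoc, mul_smul_comm, unsignedEdgeOp_comm_vertexOp] <;>
    rcases hij with ⟨rfl, rfl⟩ | ⟨rfl, rfl⟩ <;> assumption

theorem generatorOp_edge_anticomm_vertexOp (ho : IsOrientation o) (e : (lattice n).Dart) :
    generatorOp o pick (.edge e) * vertexOp o e.snd =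
      -(vertexOp o e.snd * generatorOp o pick (.edge e)) := by
  obtain ⟨s, i, j, -, oij, hij, h⟩ := exists_generatorOp_edge pick ho e
  rw [h, smul_mul_assoc, mul_smul_comm,
    unsignedEdgeOp_anticomm_vertexOp (ho.adj _ _ oij).ne (by tauto), smul_neg]

theorem generatorOp_edge_comm_edge (ho : IsOrientation o) (e f : (lattice n).Dart)
    (h₁ : e.fst ≠ f.fst) (h₂ : e.fst ≠ f.snd) (h₃ : e.snd ≠ f.fst) (h₄ : e.snd ≠ f.snd) :
    generatorOp o pick (.edge e) * generatorOp o pick (.edge f) =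
      generatorOp o pick (.edge f) * generatorOp o pick (.edge e) := by
  obtain ⟨s, i, j, -, oij, hij, he⟩ := exists_generatorOp_edge pick ho e
  obtain ⟨t, k, l, -, okl, hkl, hf⟩ := exists_generatorOp_edge pick ho f
  rw [he, hf, smul_mul_smul_comm, smul_mul_smul_comm, mul_comm s t,
    unsignedEdgeOp_comm (ho.adj _ _ oij) (ho.adj _ _ okl)] <;>
  rcases hij with ⟨rfl, rfl⟩ | ⟨rfl, rfl⟩ <;> rcases hkl with ⟨rfl, rfl⟩ | ⟨rfl, rfl⟩ <;>
    assumption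

theorem generatorOp_edge_anticomm_edge (ho : IsCompactOrientation o) (hc : IsTypedBy o c)
    (e f : (lattice n).Dart) (hef : e.snd = f.fst) (hne : e.fst ≠ f.snd) :
    generatorOp o pick (.edge e) * generatorOp o pick (.edge f) =
      -(generatorOp o pick (.edge f) * generatorOp o pick (.edge e)) := by
  obtain ⟨s, i, j, -, oij, hij, he⟩ := exists_generatorOp_edge pick ho.toIsOrientation e
  obtain ⟨t, k, l, -, okl, hkl, hf⟩ := exists_generatorOp_edge pick ho.toIsOrientation f
  rw [he, hf, smul_mul_smul_comm, smul_mul_smul_comm, mul_comm s t,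
    unsignedEdgeOp_anticomm ho hc oij okl, smul_neg]
  rcases hij with ⟨rfl, rfl⟩ | ⟨rfl, rfl⟩ <;> rcases hkl with ⟨rfl, rfl⟩ | ⟨rfl, rfl⟩ <;> tauto

theorem satisfiesRelations_generatorOp (ho : IsCompactOrientation o) (hc : IsTypedBy o c) :
    SatisfiesRelations (generatorOp o pick) where
  phase_zero := by simp [generatorOp]
  phase_mul k l := by simp [generatorOp, smul_smul, mul_comm, ← I_pow_val_add]
  phase_central k g := by simp [generatorOp]
  edge_sq := generatorOp_edge_sq pick ho.toIsOrientation
  vert_sq := vertexOp_sq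
  edge_symm e := by
    rw [generatorOp_phase_two, neg_one_mul, generatorOp_edge_symm pick ho.toIsOrientation]
  vert_comm_vert := vertexOp_comm
  edge_comm_vert := generatorOp_edge_comm_vertexOp pick ho.toIsOrientation
  edge_comm_edge := generatorOp_edge_comm_edge pick ho.toIsOrientation
  edge_anticomm_vert e := by
    rw [generatorOp_phase_two, neg_one_mul]
    exact generatorOp_edge_anticomm_vertexOp pick ho.toIsOrientation e
  edge_anticomm_edge e f hef hne := by
    rw [generatorOp_phase_two, neg_one_mul, generatorOp_edge_anticomm_edge pick ho hc e f hef hne]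

theorem exists_isCubicEncoding (ho : IsCompactOrientation o) (hc : IsTypedBy o c) :
    ∃ σ : MG (lattice n) →* QubitOp (Qubit o), IsCubicEncoding o pick σ :=
  ⟨(satisfiesRelations_generatorOp pick ho hc).lift,
    (satisfiesRelations_generatorOp pick ho hc).lift_gen⟩

end Encoding

/-! ### Signs of cycles -/

section Signs

variable {V E R : Type*} {G : SimpleGraph V} [DecidableEq E] [Ring R]

/-- The sign `(-1) ^ k` of an element of `M_G` in which `k` edges of `s` occur, counted with
multiplicity. -/
def edgeSign (L : EdgeLabelling G E) (s : Finset E) : MG G →* ℤˣ where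
  toFun g := (-1) ^ ∑ e ∈ s, (edgeHom L g).toAdd e
  map_one' := by simp
  map_mul' g h := by
    simp only [map_mul, toAdd_mul, Pi.add_apply, Finset.sum_add_distrib, uzpow_add]

theorem edgeSign_apply (L : EdgeLabelling G E) (s : Finset E) (g : MG G) :
    edgeSign L s g = (-1) ^ ∑ e ∈ s, (edgeHom L g).toAdd e := rfl

theorem edgeSign_phase (L : EdgeLabelling G E) (s : Finset E) (k : ZMod 4) :
    edgeSign L s (gen (.phase k)) = 1 := by
  simp [edgeSign_apply, edgeHom_phase]

theorem edgeSign_edge (L : EdgeLabelling G E) (s : Finset E) (e : G.Dart) :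
    edgeSign L s (gen (.edge e)) = if L.label e ∈ s then -1 else 1 := by
  rw [edgeSign_apply, edgeHom_edge, toAdd_ofAdd, Finset.sum_pi_single']
  split_ifs <;> simp

/-- Conjugation by the involution `T`, twisted by a character with values `±1`. -/
def signedConj {M : Type*} [Monoid M] (σ : M →* R) (χ : M →* ℤˣ) {T : R} (hT : T * T = 1) :
    M →* R where
  toFun g := χ g • (T * σ g * T)
  map_one' := by simp [hT]
  map_mul' g h := by
    have conj_mul : T * σ (g * h) * T = (T * σ g * T) * (T * σ h * T) := by
      rw [map_mul, mul_assoc (T * σ g), ← mul_assoc T (T * σ h), ← mul_assoc T T, hT, one_mul,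
        mul_assoc, mul_assoc, mul_assoc]
    rw [map_mul χ, conj_mul, smul_mul_smul_comm]

theorem signedConj_apply {M : Type*} [Monoid M] (σ : M →* R) (χ : M →* ℤˣ) {T : R}
    (hT : T * T = 1) (g : M) : signedConj σ χ hT g = χ g • (T * σ g * T) := rfl

theorem sum_edgeHom_eq_zero_of_commute [NeZero (2 : R)] (L : EdgeLabelling G E) {σ : MG G →* R}
    {T : R} (hT : T * T = 1) {s : Finset E}
    (hphase : ∀ k, σ (gen (.phase k)) * T = T * σ (gen (.phase k)))
    (hmem : ∀ e, L.label e ∈ s → σ (gen (.edge e)) * T = -(T * σ (gen (.edge e))))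
    (hnot : ∀ e, L.label e ∉ s → σ (gen (.edge e)) * T = T * σ (gen (.edge e)))
    {x : MG G} (hx : x ∈ cycleGroup G) (hcomm : σ x * T = T * σ x) :
    ∑ e ∈ s, (edgeHom L x).toAdd e = 0 := by
  have eq_smul_conj : σ x = edgeSign L s x • (T * σ x * T) := by
    refine eqOn_cycleGroup (β := signedConj σ (edgeSign L s) hT) (fun k => ?_) (fun e => ?_) hx
    · rw [signedConj_apply, edgeSign_phase, one_smul, ← hphase, mul_assoc, hT, mul_one]
    · rw [signedConj_apply, edgeSign_edge]
      split_ifs with he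
      · rw [Units.neg_smul, one_smul, ← neg_mul, ← hmem e he, mul_assoc, hT, mul_one]
      · rw [one_smul, ← hnot e he, mul_assoc, hT, mul_one]
  by_contra hne
  have sum_eq_one : ∑ e ∈ s, (edgeHom L x).toAdd e = 1 :=
    ((by decide : ∀ a : ZMod 2, a = 0 ∨ a = 1) _).resolve_left hne
  rw [← hcomm, mul_assoc, hT, mul_one, edgeSign_apply, sum_eq_one, uzpow_one, Units.neg_smul,
    one_smul] at eq_smul_conj
  have two_mul_eq_zero : 2 * σ x = 0 := by
    rw [two_mul]
    nth_rw 1 [eq_smul_conj]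
    exact neg_add_cancel _
  refine two_ne_zero (α := R) ?_
  rw [← mul_one (2 : R), ← map_one σ, ← mul_inv_cancel x, map_mul, ← mul_assoc, two_mul_eq_zero,
    zero_mul]

end Signs

section LatticeEdges

variable {n : Fin 3 → ℕ} {o : Vertex n → Vertex n → Prop} {c : Fin 3 → ℕ}
variable {i j k l u v : Vertex n} {d : Fin 3}

/-! ### The edges of the box -/

variable (n) in
/-- Undirected edges of the box, given by their axis and their lower end. -/
abbrev LatticeEdge : Type :=
  {p : Fin 3 × Vertex n // (p.2 p.1).val + 1 < n p.1}

theorem IsStep.inf_eq (h : IsStep d u v) : u ⊓ v = u :=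
  vertex_ext fun k => by
    simp only [Pi.inf_apply, Fin.coe_min]
    by_cases hk : k = d
    · subst hk; have := h.val_add_one; omega
    · have := h.val_eq hk; omega

/-- The undirected edge between two adjacent vertices. -/
def edgeOfAdj (h : (lattice n).Adj i j) : LatticeEdge n :=
  ⟨(edgeAxis i j, i ⊓ j), by
    simp only [Pi.inf_apply, Fin.coe_min]
    exact edgeLow_add_one_lt h⟩

theorem edgeOfAdj_comm (h : (lattice n).Adj i j) : edgeOfAdj h.symm = edgeOfAdj h :=
  Subtype.ext (Prod.ext (edgeAxis_comm j i) (inf_comm j i))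

theorem IsStep.edgeOfAdj_eq (h : IsStep d u v) : edgeOfAdj h.adj = ⟨(d, u), h.lt⟩ :=
  Subtype.ext (Prod.ext h.edgeAxis_eq h.inf_eq)

theorem IsStep.eq_of_edgeOfAdj_eq {a b : Fin 3} (h : IsStep a i j) (h' : IsStep b k l)
    (e : edgeOfAdj h.adj = edgeOfAdj h'.adj) : i = k ∧ j = l := by
  rw [h.edgeOfAdj_eq, h'.edgeOfAdj_eq] at e
  obtain ⟨rfl, rfl⟩ := Prod.ext_iff.mp (Subtype.ext_iff.mp e)
  exact ⟨rfl, h.eq_of_left h'⟩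

theorem edgeOfAdj_eq_iff (h : (lattice n).Adj i j) (h' : (lattice n).Adj k l) :
    edgeOfAdj h = edgeOfAdj h' ↔ (i = k ∧ j = l) ∨ (i = l ∧ j = k) := by
  constructor
  · intro e
    rcases isStep_or_isStep h with hs | hs <;> rcases isStep_or_isStep h' with hs' | hs'
    · exact Or.inl (hs.eq_of_edgeOfAdj_eq hs' e)
    · exact Or.inr (hs.eq_of_edgeOfAdj_eq hs' (e.trans (edgeOfAdj_comm h').symm))
    · exact Or.inr (hs.eq_of_edgeOfAdj_eq hs' ((edgeOfAdj_comm h).trans e)).symm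
    · exact Or.inl (hs.eq_of_edgeOfAdj_eq hs'
        ((edgeOfAdj_comm h).trans (e.trans (edgeOfAdj_comm h').symm))).symm
  · rintro (⟨rfl, rfl⟩ | ⟨rfl, rfl⟩)
    · rfl
    · exact (edgeOfAdj_comm h').symm ▸ rfl

variable (n) in
/-- The labelling of the edges of the box by axis and lower end. -/
def latticeLabelling : EdgeLabelling (lattice n) (LatticeEdge n) where
  label e := edgeOfAdj e.adj
  surjective := by
    rintro ⟨⟨d, u⟩, h⟩
    exact ⟨⟨(u, shift u d h), (isStep_shift u d h).adj⟩, (isStep_shift u d h).edgeOfAdj_eq⟩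
  eq_iff e f := by
    rw [edgeOfAdj_eq_iff]
    constructor
    · rintro (⟨h, h'⟩ | ⟨h, h'⟩)
      · left; ext <;> simp [h, h']
      · right; ext <;> simp [h, h']
    · rintro (rfl | rfl)
      · exact Or.inl ⟨rfl, rfl⟩
      · exact Or.inr ⟨rfl, rfl⟩

theorem lattice_preconnected : (lattice n).Preconnected := by
  rcases isEmpty_or_nonempty (Vertex n) with hV | ⟨⟨w⟩⟩
  · exact fun u => (hV.false u).elim
  let z : Vertex n := fun d => ⟨0, (w d).pos⟩
  have reachable : ∀ m (u : Vertex n), coordSum u = m → (lattice n).Reachable z u := by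
    intro m
    induction m with
    | zero =>
      intro u hu
      rw [show z = u from vertex_ext fun k =>
        (Finset.sum_eq_zero_iff.mp hu k (Finset.mem_univ k)).symm]
    | succ m ih =>
      intro u hu
      obtain ⟨k, hk⟩ := exists_pos_of_coordSum_pos (u := u) (by omega)
      obtain ⟨u', hu'⟩ := exists_isStep_of_pos hk
      have := hu'.coordSum_eq
      exact (ih u' (by omega)).trans hu'.adj.reachable
  exact fun u v => (reachable _ u rfl).symm.trans (reachable _ v rfl)

/-! ### Test operators -/

/-- The operator that acts with `P` on the qubit `q` and trivially on all others. -/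
def singleOp {Q : Type*} [Fintype Q] [DecidableEq Q] (q : Q) (P : Matrix (Fin 2) (Fin 2) ℂ) :
    QubitOp Q :=
  tensorOp fun q' => if q' = q then P else 1

section SingleOp

variable {Q : Type*} [Fintype Q] [DecidableEq Q] {q : Q} {P : Matrix (Fin 2) (Fin 2) ℂ}
variable {M : Q → Matrix (Fin 2) (Fin 2) ℂ}

theorem singleOp_sq (h : P * P = 1) : singleOp q P * singleOp q P = 1 := by
  rw [singleOp, tensorOp_mul]
  refine tensorOp_eq_one fun q' => ?_
  split_ifs <;> simp [h]

theorem tensorOp_commute_singleOp (h : M q * P = P * M q) :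
    tensorOp M * singleOp q P = singleOp q P * tensorOp M := by
  refine tensorOp_commute fun q' => ?_
  split_ifs with hq
  · rw [hq, h]
  · rw [mul_one, one_mul]

theorem tensorOp_anticommute_singleOp (h : M q * P = -(P * M q)) :
    tensorOp M * singleOp q P = -(singleOp q P * tensorOp M) := by
  refine tensorOp_anticommute q ?_ fun q' hq => ?_
  · rw [if_pos rfl, h]
  · rw [if_neg hq, mul_one, one_mul]

end SingleOp

theorem generatorOp_edge_eq (ho : IsOrientation o) (pick : Face n → Vertex n × Vertex n)
    (e : (lattice n).Dart) : ∃ (s : ℂ) (i j : Vertex n) (h : o i j),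
      edgeOfAdj (ho.adj i j h) = edgeOfAdj e.adj ∧
      generatorOp o pick (.edge e) = s • tensorOp (edgePauli o i j) := by
  obtain ⟨s, i, j, -, oij, hij, he⟩ := exists_generatorOp_edge pick ho e
  exact ⟨s, i, j, oij, (edgeOfAdj_eq_iff _ _).mpr hij, by rw [he, unsignedEdgeOp_eq]⟩

/- An edge operator commutes or anticommutes with a Pauli operator on a single qubit according to
its factor at this qubit. -/
theorem sum_edgeHom_eq_zero_of_commute_singleOp (ho : IsOrientation o)
    {pick : Face n → Vertex n × Vertex n} {σ : MG (lattice n) →* QubitOp (Qubit o)}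
    (hσ : IsCubicEncoding o pick σ) {q : Qubit o} {P : Matrix (Fin 2) (Fin 2) ℂ} (hP : P * P = 1)
    {s : Finset (LatticeEdge n)}
    (hmem : ∀ i j (h : o i j), edgeOfAdj (ho.adj i j h) ∈ s →
      edgePauli o i j q * P = -(P * edgePauli o i j q))
    (hnot : ∀ i j (h : o i j), edgeOfAdj (ho.adj i j h) ∉ s →
      edgePauli o i j q * P = P * edgePauli o i j q)
    {x : MG (lattice n)} (hx : x ∈ cycleGroup (lattice n))
    (hcomm : σ x * singleOp q P = singleOp q P * σ x) :
    ∑ e ∈ s, (edgeHom (latticeLabelling n) x).toAdd e = 0 := by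
  have : NeZero (2 : QubitOp (Qubit o)) := ⟨fun h => by
    have h' : (1 + 1 : QubitOp (Qubit o)) = 0 := one_add_one_eq_two.trans h
    have := congrFun (congrFun h' 0) 0
    norm_num [Matrix.add_apply] at this⟩
  refine sum_edgeHom_eq_zero_of_commute (latticeLabelling n) (singleOp_sq hP) (fun k => ?_)
    (fun e he => ?_) (fun e he => ?_) hx hcomm
  · rw [hσ, generatorOp, smul_mul_assoc, one_mul, mul_smul_comm, mul_one]
  · obtain ⟨s, i, j, hij, hlabel, heq⟩ := generatorOp_edge_eq ho pick e
    rw [hσ, heq, smul_mul_assoc, mul_smul_comm,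
      tensorOp_anticommute_singleOp (hmem i j hij (hlabel ▸ he)), smul_neg]
  · obtain ⟨s, i, j, hij, hlabel, heq⟩ := generatorOp_edge_eq ho pick e
    rw [hσ, heq, smul_mul_assoc, mul_smul_comm,
      tensorOp_commute_singleOp (hnot i j hij (hlabel ▸ he))]

end LatticeEdges

section Balanced

variable {n : Fin 3 → ℕ} {o : Vertex n → Vertex n → Prop} {c : Fin 3 → ℕ}
variable {i j u v u' v' : Vertex n} {d k : Fin 3} {τ : Fin 2} {O : Vertex n}

/-! ### Cycles whose operators are scalars -/

/-- The vertex `O` is the lowest vertex of the box in an odd cell of type `τ` of the infinite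
lattice, and this cell has edges in the box along the axis `d`. -/
structure IsCellEdge (c : Fin 3 → ℕ) (τ : Fin 2) (O : Vertex n) (d : Fin 3) : Prop where
  low : ∀ k, (O k).val = 0 ∨ edgeType c k (O k).val = τ.val
  type_eq : edgeType c d (O d).val = τ.val
  lt : (O d).val + 1 < n d

open Classical in
/-- The values of `z` on the edges at the lowest vertices of the odd cells, which are indexed by
their type and their lowest vertex. -/
def cellValues (c : Fin 3 → ℕ) :
    (LatticeEdge n → ZMod 2) →ₗ[ZMod 2] (Fin 2 × Vertex n → Fin 3 → ZMod 2) :=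
  LinearMap.pi fun p => LinearMap.pi fun d =>
    if h : IsCellEdge c p.1 p.2 d then LinearMap.proj ⟨(d, p.2), h.lt⟩ else 0

theorem cellValues_of_isCellEdge (h : IsCellEdge c τ O d) (z : LatticeEdge n → ZMod 2) :
    cellValues c z (τ, O) d = z ⟨(d, O), h.lt⟩ := by
  simp [cellValues, h]

theorem cellValues_of_not_isCellEdge (h : ¬ IsCellEdge c τ O d) (z : LatticeEdge n → ZMod 2) :
    cellValues c z (τ, O) d = 0 := by
  simp [cellValues, h]

open Classical in
/-- The edges at the lowest vertex `O` of an odd cell of type `τ`. -/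
def cellEdges (c : Fin 3 → ℕ) (τ : Fin 2) (O : Vertex n) : Finset (LatticeEdge n) :=
  {e | e.1.2 = O ∧ IsCellEdge c τ O e.1.1}

theorem mem_cellEdges {e : LatticeEdge n} :
    e ∈ cellEdges c τ O ↔ e.1.2 = O ∧ IsCellEdge c τ O e.1.1 := by
  simp [cellEdges]

theorem sum_cellValues (z : LatticeEdge n → ZMod 2) (τ : Fin 2) (O : Vertex n) :
    ∑ d, cellValues c z (τ, O) d = ∑ e ∈ cellEdges c τ O, z e := by
  rw [← Finset.sum_fiberwise (cellEdges c τ O) (fun e => e.1.1) z]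
  refine Finset.sum_congr rfl fun d _ => ?_
  by_cases h : IsCellEdge c τ O d
  · have fiber : {e ∈ cellEdges c τ O | e.1.1 = d} = {⟨(d, O), h.lt⟩} := by
      ext e
      simp only [Finset.mem_filter, mem_cellEdges, Finset.mem_singleton, Subtype.ext_iff,
        Prod.ext_iff]
      exact ⟨fun he => ⟨he.2, he.1.1⟩, fun he => ⟨⟨he.2, he.1 ▸ h⟩, he.1⟩⟩
    rw [cellValues_of_isCellEdge h, fiber, Finset.sum_singleton]
  · have fiber : {e ∈ cellEdges c τ O | e.1.1 = d} = ∅ :=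
      Finset.filter_eq_empty_iff.mpr fun e he hd => h (hd ▸ (mem_cellEdges.mp he).2)
    rw [cellValues_of_not_isCellEdge h, fiber, Finset.sum_empty]

theorem IsStep.edgeOfAdj_mem_cellEdges_iff
    (low : ∀ k, (O k).val = 0 ∨ edgeType c k (O k).val = τ.val) (h : IsStep d i j) :
    edgeOfAdj h.adj ∈ cellEdges c τ O ↔ (O = i ∨ O = j) ∧ dartType c i j = τ.val := by
  rw [mem_cellEdges, h.edgeOfAdj_eq, dartType, h.edgeAxis_eq, h.edgeLow_eq]
  constructor
  · rintro ⟨rfl, h⟩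
    exact ⟨Or.inl rfl, h.type_eq⟩
  · rintro ⟨rfl | rfl, ht⟩
    · exact ⟨rfl, low, ht, h.lt⟩
    · have := h.val_add_one
      have := low d
      rw [edgeType] at ht this
      omega

theorem edgeOfAdj_mem_cellEdges_iff
    (low : ∀ k, (O k).val = 0 ∨ edgeType c k (O k).val = τ.val) (h : (lattice n).Adj i j) :
    edgeOfAdj h ∈ cellEdges c τ O ↔ (O = i ∨ O = j) ∧ dartType c i j = τ.val := by
  rcases isStep_or_isStep h with h' | h'
  · exact h'.edgeOfAdj_mem_cellEdges_iff low
  · rw [← edgeOfAdj_comm h, dartType_comm, or_comm]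
    exact h'.edgeOfAdj_mem_cellEdges_iff low

/-- The conditions on the edges of a cycle under which its operator is a scalar: an even number of
the edges at each lowest vertex of an odd cell, and both or none of two opposite edges of an odd
face. -/
def balanced (c : Fin 3 → ℕ) : Submodule (ZMod 2) (LatticeEdge n → ZMod 2) where
  carrier := {z | (∀ p, ∑ d, cellValues c z p d = 0) ∧
    ∀ (d k : Fin 3) (u v u' v' : Vertex n) (h : IsStep d u v) (h' : IsStep d u' v'),
      IsStep k u u' → d ≠ k → edgeType c d (u d).val = edgeType c k (u k).val →
      z (edgeOfAdj h.adj) = z (edgeOfAdj h'.adj)}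
  zero_mem' := by simp
  add_mem' := by
    rintro z z' ⟨h₁, h₂⟩ ⟨h₁', h₂'⟩
    refine ⟨fun p => ?_, fun d k u v u' v' h h' hu hdk ht => ?_⟩
    · simp only [map_add, Pi.add_apply, Finset.sum_add_distrib, h₁, h₁', add_zero]
    · rw [Pi.add_apply, Pi.add_apply, h₂ d k u v u' v' h h' hu hdk ht,
        h₂' d k u v u' v' h h' hu hdk ht]
  smul_mem' := by
    rintro a z ⟨h₁, h₂⟩
    refine ⟨fun p => ?_, fun d k u v u' v' h h' hu hdk ht => ?_⟩
    · simp only [map_smul, Pi.smul_apply, ← Finset.smul_sum, h₁, smul_zero]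
    · rw [Pi.smul_apply, Pi.smul_apply, h₂ d k u v u' v' h h' hu hdk ht]

/- An edge is moved towards the lowest vertex of an odd cell across odd faces. -/
theorem eq_zero_of_cellValues_eq_zero {z : LatticeEdge n → ZMod 2} (hz : z ∈ balanced c)
    (hcell : cellValues c z = 0) : z = 0 := by
  suffices ∀ (m : ℕ) (d : Fin 3) (u : Vertex n) (h : (u d).val + 1 < n d), coordSum u = m →
      z ⟨(d, u), h⟩ = 0 from funext fun ⟨⟨d, u⟩, h⟩ => this _ d u h rfl
  intro m
  induction m with intro d u h hm
  | zero =>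
    have hd : IsCellEdge c ⟨edgeType c d (u d).val, edgeType_lt _ _ _⟩ u d :=
      ⟨fun k => Or.inl (Finset.sum_eq_zero_iff.mp hm k (Finset.mem_univ k)), rfl, h⟩
    rw [← cellValues_of_isCellEdge hd z, hcell]
    rfl
  | succ m ih =>
    by_cases low : ∀ k, (u k).val = 0 ∨ edgeType c k (u k).val = edgeType c d (u d).val
    · have hd : IsCellEdge c ⟨edgeType c d (u d).val, edgeType_lt _ _ _⟩ u d := ⟨low, rfl, h⟩
      rw [← cellValues_of_isCellEdge hd z, hcell]
      rfl
    · push Not at low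
      obtain ⟨k, pos, type_ne⟩ := low
      have hdk : d ≠ k := fun e => type_ne (by rw [e])
      obtain ⟨u', hu'⟩ := exists_isStep_of_pos (Nat.pos_of_ne_zero pos)
      have hd := hu'.val_eq hdk
      obtain ⟨v', hv'⟩ := exists_isStep (u := u') (d := d) (by omega)
      have hv := isStep_shift u d h
      have type_eq : edgeType c d (u' d).val = edgeType c k (u' k).val := by
        have := hu'.val_add_one
        rw [edgeType, edgeType] at type_ne ⊢
        omega
      have move := hz.2 d k u' v' u _ hv' hv hu' hdk type_eq
      rw [hv'.edgeOfAdj_eq, hv.edgeOfAdj_eq] at move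
      have := hu'.coordSum_eq
      rw [← move]
      exact ih d u' _ (by omega)

/- The test operator is `X` or `Y` at `O`, whichever is carried there by the edges of the type that
is not `τ`. -/
theorem sum_cellValues_eq_zero (ho : IsCompactOrientation o) (hc : IsTypedBy o c)
    {pick : Face n → Vertex n × Vertex n} {σ : MG (lattice n) →* QubitOp (Qubit o)}
    (hσ : IsCubicEncoding o pick σ) {x : MG (lattice n)} (hx : x ∈ cycleGroup (lattice n))
    (hcomm : ∀ T, σ x * T = T * σ x) (τ : Fin 2) (O : Vertex n) :
    ∑ d, cellValues c (edgeHom (latticeLabelling n) x).toAdd (τ, O) d = 0 := by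
  by_cases low : ∀ k, (O k).val = 0 ∨ edgeType c k (O k).val = τ.val
  swap
  · exact Finset.sum_eq_zero fun d _ => cellValues_of_not_isCellEdge (fun h => low h.low) _
  rw [sum_cellValues]
  have type_ne : ∀ i j, o i j → dartType c i j ≠ coordSum i % 2 ∧
      dartType c i j = coordSum j % 2 ∧ i ≠ j := fun i j hij => by
    have h := ho.adj i j hij
    have := (hc.iff_dartType ho.toIsOrientation h).mp hij
    have := coordSum_of_adj h
    have := dartType_lt c i j
    exact ⟨by omega, by omega, h.ne⟩
  refine sum_edgeHom_eq_zero_of_commute_singleOp ho.toIsOrientation hσ (q := Sum.inl O)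
    (P := if τ.val = coordSum O % 2 then pauliX else pauliY)
    (by split_ifs <;> simp [pauliX_sq, pauliY_sq]) ?_ ?_ hx (hcomm _) <;>
  intro i j hij <;>
  rw [edgeOfAdj_mem_cellEdges_iff low] <;>
  obtain ⟨hi, hj, hne⟩ := type_ne i j hij <;>
  simp only [edgePauli]
  · rintro ⟨rfl | rfl, ht⟩
    · simp [show ¬ τ.val = coordSum O % 2 by omega, pauliX_mul_pauliY]
    · simp [show τ.val = coordSum O % 2 by omega, hne.symm, pauliX_mul_pauliY]
  · intro h
    by_cases hi' : O = i
    · have : τ.val = coordSum i % 2 := by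
        have : dartType c i j ≠ τ.val := fun ht => h ⟨Or.inl hi', ht⟩
        have := dartType_lt c i j
        have := τ.isLt
        omega
      simp [this, hi']
    by_cases hj' : O = j
    · have : ¬ τ.val = coordSum j % 2 := fun ht => h ⟨Or.inr hj', by rw [hj, ht]⟩
      simp [this, hj', hne.symm]
    · simp [hi', hj']

theorem Face.eq_or_eq_of_isStep {f : Face n} (hdk : d ≠ k) (hd : d ≠ f.normal) (hk : k ≠ f.normal)
    (hu : IsStep k f.base u') (h : IsStep d i j) (fi : i ∈ f.verts) (fj : j ∈ f.verts) :
    i = f.base ∨ i = u' := by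
  have fu := Face.mem_verts_of_isStep hu hk f.base_mem_verts rfl
  have low := Face.edgeLow_eq h.adj fi fj
  rw [h.edgeAxis_eq, h.edgeLow_eq] at low
  rcases fi.2 k hk with hik | hik
  · exact Or.inl (Face.vert_ext hdk hd hk fi f.base_mem_verts low hik)
  · exact Or.inr (Face.vert_ext hdk hd hk fi fu (by rw [hu.val_eq hdk, low])
      (by rw [hu.val_add_one, hik]))

theorem Face.edgeOfAdj_eq_or_iff {f : Face n} (hdk : d ≠ k) (hd : d ≠ f.normal)
    (hk : k ≠ f.normal) (hu : IsStep k f.base u') (hv : IsStep d f.base v) (hv' : IsStep d u' v')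
    (h : (lattice n).Adj i j) :
    edgeOfAdj h = edgeOfAdj hv.adj ∨ edgeOfAdj h = edgeOfAdj hv'.adj ↔
      i ∈ f.verts ∧ j ∈ f.verts ∧ edgeAxis i j = d := by
  have fu := f.base_mem_verts
  have fu' := Face.mem_verts_of_isStep hu hk fu rfl
  have fv := Face.mem_verts_of_isStep hv hd fu rfl
  have fv' := Face.mem_verts_of_isStep hv' hd fu' (hu.val_eq hdk)
  have axis_v := hv.edgeAxis_eq
  have axis_v' := hv'.edgeAxis_eq
  constructor
  · simp only [edgeOfAdj_eq_iff]
    rintro ((⟨rfl, rfl⟩ | ⟨rfl, rfl⟩) | (⟨rfl, rfl⟩ | ⟨rfl, rfl⟩))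
    · exact ⟨fu, fv, axis_v⟩
    · exact ⟨fv, fu, edgeAxis_comm _ _ ▸ axis_v⟩
    · exact ⟨fu', fv', axis_v'⟩
    · exact ⟨fv', fu', edgeAxis_comm _ _ ▸ axis_v'⟩
  · rintro ⟨fi, fj, rfl⟩
    rw [edgeOfAdj_eq_iff, edgeOfAdj_eq_iff]
    rcases isStep_or_isStep h with h' | h'
    · rcases Face.eq_or_eq_of_isStep hdk hd hk hu h' fi fj with rfl | rfl
      · exact Or.inl (Or.inl ⟨rfl, h'.eq_of_left hv⟩)
      · exact Or.inr (Or.inl ⟨rfl, h'.eq_of_left hv'⟩)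
    · rcases Face.eq_or_eq_of_isStep hdk hd hk hu h' fj fi with rfl | rfl
      · exact Or.inl (Or.inr ⟨h'.eq_of_left hv, rfl⟩)
      · exact Or.inr (Or.inr ⟨h'.eq_of_left hv', rfl⟩)

/- The test operator acts on the face as the edges along the axis `k` do. -/
theorem opposite_edges_eq (ho : IsOrientation o)
    {pick : Face n → Vertex n × Vertex n} {σ : MG (lattice n) →* QubitOp (Qubit o)}
    (hσ : IsCubicEncoding o pick σ) {x : MG (lattice n)} (hx : x ∈ cycleGroup (lattice n))
    (hcomm : ∀ T, σ x * T = T * σ x) {f : Face n} (hf : IsOddFace o f) (hdk : d ≠ k)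
    (hd : d ≠ f.normal) (hk : k ≠ f.normal) (hu : IsStep k f.base u') (hv : IsStep d f.base v)
    (hv' : IsStep d u' v') :
    (edgeHom (latticeLabelling n) x).toAdd (edgeOfAdj hv.adj) =
      (edgeHom (latticeLabelling n) x).toAdd (edgeOfAdj hv'.adj) := by
  have hne : edgeOfAdj hv.adj ≠ edgeOfAdj hv'.adj := fun e => by
    have := hu.val_add_one
    rw [(hv.eq_of_edgeOfAdj_eq hv' e).1] at this
    omega
  rw [← CharTwo.add_eq_zero, ← Finset.sum_pair hne]
  refine sum_edgeHom_eq_zero_of_commute_singleOp ho hσ (q := Sum.inr ⟨f, hf⟩) (axisPauli_sq k)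
    (fun i j hij hmem => ?_) (fun i j hij hnot => ?_) hx (hcomm _)
  · rw [Finset.mem_insert, Finset.mem_singleton,
      Face.edgeOfAdj_eq_or_iff hdk hd hk hu hv hv'] at hmem
    obtain ⟨fi, fj, rfl⟩ := hmem
    rw [edgePauli, if_pos ⟨fi, fj⟩, axisPauli_anticomm hdk]
  · rw [Finset.mem_insert, Finset.mem_singleton,
      Face.edgeOfAdj_eq_or_iff hdk hd hk hu hv hv'] at hnot
    rw [edgePauli]
    split_ifs with hij'
    · have axis_ne := Face.axis_ne_normal (ho.adj i j hij) hij'.1 hij'.2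
      rcases axis_cases hdk hd hk (edgeAxis i j) with e | e | e
      · exact absurd ⟨hij'.1, hij'.2, e⟩ hnot
      · rw [e]
      · exact absurd e axis_ne
    · rw [one_mul, mul_one]

theorem mem_balanced_of_commute (ho : IsCompactOrientation o) (hc : IsTypedBy o c)
    {pick : Face n → Vertex n × Vertex n} {σ : MG (lattice n) →* QubitOp (Qubit o)}
    (hσ : IsCubicEncoding o pick σ) {x : MG (lattice n)} (hx : x ∈ cycleGroup (lattice n))
    (hcomm : ∀ T, σ x * T = T * σ x) :
    (edgeHom (latticeLabelling n) x).toAdd ∈ balanced c := by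
  refine ⟨fun p => sum_cellValues_eq_zero ho hc hσ hx hcomm p.1 p.2,
    fun d k u v u' v' hv hv' hu hdk ht => ?_⟩
  obtain ⟨f, rfl, hd, hk⟩ := exists_face_of_lt hdk hv.lt hu.lt
  exact opposite_edges_eq ho.toIsOrientation hσ hx hcomm
    ((isOddFace_iff_edgeType ho hc f hdk hd hk).mpr ht) hdk hd hk hu hv hv'

end Balanced

section Cells

variable {n : Fin 3 → ℕ} {o : Vertex n → Vertex n → Prop} {c : Fin 3 → ℕ}
variable {f g : Face n} {d : Fin 3} {i j : Vertex n}

/-! ### Odd cells and isolated odd faces -/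

/-- The face of the cell `p` that is normal to `d` and contains the least vertex of `p`. -/
def Cell.lowerFace (p : Cell n) (d : Fin 3) : Face n := ⟨(d, p.1), fun k _ => p.2 k⟩

/-- The face of the cell `p` opposite to `Cell.lowerFace p d`. -/
def Cell.upperFace (p : Cell n) (d : Fin 3) : Face n :=
  ⟨(d, shift p.1 d (p.2 d)), fun k hk => by
    rw [(isStep_shift p.1 d (p.2 d)).val_eq hk]; exact p.2 k⟩

theorem Cell.lowerFace_verts_subset (p : Cell n) (d : Fin 3) :
    (Cell.lowerFace p d).verts ⊆ p.verts := by
  intro v hv k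
  by_cases hk : k = d
  · subst hk; exact Or.inl (congrArg Fin.val hv.1)
  · exact hv.2 k hk

theorem Cell.upperFace_verts_subset (p : Cell n) (d : Fin 3) :
    (Cell.upperFace p d).verts ⊆ p.verts := by
  have hs := isStep_shift p.1 d (p.2 d)
  intro v hv k
  by_cases hk : k = d
  · subst hk; exact Or.inr ((congrArg Fin.val hv.1).trans hs.val_add_one)
  · have := hv.2 k hk
    rwa [show (Cell.upperFace p d).base k = p.1 k from (hs.2 k hk).symm] at this

theorem Face.base_val_of_subset {p : Cell n} (h : f.verts ⊆ p.verts) (hd : d ≠ f.normal) :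
    (f.base d).val = (p.1 d).val := by
  have h₁ := h f.base_mem_verts d
  have hs := isStep_shift f.base d (f.lt hd)
  have h₂ := h (Face.mem_verts_of_isStep hs hd f.base_mem_verts rfl) d
  rw [hs.val_add_one] at h₂
  omega

theorem isOddCell_iff (ho : IsCompactOrientation o) (hc : IsTypedBy o c) (p : Cell n) :
    IsOddCell o p ↔ ∀ a b, edgeType c a (p.1 a).val = edgeType c b (p.1 b).val := by
  constructor
  · intro h a b
    by_cases hab : a = b
    · rw [hab]
    obtain ⟨k, hka, hkb, -⟩ := exists_third_axis hab
    exact (isOddFace_iff ho hc _).mp (h _ (Cell.lowerFace_verts_subset p k)) a b hka.symm hkb.symm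
  · intro h f hf
    rw [isOddFace_iff ho hc]
    intro a b ha hb
    rw [Face.base_val_of_subset hf ha, Face.base_val_of_subset hf hb]
    exact h a b

theorem Face.mem_verts_iff_of_isStep (h : IsStep d i j) :
    i ∈ f.verts ∧ j ∈ f.verts ↔ d ≠ f.normal ∧ i ∈ f.verts ∧ (i d).val = (f.base d).val := by
  refine ⟨fun ⟨hi, hj⟩ => ?_, fun ⟨hd, hi, hb⟩ => ⟨hi, Face.mem_verts_of_isStep h hd hi hb⟩⟩
  have hn := Face.axis_ne_normal h.adj hi hj
  have hl := Face.edgeLow_eq h.adj hi hj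
  rw [h.edgeAxis_eq] at hn hl
  exact ⟨hn, hi, h.edgeLow_eq.symm.trans hl⟩

/-- The faces `f` and `g` have a common edge along the axis `d`. -/
def ShareEdge (d : Fin 3) (f g : Face n) : Prop :=
  ∃ i j, IsStep d i j ∧ (i ∈ f.verts ∧ j ∈ f.verts) ∧ i ∈ g.verts ∧ j ∈ g.verts

theorem shareEdge_of_adj (h : (lattice n).Adj i j) (hf : i ∈ f.verts ∧ j ∈ f.verts)
    (hg : i ∈ g.verts ∧ j ∈ g.verts) : ShareEdge (edgeAxis i j) f g := by
  rcases isStep_or_isStep h with h | h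
  · exact ⟨i, j, h, hf, hg⟩
  · exact ⟨j, i, h, hf.symm, hg.symm⟩

theorem ShareEdge.symm (h : ShareEdge d f g) : ShareEdge d g f := by
  obtain ⟨i, j, hs, hf, hg⟩ := h
  exact ⟨i, j, hs, hg, hf⟩

theorem ShareEdge.ne_normal (h : ShareEdge d f g) : d ≠ f.normal := by
  obtain ⟨i, j, hs, hf, -⟩ := h
  exact ((Face.mem_verts_iff_of_isStep hs).mp hf).1

theorem ShareEdge.base_eq (h : ShareEdge d f g) : (f.base d).val = (g.base d).val := by
  obtain ⟨i, j, hs, hf, hg⟩ := h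
  rw [← ((Face.mem_verts_iff_of_isStep hs).mp hf).2.2,
    ((Face.mem_verts_iff_of_isStep hs).mp hg).2.2]

theorem ShareEdge.exists_mem (h : ShareEdge d f g) : ∃ i, i ∈ f.verts ∧ i ∈ g.verts := by
  obtain ⟨i, j, -, hf, hg⟩ := h
  exact ⟨i, hf.1, hg.1⟩

theorem shareEdge_iff (hn : f.normal ≠ g.normal) (hf : d ≠ f.normal) (hg : d ≠ g.normal) :
    ShareEdge d f g ↔ (f.base d).val = (g.base d).val ∧
      ((f.base f.normal).val = (g.base f.normal).val ∨
        (f.base f.normal).val = (g.base f.normal).val + 1) ∧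
      ((g.base g.normal).val = (f.base g.normal).val ∨
        (g.base g.normal).val = (f.base g.normal).val + 1) := by
  constructor
  · intro h
    refine ⟨h.base_eq, ?_⟩
    obtain ⟨i, fi, gi⟩ := h.exists_mem
    exact ⟨fi.1 ▸ gi.2 _ hn, gi.1 ▸ fi.2 _ hn.symm⟩
  · rintro ⟨hd, ha, hb⟩
    let i : Vertex n := Function.update f.base g.normal (g.base g.normal)
    have i_of_ne : ∀ {k}, k ≠ g.normal → i k = f.base k := fun hk => Function.update_of_ne hk _ _
    have i_normal : i g.normal = g.base g.normal := Function.update_self ..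
    have fi : i ∈ f.verts := by
      refine ⟨i_of_ne hn, fun k _ => ?_⟩
      by_cases hk : k = g.normal
      · subst hk; rwa [i_normal]
      · exact Or.inl (congrArg Fin.val (i_of_ne hk))
    have gi : i ∈ g.verts := by
      refine ⟨i_normal, fun k hk => ?_⟩
      rw [i_of_ne hk]
      rcases axis_cases hn hf.symm hg.symm k with rfl | rfl | rfl
      exacts [ha, absurd rfl hk, Or.inl hd]
    have id : (i d).val = (f.base d).val := congrArg Fin.val (i_of_ne hg)
    have hs := isStep_shift i d (by rw [id]; exact f.lt hf)
    exact ⟨i, _, hs, (Face.mem_verts_iff_of_isStep hs).mpr ⟨hf, fi, id⟩,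
      (Face.mem_verts_iff_of_isStep hs).mpr ⟨hg, gi, id.trans hd⟩⟩

theorem ShareEdge.edgeType_eq (ho : IsCompactOrientation o) (hc : IsTypedBy o c)
    (h : ShareEdge d f g) (hf : IsOddFace o f) (hg : IsOddFace o g) {a b : Fin 3}
    (ha : a ≠ f.normal) (hb : b ≠ g.normal) :
    edgeType c a (f.base a).val = edgeType c b (g.base b).val := by
  rw [(isOddFace_iff ho hc f).mp hf a d ha h.ne_normal, h.base_eq,
    (isOddFace_iff ho hc g).mp hg d b h.symm.ne_normal hb]

theorem ShareEdge.eq_of_normal_eq (ho : IsCompactOrientation o) (hc : IsTypedBy o c)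
    (h : ShareEdge d f g) (hf : IsOddFace o f) (hg : IsOddFace o g)
    (hn : f.normal = g.normal) : f = g := by
  obtain ⟨i, fi, gi⟩ := h.exists_mem
  refine face_ext hn fun a => ?_
  by_cases ha : a = f.normal
  · rw [ha, ← fi.1, hn, gi.1]
  · have ha' : a ≠ g.normal := hn ▸ ha
    have type_eq := h.edgeType_eq ho hc hf hg ha ha'
    have := fi.2 a ha
    have := gi.2 a ha'
    rw [edgeType, edgeType] at type_eq
    omega

theorem IsIsolatedOddFace.eq_of_shareEdge (ho : IsCompactOrientation o) (hc : IsTypedBy o c)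
    (hf : IsIsolatedOddFace o f) (hg : IsOddFace o g) (h : ShareEdge d f g) : f = g := by
  by_contra hne
  have hn : f.normal ≠ g.normal := fun e => hne (h.eq_of_normal_eq ho hc hf.odd hg e)
  -- The edges of perpendicular odd faces with a common edge span a cell all of whose edges at its
  -- least vertex have the same type.
  let p : Cell n := ⟨Function.update f.base f.normal (g.base f.normal), fun a => by
    by_cases ha : a = f.normal
    · subst ha; simpa using g.lt hn
    · simpa [ha] using f.lt ha⟩
  have p_normal : p.1 f.normal = g.base f.normal := Function.update_self ..
  have p_of_ne : ∀ {a}, a ≠ f.normal → p.1 a = f.base a := fun ha => Function.update_of_ne ha _ _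
  refine hf.isolated p ((isOddCell_iff ho hc p).mpr ?_) fun v hv a => ?_
  · have type_eq : ∀ a, edgeType c a (p.1 a).val = edgeType c f.normal (g.base f.normal).val := by
      intro a
      by_cases ha : a = f.normal
      · rw [ha, p_normal]
      · rw [p_of_ne ha, h.edgeType_eq ho hc hf.odd hg ha hn]
    exact fun a b => (type_eq a).trans (type_eq b).symm
  · by_cases ha : a = f.normal
    · obtain ⟨i, fi, gi⟩ := h.exists_mem
      rw [ha, p_normal, hv.1, ← fi.1]
      exact gi.2 _ hn
    · rw [p_of_ne ha]
      exact hv.2 a ha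

theorem shareEdge_upperFace_iff (ho : IsCompactOrientation o) (hc : IsTypedBy o c) {p : Cell n}
    (hp : IsOddCell o p) (hg : IsOddFace o g) {k : Fin 3} (hn : g.normal ≠ k) :
    ShareEdge d (Cell.upperFace p k) g ↔ ShareEdge d (Cell.lowerFace p k) g := by
  by_cases hdk : d = k
  · exact iff_of_false (fun h => h.ne_normal hdk) (fun h => h.ne_normal hdk)
  by_cases hdg : d = g.normal
  · exact iff_of_false (fun h => h.symm.ne_normal hdg) (fun h => h.symm.ne_normal hdg)
  rw [shareEdge_iff (f := Cell.upperFace p k) hn.symm hdk hdg,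
    shareEdge_iff (f := Cell.lowerFace p k) hn.symm hdk hdg]
  have hs := isStep_shift p.1 k (p.2 k)
  have upper_of_ne : ∀ {a}, a ≠ k → ((Cell.upperFace p k).base a).val = (p.1 a).val := hs.val_eq
  have upper_k : ((Cell.upperFace p k).base k).val = (p.1 k).val + 1 := hs.val_add_one
  change _ ∧ (((Cell.upperFace p k).base k).val = (g.base k).val ∨
    ((Cell.upperFace p k).base k).val = (g.base k).val + 1) ∧ _ ↔
    (p.1 d).val = _ ∧ ((p.1 k).val = (g.base k).val ∨ (p.1 k).val = (g.base k).val + 1) ∧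
      ((g.base g.normal).val = (p.1 g.normal).val ∨
        (g.base g.normal).val = (p.1 g.normal).val + 1)
  rw [upper_of_ne hdk, upper_of_ne hn, upper_k]
  refine and_congr_right fun base_eq => and_congr_left fun _ => ?_
  have type_g := (isOddFace_iff ho hc g).mp hg k d hn.symm hdg
  have type_p := (isOddCell_iff ho hc p).mp hp d k
  rw [← base_eq, type_p, edgeType, edgeType] at type_g
  omega

end Cells

section Loops

variable {n : Fin 3 → ℕ} {o : Vertex n → Vertex n → Prop} {c : Fin 3 → ℕ}
variable {f g : Face n} {d : Fin 3} {i j p q r t : Vertex n}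

/-! ### The loop around an odd face -/

theorem Face.exists_corners (f : Face n) : ∃ (a b : Fin 3) (v v' w : Vertex n), a ≠ b ∧
    IsStep a f.base v ∧ IsStep b f.base v' ∧ IsStep b v w ∧ IsStep a v' w ∧
    f.verts = {f.base, v, v', w} := by
  obtain ⟨a, b, hab, hka, hkb, -⟩ := exists_other_axes f.normal
  have hv := isStep_shift f.base a (f.lt hka.symm)
  have hv' := isStep_shift f.base b (f.lt hkb.symm)
  obtain ⟨w, hw, hw'⟩ := hv.exists_square hv' hab
  have base_mem := f.base_mem_verts
  have v_mem := Face.mem_verts_of_isStep hv hka.symm base_mem rfl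
  have v'_mem := Face.mem_verts_of_isStep hv' hkb.symm base_mem rfl
  have w_mem := Face.mem_verts_of_isStep hw hkb.symm v_mem (hv.val_eq hab.symm)
  refine ⟨a, b, _, _, w, hab, hv, hv', hw, hw', Set.Subset.antisymm (fun x hx => ?_) ?_⟩
  · have eq_of_val_eq {y} (hy : y ∈ f.verts) := Face.vert_ext hab hka.symm hkb.symm hx hy
    have := hv.val_add_one
    have := hv.val_eq hab.symm
    have := hv'.val_add_one
    have := hv'.val_eq hab
    have := hw'.val_add_one
    have := hw'.val_eq hab.symm
    rcases hx.2 a hka.symm with ha | ha <;> rcases hx.2 b hkb.symm with hb | hb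
    · exact Or.inl (eq_of_val_eq base_mem ha hb)
    · exact Or.inr (Or.inr (Or.inl (eq_of_val_eq v'_mem (by omega) (by omega))))
    · exact Or.inr (Or.inl (eq_of_val_eq v_mem (by omega) (by omega)))
    · exact Or.inr (Or.inr (Or.inr (eq_of_val_eq w_mem (by omega) (by omega))))
  · rintro x (rfl | rfl | rfl | rfl)
    exacts [base_mem, v_mem, v'_mem, w_mem]

theorem exists_orientation_of_isOddFace (ho : IsCompactOrientation o) (hc : IsTypedBy o c)
    (hf : IsOddFace o f) : ∃ t, ∀ i j, i ∈ f.verts → j ∈ f.verts → (lattice n).Adj i j →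
      (o i j ↔ coordSum i % 2 ≠ t) := by
  obtain ⟨a, -, -, ha, -⟩ := exists_other_axes f.normal
  refine ⟨edgeType c a (f.base a).val, fun i j hi hj hij => ?_⟩
  rw [hc.iff_dartType ho.toIsOrientation hij, dartType, Face.edgeLow_eq hij hi hj,
    (isOddFace_iff ho hc f).mp hf _ a (Face.axis_ne_normal hij hi hj) ha.symm, ne_comm]

/-- The face `f` has the sources `p`, `q` and the sinks `r`, `t`: this is the shape of an odd
face. -/
structure IsOddSquare (o : Vertex n → Vertex n → Prop) (f : Face n) (p q r t : Vertex n) :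
    Prop where
  verts_eq : f.verts = {p, q, r, t}
  pr : o p r
  qr : o q r
  qt : o q t
  pt : o p t
  axis_eq₁ : edgeAxis q t = edgeAxis p r
  axis_eq₂ : edgeAxis p t = edgeAxis q r
  axis_ne : edgeAxis p r ≠ edgeAxis q r

theorem exists_isOddSquare (ho : IsCompactOrientation o) (hc : IsTypedBy o c)
    (hf : IsOddFace o f) : ∃ p q r t, IsOddSquare o f p q r t := by
  obtain ⟨a, b, v, v', w, hab, hv, hv', hw, hw', verts_eq⟩ := f.exists_corners
  obtain ⟨s, o_iff⟩ := exists_orientation_of_isOddFace ho hc hf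
  have mem : f.base ∈ f.verts ∧ v ∈ f.verts ∧ v' ∈ f.verts ∧ w ∈ f.verts := by simp [verts_eq]
  obtain ⟨base_mem, v_mem, v'_mem, w_mem⟩ := mem
  have := hv.coordSum_eq
  have := hv'.coordSum_eq
  have := hw.coordSum_eq
  by_cases hs : coordSum f.base % 2 = s
  · refine ⟨v, v', f.base, w, ?_, (o_iff _ _ v_mem base_mem hv.adj.symm).mpr (by omega),
      (o_iff _ _ v'_mem base_mem hv'.adj.symm).mpr (by omega),
      (o_iff _ _ v'_mem w_mem hw'.adj).mpr (by omega),
      (o_iff _ _ v_mem w_mem hw.adj).mpr (by omega), ?_, ?_, ?_⟩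
    · rw [verts_eq]; ext x; simp only [Set.mem_insert_iff, Set.mem_singleton_iff]; tauto
    · rw [hw'.edgeAxis_eq, edgeAxis_comm, hv.edgeAxis_eq]
    · rw [hw.edgeAxis_eq, edgeAxis_comm, hv'.edgeAxis_eq]
    · rwa [edgeAxis_comm, hv.edgeAxis_eq, edgeAxis_comm, hv'.edgeAxis_eq]
  · have := (o_iff _ _ v_mem base_mem hv.adj.symm).not.mp
      ((ho.not_iff hv.adj.symm).mpr ((o_iff _ _ base_mem v_mem hv.adj).mpr hs))
    refine ⟨f.base, w, v, v', ?_, (o_iff _ _ base_mem v_mem hv.adj).mpr hs,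
      (o_iff _ _ w_mem v_mem hw.adj.symm).mpr (by omega),
      (o_iff _ _ w_mem v'_mem hw'.adj.symm).mpr (by omega),
      (o_iff _ _ base_mem v'_mem hv'.adj).mpr hs, ?_, ?_, ?_⟩
    · rw [verts_eq]; ext x; simp only [Set.mem_insert_iff, Set.mem_singleton_iff]; tauto
    · rw [edgeAxis_comm, hw'.edgeAxis_eq, hv.edgeAxis_eq]
    · rw [hv'.edgeAxis_eq, edgeAxis_comm, hw.edgeAxis_eq]
    · rwa [hv.edgeAxis_eq, edgeAxis_comm, hw.edgeAxis_eq]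

namespace IsOddSquare

theorem mem_verts (h : IsOddSquare o f p q r t) :
    p ∈ f.verts ∧ q ∈ f.verts ∧ r ∈ f.verts ∧ t ∈ f.verts := by
  simp [h.verts_eq]

theorem swap_sources (h : IsOddSquare o f p q r t) : IsOddSquare o f q p r t where
  verts_eq := h.verts_eq.trans (Set.insert_comm ..)
  pr := h.qr
  qr := h.pr
  qt := h.pt
  pt := h.qt
  axis_eq₁ := h.axis_eq₂
  axis_eq₂ := h.axis_eq₁
  axis_ne := h.axis_ne.symm

theorem swap_sinks (h : IsOddSquare o f p q r t) : IsOddSquare o f p q t r where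
  verts_eq := by rw [h.verts_eq, Set.pair_comm]
  pr := h.pt
  qr := h.qt
  qt := h.qr
  pt := h.pr
  axis_eq₁ := h.axis_eq₂.symm
  axis_eq₂ := h.axis_eq₁.symm
  axis_ne := by rw [h.axis_eq₁, h.axis_eq₂]; exact h.axis_ne.symm

theorem p_ne_q (h : IsOddSquare o f p q r t) : p ≠ q := by
  rintro rfl; exact h.axis_ne rfl

theorem r_ne_t (h : IsOddSquare o f p q r t) : r ≠ t := by
  rintro rfl; exact h.axis_ne h.axis_eq₂

theorem edge_cases (h : IsOddSquare o f p q r t) (ho : IsOrientation o) (hi : i ∈ f.verts)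
    (hj : j ∈ f.verts) (hij : o i j) :
    (i = p ∧ j = r) ∨ (i = q ∧ j = r) ∨ (i = q ∧ j = t) ∨ (i = p ∧ j = t) := by
  rw [h.verts_eq] at hi hj
  have := coordSum_of_adj (ho.adj _ _ h.pr)
  have := coordSum_of_adj (ho.adj _ _ h.qr)
  have := coordSum_of_adj (ho.adj _ _ h.qt)
  have := coordSum_of_adj (ho.adj _ _ hij)
  have := (ho.xor _ _ (ho.adj _ _ h.pr)).mp h.pr
  have := (ho.xor _ _ (ho.adj _ _ h.qr)).mp h.qr
  have := (ho.xor _ _ (ho.adj _ _ h.qt)).mp h.qt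
  have := (ho.xor _ _ (ho.adj _ _ h.pt)).mp h.pt
  rcases hi with rfl | rfl | rfl | rfl <;> rcases hj with rfl | rfl | rfl | rfl <;>
    first | (exfalso; omega) | tauto

theorem adj_cases (h : IsOddSquare o f p q r t) (ho : IsOrientation o) (hi : i ∈ f.verts)
    (hj : j ∈ f.verts) (hij : (lattice n).Adj i j) :
    ((i = p ∧ j = r) ∨ (i = q ∧ j = r) ∨ (i = q ∧ j = t) ∨ (i = p ∧ j = t)) ∨
    ((j = p ∧ i = r) ∨ (j = q ∧ i = r) ∨ (j = q ∧ i = t) ∨ (j = p ∧ i = t)) := by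
  by_cases hor : o i j
  · exact Or.inl (h.edge_cases ho hi hj hor)
  · exact Or.inr (h.edge_cases ho hj hi ((ho.not_iff hij).mp hor))

/-- The walk around an odd face. -/
def walk (h : IsOddSquare o f p q r t) (ho : IsOrientation o) : (lattice n).Walk p p :=
  .cons (ho.adj _ _ h.pr) (.cons (ho.adj _ _ h.qr).symm (.cons (ho.adj _ _ h.qt)
    (.cons (ho.adj _ _ h.pt).symm .nil)))

end IsOddSquare

open Classical in
/-- The four edges of a face, counted modulo two. -/
def faceBoundary (f : Face n) : LatticeEdge n → ZMod 2 := fun e =>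
  if e.1.1 ≠ f.normal ∧ e.1.2 ∈ f.verts ∧ (e.1.2 e.1.1).val = (f.base e.1.1).val then 1 else 0

theorem IsOddSquare.darts_map_label (h : IsOddSquare o f p q r t) (ho : IsOrientation o) :
    (h.walk ho).darts.map (latticeLabelling n).label =
      [edgeOfAdj (ho.adj _ _ h.pr), edgeOfAdj (ho.adj _ _ h.qr).symm,
        edgeOfAdj (ho.adj _ _ h.qt), edgeOfAdj (ho.adj _ _ h.pt).symm] := rfl

theorem IsOddSquare.mem_darts_map_label_iff (h : IsOddSquare o f p q r t) (ho : IsOrientation o)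
    (hij : (lattice n).Adj i j) :
    edgeOfAdj hij ∈ (h.walk ho).darts.map (latticeLabelling n).label ↔
      i ∈ f.verts ∧ j ∈ f.verts := by
  simp only [h.darts_map_label, List.mem_cons, List.not_mem_nil, or_false, edgeOfAdj_eq_iff]
  constructor
  · obtain ⟨hp, hq, hr, ht⟩ := h.mem_verts
    rintro ((⟨e, e'⟩ | ⟨e, e'⟩) | (⟨e, e'⟩ | ⟨e, e'⟩) | (⟨e, e'⟩ | ⟨e, e'⟩) |
      (⟨e, e'⟩ | ⟨e, e'⟩)) <;> rw [e, e'] <;> exact ⟨by assumption, by assumption⟩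
  · rintro ⟨hi, hj⟩
    have := h.adj_cases ho hi hj hij
    tauto

theorem IsOddSquare.nodup_darts_map_label (h : IsOddSquare o f p q r t) (ho : IsOrientation o) :
    ((h.walk ho).darts.map (latticeLabelling n).label).Nodup := by
  have hpr := (ho.adj _ _ h.pr).ne
  have hqr := (ho.adj _ _ h.qr).ne
  have hqt := (ho.adj _ _ h.qt).ne
  simp [h.darts_map_label, edgeOfAdj_eq_iff, h.p_ne_q, h.r_ne_t, h.p_ne_q.symm, hpr, hpr.symm,
    hqr.symm, hqt]

theorem IsOddSquare.edgeVec_walk (h : IsOddSquare o f p q r t) (ho : IsOrientation o) :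
    edgeVec (latticeLabelling n) (h.walk ho) = faceBoundary f := by
  funext ⟨⟨d, w⟩, hw⟩
  have hs := isStep_shift w d hw
  have mem_iff := h.mem_darts_map_label_iff ho hs.adj
  rw [Face.mem_verts_iff_of_isStep hs, hs.edgeOfAdj_eq] at mem_iff
  rw [edgeVec_apply_of_nodup _ (h.nodup_darts_map_label ho), faceBoundary]
  split_ifs <;> tauto

end Loops

section LoopOperators

variable {n : Fin 3 → ℕ} {o : Vertex n → Vertex n → Prop} {c : Fin 3 → ℕ}
variable {f g : Face n} {d : Fin 3} {i j p q r t : Vertex n}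

/-! ### The operator of the loop around an odd face -/

open Classical in
/-- The Pauli matrix with which the loop around `f` acts on the qubit of the face `g`. The two
edges of the loop that meet at a vertex act on the qubit of `f` itself with different matrices, so
this qubit contributes only a sign, which is not part of `loopPauli`. The axis of the common edge
is unique, see `loopPauli_of_shareEdge`. -/
def loopPauli (f g : Face n) : Matrix (Fin 2) (Fin 2) ℂ :=
  if ∃ d, g ≠ f ∧ ShareEdge d f g then
    axisPauli (Classical.epsilon fun d => g ≠ f ∧ ShareEdge d f g)
  else 1

/-- The operator of the loop around `f`, up to a sign. -/
def loopOp (o : Vertex n → Vertex n → Prop) (f : Face n) : QubitOp (Qubit o) :=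
  tensorOp fun
    | Sum.inl _ => 1
    | Sum.inr g => loopPauli f g.1

theorem loopPauli_sq (f g : Face n) : loopPauli f g * loopPauli f g = 1 := by
  rw [loopPauli]
  split_ifs
  · exact axisPauli_sq _
  · exact one_mul 1

theorem loopOp_sq (f : Face n) : loopOp o f * loopOp o f = 1 := by
  rw [loopOp, tensorOp_mul]
  refine tensorOp_eq_one fun q => ?_
  rcases q with _ | g
  · exact one_mul 1
  · exact loopPauli_sq f g.1

theorem loopPauli_self (f : Face n) : loopPauli f f = 1 :=
  if_neg fun ⟨_, h, _⟩ => h rfl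

theorem loopPauli_of_not_shareEdge (h : ∀ d, ¬ ShareEdge d f g) : loopPauli f g = 1 :=
  if_neg fun ⟨d, _, hd⟩ => h d hd

theorem ShareEdge.axis_unique {e : Fin 3} (h : ShareEdge d f g) (h' : ShareEdge e f g)
    (hne : g ≠ f) : d = e := by
  obtain ⟨i, j, hij, hf, hg⟩ := h
  obtain ⟨k, l, hkl, hf', hg'⟩ := h'
  by_contra hde
  exact hne (Face.eq_of_perpendicular hij.adj hkl.adj
    (by rwa [hij.edgeAxis_eq, hkl.edgeAxis_eq]) hg.1 hg.2 hg'.1 hg'.2 hf.1 hf.2 hf'.1 hf'.2)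

theorem loopPauli_of_shareEdge (hne : g ≠ f) (h : ShareEdge d f g) :
    loopPauli f g = axisPauli d := by
  have hex : ∃ d, g ≠ f ∧ ShareEdge d f g := ⟨d, hne, h⟩
  rw [loopPauli, if_pos hex, (Classical.epsilon_spec hex).2.axis_unique h hne]

theorem loopPauli_lowerFace_eq_upperFace (ho : IsCompactOrientation o) (hc : IsTypedBy o c)
    {p : Cell n} (hp : IsOddCell o p) (hg : IsOddFace o g) (k : Fin 3) :
    loopPauli (Cell.lowerFace p k) g = loopPauli (Cell.upperFace p k) g := by
  have same (d) : (g ≠ Cell.lowerFace p k ∧ ShareEdge d (Cell.lowerFace p k) g) =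
      (g ≠ Cell.upperFace p k ∧ ShareEdge d (Cell.upperFace p k) g) := by
    by_cases hn : g.normal = k
    · refine propext (iff_of_false (fun ⟨hne, h⟩ => hne ?_) fun ⟨hne, h⟩ => hne ?_)
      · exact (h.eq_of_normal_eq ho hc (hp _ (Cell.lowerFace_verts_subset p k)) hg hn.symm).symm
      · exact (h.eq_of_normal_eq ho hc (hp _ (Cell.upperFace_verts_subset p k)) hg hn.symm).symm
    · have ne {f : Face n} (hf : f.normal = k) : g ≠ f := fun e => hn (e ▸ hf)
      rw [shareEdge_upperFace_iff ho hc hp hg hn, iff_true_intro (ne (f := Cell.lowerFace p k) rfl),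
        iff_true_intro (ne (f := Cell.upperFace p k) rfl)]
  rw [loopPauli, loopPauli]
  classical exact if_congr (by simp only [same]) (by simp only [same]) rfl

theorem loopOp_lowerFace_eq_upperFace (ho : IsCompactOrientation o) (hc : IsTypedBy o c)
    {p : Cell n} (hp : IsOddCell o p) (k : Fin 3) :
    loopOp o (Cell.lowerFace p k) = loopOp o (Cell.upperFace p k) := by
  rw [loopOp, loopOp]
  congr 1
  funext q
  rcases q with u | ⟨g, hg⟩
  exacts [rfl, loopPauli_lowerFace_eq_upperFace ho hc hp hg k]

theorem loopOp_eq_one_of_isIsolatedOddFace (ho : IsCompactOrientation o) (hc : IsTypedBy o c)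
    (hf : IsIsolatedOddFace o f) : loopOp o f = 1 := by
  refine tensorOp_eq_one fun q => ?_
  rcases q with u | ⟨g, hg⟩
  · rfl
  · exact if_neg fun ⟨_, hne, hd⟩ => hne (hf.eq_of_shareEdge ho hc hg hd).symm

theorem axisPauli_loop {a b : Fin 3} (h : a ≠ b) :
    axisPauli a * axisPauli b * axisPauli a * axisPauli b = -1 := by
  rw [axisPauli_anticomm h, neg_mul, mul_assoc, axisPauli_sq, mul_one, neg_mul, axisPauli_sq]

namespace IsOddSquare

theorem edgePauli_vertex (h : IsOddSquare o f p q r t) (ho : IsOrientation o) (u : Vertex n) :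
    edgePauli o p r (.inl u) * edgePauli o q r (.inl u) * edgePauli o q t (.inl u) *
      edgePauli o p t (.inl u) = 1 := by
  have hpq := h.p_ne_q
  have hrt := h.r_ne_t
  have hpr := (ho.adj _ _ h.pr).ne
  have hqr := (ho.adj _ _ h.qr).ne
  have hqt := (ho.adj _ _ h.qt).ne
  have hpt := (ho.adj _ _ h.pt).ne
  simp only [edgePauli]
  by_cases hp : u = p
  · subst hp; simp [hpq, hpr, hpt, pauliX_sq]
  by_cases hq : u = q
  · subst hq; simp [hp, hqr, hqt, pauliX_sq]
  by_cases hr : u = r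
  · subst hr; simp [hp, hq, hrt, pauliY_sq]
  by_cases ht : u = t
  · subst ht; simp [hp, hq, hr, pauliY_sq]
  simp [hp, hq, hr, ht]

theorem edgePauli_self (h : IsOddSquare o f p q r t) (hf : IsOddFace o f) :
    edgePauli o p r (.inr ⟨f, hf⟩) * edgePauli o q r (.inr ⟨f, hf⟩) *
      edgePauli o q t (.inr ⟨f, hf⟩) * edgePauli o p t (.inr ⟨f, hf⟩) = -1 := by
  obtain ⟨hp, hq, hr, ht⟩ := h.mem_verts
  simp only [edgePauli, hp, hq, hr, ht, and_self, if_true, h.axis_eq₁, h.axis_eq₂]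
  exact axisPauli_loop h.axis_ne

theorem notMem_of_mem (h : IsOddSquare o f p q r t) (ho : IsOrientation o) (hgf : g ≠ f)
    (hp : p ∈ g.verts) (hr : r ∈ g.verts) : q ∉ g.verts ∧ t ∉ g.verts := by
  obtain ⟨fp, fq, fr, ft⟩ := h.mem_verts
  refine ⟨fun hq => hgf ?_, fun ht => hgf ?_⟩
  · exact Face.eq_of_perpendicular (ho.adj _ _ h.pr) (ho.adj _ _ h.qr) h.axis_ne
      hp hr hq hr fp fr fq fr
  · exact Face.eq_of_perpendicular (ho.adj _ _ h.pr) (ho.adj _ _ h.pt)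
      (h.axis_eq₂ ▸ h.axis_ne) hp hr hp ht fp fr fp ft

theorem loopPauli_eq (h : IsOddSquare o f p q r t) (ho : IsOrientation o) (hgf : g ≠ f)
    (hp : p ∈ g.verts) (hr : r ∈ g.verts) : loopPauli f g = axisPauli (edgeAxis p r) := by
  obtain ⟨fp, -, fr, -⟩ := h.mem_verts
  exact loopPauli_of_shareEdge hgf (shareEdge_of_adj (ho.adj _ _ h.pr) ⟨fp, fr⟩ ⟨hp, hr⟩)

theorem edgePauli_face (h : IsOddSquare o f p q r t) (ho : IsOrientation o) (hg : IsOddFace o g)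
    (hgf : g ≠ f) :
    edgePauli o p r (.inr ⟨g, hg⟩) * edgePauli o q r (.inr ⟨g, hg⟩) *
      edgePauli o q t (.inr ⟨g, hg⟩) * edgePauli o p t (.inr ⟨g, hg⟩) = loopPauli f g := by
  simp only [edgePauli]
  by_cases hpr : p ∈ g.verts ∧ r ∈ g.verts
  · simp [hpr, h.notMem_of_mem ho hgf hpr.1 hpr.2, h.loopPauli_eq ho hgf hpr.1 hpr.2]
  by_cases hqr : q ∈ g.verts ∧ r ∈ g.verts
  · simp [hqr, h.swap_sources.notMem_of_mem ho hgf hqr.1 hqr.2,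
      h.swap_sources.loopPauli_eq ho hgf hqr.1 hqr.2]
  by_cases hqt : q ∈ g.verts ∧ t ∈ g.verts
  · simp [hqt, h.swap_sources.swap_sinks.notMem_of_mem ho hgf hqt.1 hqt.2,
      h.swap_sources.swap_sinks.loopPauli_eq ho hgf hqt.1 hqt.2]
  by_cases hpt : p ∈ g.verts ∧ t ∈ g.verts
  · simp [hpt, h.swap_sinks.notMem_of_mem ho hgf hpt.1 hpt.2,
      h.swap_sinks.loopPauli_eq ho hgf hpt.1 hpt.2]
  simp only [if_neg hpr, if_neg hqr, if_neg hqt, if_neg hpt, one_mul]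
  refine (loopPauli_of_not_shareEdge ?_).symm
  rintro d ⟨i, j, hij, ⟨fi, fj⟩, gi, gj⟩
  rcases h.adj_cases ho fi fj hij.adj with
    (⟨rfl, rfl⟩ | ⟨rfl, rfl⟩ | ⟨rfl, rfl⟩ | ⟨rfl, rfl⟩) |
    (⟨rfl, rfl⟩ | ⟨rfl, rfl⟩ | ⟨rfl, rfl⟩ | ⟨rfl, rfl⟩) <;> tauto

theorem unsignedEdgeOp_loop (h : IsOddSquare o f p q r t) (ho : IsOrientation o)
    (hf : IsOddFace o f) :
    unsignedEdgeOp o p r * unsignedEdgeOp o q r * unsignedEdgeOp o q t * unsignedEdgeOp o p t =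
      -loopOp o f := by
  simp only [unsignedEdgeOp_eq, tensorOp_mul, loopOp]
  refine tensorOp_eq_neg (Sum.inr ⟨f, hf⟩) ?_ fun x hx => ?_
  · exact (h.edgePauli_self hf).trans (congrArg Neg.neg (loopPauli_self f)).symm
  · rcases x with u | ⟨g, hg⟩
    · exact h.edgePauli_vertex ho u
    · exact h.edgePauli_face ho hg fun e => hx (by subst e; rfl)

end IsOddSquare

variable {pick : Face n → Vertex n × Vertex n} {σ : MG (lattice n) →* QubitOp (Qubit o)}

open Classical in
theorem pickSign_eq (ho : IsCompactOrientation o) (hc : IsTypedBy o c)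
    (hpick : IsEdgeChoice o pick) (hf : IsOddFace o f) (hij : o i j) (hi : i ∈ f.verts)
    (hj : j ∈ f.verts) :
    pickSign o pick i j = if IsIsolatedOddFace o f ∧ pick f = (i, j) then -1 else 1 := by
  rw [pickSign]
  refine if_congr ⟨?_, fun h => ⟨f, h⟩⟩ rfl rfl
  rintro ⟨g, hg, hgp⟩
  have hm := hpick g hg
  rw [hgp] at hm
  have : g = f := hg.eq_of_shareEdge ho hc hf
    (shareEdge_of_adj (ho.adj _ _ hij) ⟨hm.1, hm.2.1⟩ ⟨hi, hj⟩)
  subst this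
  exact ⟨hg, hgp⟩

open Classical in
theorem IsOddSquare.prod_pickSign (h : IsOddSquare o f p q r t) (ho : IsCompactOrientation o)
    (hc : IsTypedBy o c) (hpick : IsEdgeChoice o pick) (hf : IsOddFace o f) :
    pickSign o pick p r * pickSign o pick q r * pickSign o pick q t * pickSign o pick p t =
      if IsIsolatedOddFace o f then -1 else 1 := by
  obtain ⟨hp, hq, hr, ht⟩ := h.mem_verts
  rw [pickSign_eq ho hc hpick hf h.pr hp hr, pickSign_eq ho hc hpick hf h.qr hq hr,
    pickSign_eq ho hc hpick hf h.qt hq ht, pickSign_eq ho hc hpick hf h.pt hp ht]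
  by_cases hi : IsIsolatedOddFace o f
  · obtain ⟨hm₁, hm₂, hm⟩ := hpick f hi
    have hpq := h.p_ne_q
    have hrt := h.r_ne_t
    generalize pick f = e at hm₁ hm₂ hm
    obtain ⟨i, j⟩ := e
    rcases h.edge_cases ho.toIsOrientation hm₁ hm₂ hm with
      ⟨rfl, rfl⟩ | ⟨rfl, rfl⟩ | ⟨rfl, rfl⟩ | ⟨rfl, rfl⟩ <;>
    simp [hi, hpq, hpq.symm, hrt, hrt.symm]
  · simp [hi]

theorem IsCubicEncoding.map_edge (hσ : IsCubicEncoding o pick σ) (hij : o i j)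
    (h : (lattice n).Adj i j) :
    σ (gen (.edge ⟨(i, j), h⟩)) = pickSign o pick i j • unsignedEdgeOp o i j := by
  rw [hσ, generatorOp, if_pos hij, orientedEdgeOp_eq]

theorem IsCubicEncoding.map_edge_symm (hσ : IsCubicEncoding o pick σ) (ho : IsOrientation o)
    (hij : o i j) (h : (lattice n).Adj j i) :
    σ (gen (.edge ⟨(j, i), h⟩)) = -(pickSign o pick i j • unsignedEdgeOp o i j) := by
  rw [hσ, generatorOp, if_neg ((ho.not_iff h).mpr hij), orientedEdgeOp_eq]

open Classical in
theorem IsOddSquare.map_cycleElement (h : IsOddSquare o f p q r t) (ho : IsCompactOrientation o)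
    (hc : IsTypedBy o c) (hpick : IsEdgeChoice o pick) (hf : IsOddFace o f)
    (hσ : IsCubicEncoding o pick σ) :
    σ (cycleElement (h.walk ho.toIsOrientation)) =
      if IsIsolatedOddFace o f then loopOp o f else -loopOp o f := by
  have ho' := ho.toIsOrientation
  have length_eq : ((h.walk ho').length : ZMod 4) = 0 :=
    show ((4 : ℕ) : ZMod 4) = 0 from rfl
  have map_eq : σ (cycleElement (h.walk ho')) =
      (pickSign o pick p r * pickSign o pick q r * pickSign o pick q t * pickSign o pick p t) •
      (unsignedEdgeOp o p r * unsignedEdgeOp o q r * unsignedEdgeOp o q t *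
        unsignedEdgeOp o p t) := by
    rw [cycleElement, length_eq, satisfiesRelations_gen.phase_zero, one_mul]
    simp only [IsOddSquare.walk, SimpleGraph.Walk.darts_cons, SimpleGraph.Walk.darts_nil,
      List.map_cons, List.map_nil, List.prod_cons, List.prod_nil, map_mul, mul_one]
    rw [hσ.map_edge h.pr, hσ.map_edge_symm ho' h.qr, hσ.map_edge h.qt,
      hσ.map_edge_symm ho' h.pt]
    simp only [neg_mul, mul_neg, neg_neg, smul_mul_smul_comm, mul_assoc]
  rw [map_eq, h.prod_pickSign ho hc hpick hf, h.unsignedEdgeOp_loop ho' hf]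
  split_ifs <;> simp

open Classical in
theorem exists_mem_cycleGroup_faceBoundary (ho : IsCompactOrientation o) (hc : IsTypedBy o c)
    (hpick : IsEdgeChoice o pick) (hf : IsOddFace o f) (hσ : IsCubicEncoding o pick σ) :
    ∃ x ∈ cycleGroup (lattice n),
      edgeHom (latticeLabelling n) x = Multiplicative.ofAdd (faceBoundary f) ∧
      σ x = if IsIsolatedOddFace o f then loopOp o f else -loopOp o f := by
  obtain ⟨p, q, r, t, h⟩ := exists_isOddSquare ho hc hf
  refine ⟨_, Subgroup.subset_closure ⟨p, h.walk ho.toIsOrientation, rfl⟩, ?_,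
    h.map_cycleElement ho hc hpick hf hσ⟩
  rw [edgeHom_cycleElement, h.edgeVec_walk]

end LoopOperators

section CycleKernel

variable {V Q : Type*} {G : SimpleGraph V} [Fintype Q] [DecidableEq Q]

/-! ### The cycles that act trivially -/

/-- The cycles in the kernel of a representation. The stabilizer group is the quotient of the group
of cycles by this subgroup. -/
def cycleKernel (σ : MG G →* QubitOp Q) : Subgroup (MG G) :=
  cycleGroup G ⊓ σ.toHomUnits.ker

theorem mem_cycleKernel {σ : MG G →* QubitOp Q} {x : MG G} :
    x ∈ cycleKernel σ ↔ x ∈ cycleGroup G ∧ σ x = 1 := by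
  rw [cycleKernel, Subgroup.mem_inf, MonoidHom.mem_ker, Units.ext_iff]
  rfl

theorem card_stabilizerGroup_mul_card_cycleKernel (σ : MG G →* QubitOp Q) :
    Nat.card (stabilizerGroup σ) * Nat.card (cycleKernel σ) = Nat.card (cycleGroup G) := by
  let φ : cycleGroup G →* (QubitOp Q)ˣ := σ.toHomUnits.comp (cycleGroup G).subtype
  have range_eq : stabilizerGroup σ = φ.range := by
    rw [stabilizerGroup, MonoidHom.range_comp, Subgroup.range_subtype]
  have card_ker : Nat.card φ.ker = Nat.card (cycleKernel σ) :=
    Nat.card_congr ⟨fun x => ⟨x.1.1, x.1.2, x.2⟩, fun x => ⟨⟨x.1, x.2.1⟩, x.2.2⟩,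
      fun _ => rfl, fun _ => rfl⟩
  rw [range_eq, ← card_ker, Subgroup.card_eq_card_quotient_mul_card_subgroup φ.ker,
    Nat.card_congr (QuotientGroup.quotientKerEquivRange φ).toEquiv]

end CycleKernel

section CellSpace

variable {n : Fin 3 → ℕ} {o : Vertex n → Vertex n → Prop} {c : Fin 3 → ℕ}
variable {τ : Fin 2} {O : Vertex n} {f : Face n} {k : Fin 3}

/-- The possible families `cellValues c z` for a balanced vector `z`: they are supported on the
edges of odd cells and sum to zero over each cell. -/
def cellSpace (c : Fin 3 → ℕ) : Submodule (ZMod 2) (Fin 2 × Vertex n → Fin 3 → ZMod 2) where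
  carrier := {κ | ∀ p, (∀ d, ¬ IsCellEdge c p.1 p.2 d → κ p d = 0) ∧ ∑ d, κ p d = 0}
  zero_mem' := by simp
  add_mem' := by
    intro κ κ' h h' p
    refine ⟨fun d hd => ?_, ?_⟩
    · rw [Pi.add_apply, Pi.add_apply, (h p).1 d hd, (h' p).1 d hd, add_zero]
    · simp only [Pi.add_apply, Finset.sum_add_distrib, (h p).2, (h' p).2, add_zero]
  smul_mem' := by
    intro a κ h p
    refine ⟨fun d hd => ?_, ?_⟩
    · rw [Pi.smul_apply, Pi.smul_apply, (h p).1 d hd, smul_zero]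
    · simp only [Pi.smul_apply, ← Finset.smul_sum, (h p).2, smul_zero]

theorem cellValues_mem_cellSpace {z : LatticeEdge n → ZMod 2} (hz : z ∈ balanced c) :
    cellValues c z ∈ cellSpace c :=
  fun p => ⟨fun _ hd => cellValues_of_not_isCellEdge hd z, hz.1 p⟩

theorem edgeType_succ_ne (d : Fin 3) (x : ℕ) : edgeType c d (x + 1) ≠ edgeType c d x := by
  simp only [edgeType]; omega

theorem faceBoundary_base {d : Fin 3} (h : (f.base d).val + 1 < n d) :
    faceBoundary f ⟨(d, f.base), h⟩ = if d = f.normal then 0 else 1 := by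
  rw [faceBoundary]
  by_cases hdf : d = f.normal
  · rw [if_pos hdf, if_neg fun h => h.1 hdf]
  · rw [if_neg hdf, if_pos ⟨hdf, f.base_mem_verts, rfl⟩]

/-- The types along each axis alternate, so the base of `f` is the only vertex of `f` that can be
the lowest vertex of an odd cell of the same type. -/
theorem IsCellEdge.eq_base (hf : ∀ a, a ≠ f.normal → IsCellEdge c τ f.base a) {w : Vertex n}
    {d : Fin 3} (h : IsCellEdge c τ w d) (hw : w ∈ f.verts) : w = f.base := by
  refine vertex_ext fun a => ?_
  by_cases ha : a = f.normal
  · rw [ha, hw.1]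
  refine (hw.2 a ha).resolve_right fun up => ?_
  have low := h.low a
  rw [up, ← (hf a ha).type_eq] at low
  exact low.elim (Nat.succ_ne_zero _) (edgeType_succ_ne a _)

theorem cellValues_faceBoundary (hf : ∀ a, a ≠ f.normal → IsCellEdge c τ f.base a) :
    cellValues c (faceBoundary f) =
      Pi.single (τ, f.base) fun d => if d = f.normal then 0 else 1 := by
  funext ⟨τ', w⟩ d
  by_cases hcd : IsCellEdge c τ' w d
  swap
  · rw [cellValues_of_not_isCellEdge hcd]
    by_cases hw : (τ', w) = (τ, f.base)
    · obtain ⟨rfl, rfl⟩ : τ' = τ ∧ w = f.base := Prod.ext_iff.mp hw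
      rw [Pi.single_eq_same, if_pos (by_contra fun hd => hcd (hf d hd))]
    · rw [Pi.single_eq_of_ne hw, Pi.zero_apply]
  by_cases hw : (τ', w) = (τ, f.base)
  · obtain ⟨rfl, rfl⟩ : τ' = τ ∧ w = f.base := Prod.ext_iff.mp hw
    rw [cellValues_of_isCellEdge hcd, Pi.single_eq_same, faceBoundary_base]
  · rw [cellValues_of_isCellEdge hcd, Pi.single_eq_of_ne hw, Pi.zero_apply, faceBoundary, if_neg]
    rintro ⟨hd, hwf, hb⟩
    obtain rfl : τ' = τ := Fin.ext (by rw [← hcd.type_eq, hb, (hf d hd).type_eq])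
    exact hw (Prod.ext rfl (hcd.eq_base hf hwf))

theorem cellValues_faceBoundary_upperFace {p : Cell n} (hp : ∀ a, IsCellEdge c τ p.1 a)
    (k : Fin 3) : cellValues c (faceBoundary (Cell.upperFace p k)) = 0 := by
  have step := isStep_shift p.1 k (p.2 k)
  funext ⟨τ', w⟩ d
  rw [Pi.zero_apply, Pi.zero_apply]
  by_cases hcd : IsCellEdge c τ' w d
  swap
  · exact cellValues_of_not_isCellEdge hcd _
  rw [cellValues_of_isCellEdge hcd, faceBoundary, if_neg]
  rintro ⟨hd, hw, hb⟩
  have type_eq : τ'.val = edgeType c k (p.1 k).val := by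
    rw [← hcd.type_eq, hb, show ((Cell.upperFace p k).base d).val = (p.1 d).val from step.val_eq hd,
      (hp d).type_eq, (hp k).type_eq]
  have up : (w k).val = (p.1 k).val + 1 := (congrArg Fin.val hw.1).trans step.val_add_one
  have low := hcd.low k
  rw [up, type_eq] at low
  exact low.elim (Nat.succ_ne_zero _) (edgeType_succ_ne k _)

end CellSpace

section KernelOfEncoding

variable {n : Fin 3 → ℕ} {o : Vertex n → Vertex n → Prop} {c : Fin 3 → ℕ}
variable {pick : Face n → Vertex n × Vertex n} {σ : MG (lattice n) →* QubitOp (Qubit o)}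
variable {τ : Fin 2} {O : Vertex n} {f : Face n} {k : Fin 3}

theorem exists_mem_cycleKernel_of_isIsolatedOddFace (ho : IsCompactOrientation o)
    (hc : IsTypedBy o c) (hpick : IsEdgeChoice o pick) (hσ : IsCubicEncoding o pick σ)
    (hf : IsIsolatedOddFace o f) :
    ∃ x ∈ cycleKernel σ, (edgeHom (latticeLabelling n) x).toAdd = faceBoundary f := by
  obtain ⟨x, hx, hxf, hσx⟩ := exists_mem_cycleGroup_faceBoundary ho hc hpick hf.odd hσ
  rw [if_pos hf, loopOp_eq_one_of_isIsolatedOddFace ho hc hf] at hσx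
  exact ⟨x, mem_cycleKernel.mpr ⟨hx, hσx⟩, congrArg Multiplicative.toAdd hxf⟩

theorem exists_mem_cycleKernel_of_isOddCell (ho : IsCompactOrientation o) (hc : IsTypedBy o c)
    (hpick : IsEdgeChoice o pick) (hσ : IsCubicEncoding o pick σ) {p : Cell n}
    (hp : IsOddCell o p) (k : Fin 3) :
    ∃ x ∈ cycleKernel σ, (edgeHom (latticeLabelling n) x).toAdd =
      faceBoundary (Cell.lowerFace p k) + faceBoundary (Cell.upperFace p k) := by
  have hlow := Cell.lowerFace_verts_subset p k
  have hup := Cell.upperFace_verts_subset p k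
  obtain ⟨x, hx, hxf, hσx⟩ := exists_mem_cycleGroup_faceBoundary ho hc hpick (hp _ hlow) hσ
  obtain ⟨y, hy, hyf, hσy⟩ := exists_mem_cycleGroup_faceBoundary ho hc hpick (hp _ hup) hσ
  rw [if_neg fun h => h.isolated p hp hlow] at hσx
  rw [if_neg fun h => h.isolated p hp hup] at hσy
  refine ⟨x * y, mem_cycleKernel.mpr ⟨mul_mem hx hy, ?_⟩, ?_⟩
  · rw [map_mul, hσx, hσy, loopOp_lowerFace_eq_upperFace ho hc hp, neg_mul_neg, loopOp_sq]
  · rw [map_mul, hxf, hyf, ← ofAdd_add, toAdd_ofAdd]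

theorem isIsolatedOddFace_of_not_isCellEdge (ho : IsCompactOrientation o) (hc : IsTypedBy o c)
    (hf : ∀ a, a ≠ f.normal → IsCellEdge c τ f.base a)
    (hnormal : ¬ IsCellEdge c τ f.base f.normal) : IsIsolatedOddFace o f := by
  obtain ⟨b, -, -, hb, -, -⟩ := exists_other_axes f.normal
  have edge_b := hf b hb.symm
  have low := edge_b.low f.normal
  have last (h : edgeType c f.normal (f.base f.normal).val = τ.val) :
      ¬ (f.base f.normal).val + 1 < n f.normal := fun lt => hnormal ⟨edge_b.low, h, lt⟩
  refine ⟨?_, low.imp_right fun h => ?_, fun p hp hsub => ?_⟩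
  · rw [isOddFace_iff ho hc]
    exact fun d e hd he => (hf d hd).type_eq.trans (hf e he).type_eq.symm
  · exact le_antisymm (f.base f.normal).isLt (not_lt.mp (last h))
  · have type_p : edgeType c f.normal (p.1 f.normal).val = τ.val := by
      rw [(isOddCell_iff ho hc p).mp hp f.normal b, ← Face.base_val_of_subset hsub hb.symm,
        edge_b.type_eq]
    rcases hsub f.base_mem_verts f.normal with base_eq | base_eq
    · exact last (base_eq ▸ type_p) (base_eq ▸ p.2 f.normal)
    · rw [base_eq, ← type_p] at low
      exact low.elim (Nat.succ_ne_zero _) (edgeType_succ_ne _ _)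

theorem exists_mem_cycleKernel (ho : IsCompactOrientation o) (hc : IsTypedBy o c)
    (hpick : IsEdgeChoice o pick) (hσ : IsCubicEncoding o pick σ)
    (hcell : ∀ a, a ≠ k → IsCellEdge c τ O a) :
    ∃ x ∈ cycleKernel σ, cellValues c (edgeHom (latticeLabelling n) x).toAdd =
      Pi.single (τ, O) fun d => if d = k then 0 else 1 := by
  let f : Face n := ⟨(k, O), fun a ha => (hcell a ha).lt⟩
  have values_f : cellValues c (faceBoundary f) =
      Pi.single (τ, O) fun d => if d = k then 0 else 1 := cellValues_faceBoundary (f := f) hcell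
  by_cases hk : IsCellEdge c τ O k
  · have hall (a) : IsCellEdge c τ O a := if ha : a = k then ha ▸ hk else hcell a ha
    let p : Cell n := ⟨O, fun a => (hall a).lt⟩
    have hp : IsOddCell o p :=
      (isOddCell_iff ho hc p).mpr fun a b => (hall a).type_eq.trans (hall b).type_eq.symm
    obtain ⟨x, hx, hxp⟩ := exists_mem_cycleKernel_of_isOddCell ho hc hpick hσ hp k
    refine ⟨x, hx, ?_⟩
    rw [hxp, map_add, cellValues_faceBoundary_upperFace hall, add_zero]
    exact values_f
  · obtain ⟨x, hx, hxf⟩ := exists_mem_cycleKernel_of_isIsolatedOddFace ho hc hpick hσ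
      (isIsolatedOddFace_of_not_isCellEdge (f := f) ho hc hcell hk)
    exact ⟨x, hx, by rw [hxf, values_f]⟩

theorem eq_zero_or_exists_of_sum_eq_zero : ∀ κ : Fin 3 → ZMod 2, ∑ d, κ d = 0 →
    κ = 0 ∨ ∃ k, κ = fun d => if d = k then 0 else 1 := by
  decide

theorem cellSpace_le_map (ho : IsCompactOrientation o) (hc : IsTypedBy o c)
    (hpick : IsEdgeChoice o pick) (hσ : IsCubicEncoding o pick σ) :
    cellSpace c ≤ (edgeSpace (latticeLabelling n) (cycleKernel σ)).map (cellValues c) := by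
  intro κ hκ
  rw [← Finset.univ_sum_single κ]
  refine Submodule.sum_mem _ fun ⟨τ, O⟩ _ => ?_
  rcases eq_zero_or_exists_of_sum_eq_zero (κ (τ, O)) (hκ (τ, O)).2 with h | ⟨k, h⟩
  · rw [h, Pi.single_zero]
    exact Submodule.zero_mem _
  · have hcell (a : Fin 3) (ha : a ≠ k) : IsCellEdge c τ O a := by
      by_contra hcon
      have := (hκ (τ, O)).1 a hcon
      rw [h] at this
      exact one_ne_zero ((if_neg ha).symm.trans this)
    obtain ⟨x, hx, hval⟩ := exists_mem_cycleKernel ho hc hpick hσ hcell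
    rw [h, ← hval]
    exact ⟨_, ⟨x, hx, rfl⟩, rfl⟩

theorem edgeSpace_cycleKernel_le (ho : IsCompactOrientation o) (hc : IsTypedBy o c)
    (hσ : IsCubicEncoding o pick σ) :
    edgeSpace (latticeLabelling n) (cycleKernel σ) ≤ balanced c := by
  rintro z ⟨x, hx, hz⟩
  obtain ⟨hx, hσx⟩ := mem_cycleKernel.mp hx
  have := mem_balanced_of_commute ho hc hσ hx fun T => by rw [hσx, one_mul, mul_one]
  rwa [hz] at this

theorem map_eq_one_of_commute (ho : IsCompactOrientation o) (hc : IsTypedBy o c)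
    (hpick : IsEdgeChoice o pick) (hσ : IsCubicEncoding o pick σ) {x : MG (lattice n)}
    (hx : x ∈ cycleGroup (lattice n)) (hcomm : ∀ T, σ x * T = T * σ x) : σ x = 1 := by
  have hb := mem_balanced_of_commute ho hc hσ hx hcomm
  obtain ⟨z, hz, he⟩ := cellSpace_le_map ho hc hpick hσ (cellValues_mem_cellSpace hb)
  have hzx := sub_eq_zero.mp <| eq_zero_of_cellValues_eq_zero
    (Submodule.sub_mem _ (edgeSpace_cycleKernel_le ho hc hσ hz) hb) (by rw [map_sub, he, sub_self])
  obtain ⟨y, hy, hyz⟩ := hz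
  obtain ⟨hy, hσy⟩ := mem_cycleKernel.mp hy
  obtain rfl : y = x := edgeHom_injOn (latticeLabelling n) hy hx
    (hyz.trans (congrArg Multiplicative.ofAdd hzx))
  exact hσy

theorem card_cycleKernel (ho : IsCompactOrientation o) (hc : IsTypedBy o c)
    (hpick : IsEdgeChoice o pick) (hσ : IsCubicEncoding o pick σ) :
    Nat.card (cycleKernel σ) = Nat.card (cellSpace (n := n) c) := by
  rw [card_eq_card_edgeSpace (latticeLabelling n) (show cycleKernel σ ≤ _ from inf_le_left)]
  have hle := edgeSpace_cycleKernel_le ho hc hσ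
  refine Nat.card_congr (Equiv.ofBijective
    (fun z => ⟨cellValues c z.1, cellValues_mem_cellSpace (hle z.2)⟩) ⟨fun z z' h => ?_, ?_⟩)
  · refine Subtype.ext (sub_eq_zero.mp (eq_zero_of_cellValues_eq_zero
      (Submodule.sub_mem _ (hle z.2) (hle z'.2)) ?_))
    rw [map_sub, sub_eq_zero]
    exact congrArg Subtype.val h
  · rintro ⟨κ, hκ⟩
    obtain ⟨z, hz, he⟩ := cellSpace_le_map ho hc hpick hσ hκ
    exact ⟨⟨z, hz⟩, Subtype.ext he⟩

theorem neg_one_notMem_stabilizerGroup (ho : IsCompactOrientation o) (hc : IsTypedBy o c)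
    (hpick : IsEdgeChoice o pick) (hσ : IsCubicEncoding o pick σ) :
    (-1 : (QubitOp (Qubit o))ˣ) ∉ stabilizerGroup σ := by
  rintro ⟨x, hx, he⟩
  have map_eq : σ x = -1 := congrArg Units.val he
  have map_eq_one := map_eq_one_of_commute ho hc hpick hσ hx (by simp [map_eq])
  have entry := congrFun (congrFun (map_eq.symm.trans map_eq_one) 0) 0
  rw [Matrix.neg_apply, Matrix.one_apply_eq] at entry
  norm_num at entry

theorem minGenerators_stabilizerGroup (hn : ∀ d, n d ≠ 0) (ho : IsCompactOrientation o)
    (hc : IsTypedBy o c) (hpick : IsEdgeChoice o pick) (hσ : IsCubicEncoding o pick σ) {m : ℕ}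
    (hm : Nat.card (cellSpace (n := n) c) = 2 ^ m) :
    minGenerators (stabilizerGroup σ) + m + Fintype.card (Vertex n) =
      Fintype.card (LatticeEdge n) + 1 := by
  have : Nonempty (Vertex n) := ⟨fun d => ⟨0, Nat.pos_of_ne_zero (hn d)⟩⟩
  obtain ⟨k, hk, hkE⟩ := card_cycleGroup (latticeLabelling n) ⟨lattice_preconnected⟩
  have card_mul := card_stabilizerGroup_mul_card_cycleKernel σ
  rw [card_cycleKernel ho hc hpick hσ, hm, hk] at card_mul
  have hmk : m ≤ k := (Nat.pow_dvd_pow_iff_le_right one_lt_two).mp (Dvd.intro_left _ card_mul)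
  have card_eq : Nat.card (stabilizerGroup σ) = 2 ^ (k - m) := by
    apply Nat.eq_of_mul_eq_mul_right (show 0 < 2 ^ m by positivity)
    rw [card_mul, ← pow_add, Nat.sub_add_cancel hmk]
  have sq_eq_one (y : stabilizerGroup σ) : y ^ 2 = 1 := by
    obtain ⟨_, x, hx, rfl⟩ := y
    refine Subtype.ext ?_
    change σ.toHomUnits x ^ 2 = 1
    rw [← map_pow, sq_eq_one_of_mem_cycleGroup hx, map_one]
  rw [minGenerators_of_card_eq sq_eq_one card_eq]
  omega

end KernelOfEncoding

section AxisCounts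

variable (n c : Fin 3 → ℕ) (d : Fin 3) {τ τ' : ℕ}

/-! ### Counting along one axis -/

/-- The number of edges of type `τ` on a line along the axis `d`. -/
def segmentCount (τ : ℕ) : ℕ :=
  Nat.count (fun x => edgeType c d x = τ) (n d - 1)

/-- The number of possible coordinates along the axis `d` of the lowest vertex of an odd cell of
type `τ`, which may be truncated by the boundary of the box. -/
def lowCount (τ : ℕ) : ℕ :=
  Nat.count (fun x => x = 0 ∨ edgeType c d x = τ) (n d)

/-- The coordinate `x` is an end of the box along the axis `d`, and the edge at that end has the
type `τ`. -/
def IsEnd (τ x : ℕ) : Prop :=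
  (x = 0 ∧ edgeType c d 0 = τ) ∨ (x + 1 = n d ∧ edgeType c d (n d - 2) = τ)

open Classical in
/-- The number of ends of the box along the axis `d` whose edge has the type `τ`. -/
def endCount (τ : ℕ) : ℕ := Nat.count (IsEnd n c d τ) (n d)

theorem edgeType_eq_iff (hτ : τ + τ' = 1) (x : ℕ) : edgeType c d x = τ' ↔ ¬ edgeType c d x = τ := by
  rw [edgeType]; omega

theorem edgeType_succ_eq_iff (hτ : τ + τ' = 1) (x : ℕ) :
    edgeType c d (x + 1) = τ ↔ edgeType c d x = τ' := by
  rw [edgeType, edgeType]; omega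

theorem segmentCount_add (hτ : τ + τ' = 1) :
    segmentCount n c d τ + segmentCount n c d τ' = n d - 1 := by
  simp only [segmentCount, edgeType_eq_iff c d hτ]
  induction n d - 1 with
  | zero => rfl
  | succ m ih => rw [Nat.count_succ, Nat.count_succ]; split_ifs <;> omega

variable {n d}

theorem lowCount_eq (hd : n d ≠ 0) (hτ : τ + τ' = 1) :
    lowCount n c d τ = segmentCount n c d τ' + 1 := by
  obtain ⟨m, hm⟩ := Nat.exists_eq_succ_of_ne_zero hd
  rw [lowCount, segmentCount, hm, Nat.count_succ']
  simp [edgeType_succ_eq_iff c d hτ]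

theorem count_edgeType_add (hτ : τ + τ' = 1) (m : ℕ) :
    (if edgeType c d 0 = τ then 1 else 0) + (if edgeType c d m = τ then 1 else 0) +
      Nat.count (fun x => edgeType c d x = τ') (m + 1) =
    Nat.count (fun x => edgeType c d x = τ) (m + 1) + 1 := by
  have alternate := edgeType_succ_eq_iff c d hτ
  have exclusive := edgeType_eq_iff c d hτ
  induction m with
  | zero => simp only [Nat.count_succ, Nat.count_zero, exclusive]; split_ifs <;> omega
  | succ m ih =>
    rw [Nat.count_succ, Nat.count_succ _ (m + 1)]
    simp only [alternate, exclusive] at ih ⊢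
    split_ifs at ih ⊢ <;> omega

theorem endCount_eq (hd : 2 ≤ n d) : endCount n c d τ =
    (if edgeType c d 0 = τ then 1 else 0) + (if edgeType c d (n d - 2) = τ then 1 else 0) := by
  obtain ⟨m, hm⟩ := Nat.exists_eq_add_of_le' hd
  have inner (x : ℕ) (hx : x < m) : ¬ IsEnd n c d τ (x + 1) := by
    rw [IsEnd]; omega
  classical
  rw [endCount, hm, Nat.count_succ, Nat.count_succ', Nat.count_of_forall_not (fun _ h => inner _ h)]
  simp [IsEnd, hm]

theorem endCount_add_segmentCount (hd : 2 ≤ n d) (hτ : τ + τ' = 1) :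
    endCount n c d τ + segmentCount n c d τ' = segmentCount n c d τ + 1 := by
  rw [endCount_eq c hd, segmentCount, segmentCount, show n d - 1 = n d - 2 + 1 by omega]
  exact count_edgeType_add c hτ _

theorem endCount_add (hd : 2 ≤ n d) : endCount n c d 0 + endCount n c d 1 = 2 := by
  have h₀ := endCount_add_segmentCount c hd (zero_add 1)
  have h₁ := endCount_add_segmentCount c hd (add_zero 1)
  omega

end AxisCounts

section Counting

variable {n : Fin 3 → ℕ} {o : Vertex n → Vertex n → Prop} {c : Fin 3 → ℕ}

/-! ### Counting vertices, edges, faces and corners -/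

theorem card_fin_subtype (m : ℕ) (p : ℕ → Prop) [DecidablePred p] :
    Nat.card {x : Fin m // p x.val} = Nat.count p m := by
  rw [Nat.count_eq_card_filter_range, ← Fintype.card_coe, ← Nat.card_eq_fintype_card]
  exact Nat.card_congr
    ⟨fun x => ⟨x.1.val, Finset.mem_filter.mpr ⟨Finset.mem_range.mpr x.1.isLt, x.2⟩⟩,
      fun x => ⟨⟨x.1, Finset.mem_range.mp (Finset.mem_filter.mp x.2).1⟩,
        (Finset.mem_filter.mp x.2).2⟩, fun _ => rfl, fun _ => rfl⟩

theorem card_fin_subtype_succ_lt (m : ℕ) (p : ℕ → Prop) [DecidablePred p] :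
    Nat.card {x : Fin m // x.val + 1 < m ∧ p x.val} = Nat.count p (m - 1) := by
  rw [← card_fin_subtype]
  exact Nat.card_congr ⟨fun x => ⟨⟨x.1.val, Nat.lt_sub_of_add_lt x.2.1⟩, x.2.2⟩,
    fun x => ⟨⟨x.1.val, by omega⟩, Nat.add_lt_of_lt_sub x.1.isLt, x.2⟩,
    fun _ => rfl, fun _ => rfl⟩

theorem card_subtype_pi {ι : Type*} [Fintype ι] {α : ι → Type*} (p : ∀ i, α i → Prop) :
    Nat.card {u : ∀ i, α i // ∀ i, p i (u i)} = ∏ i, Nat.card {x // p i x} := by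
  rw [Nat.card_congr (Equiv.subtypePiEquivPi (p := fun i => p i)), Nat.card_pi]

theorem card_vertex : Fintype.card (Vertex n) = ∏ d, n d := by
  simp [Fintype.card_pi]

theorem card_latticeEdge :
    Fintype.card (LatticeEdge n) = ∑ k, ∏ d, if d = k then n d - 1 else n d := by
  let p (k d : Fin 3) (x : Fin (n d)) : Prop := d = k → x.val + 1 < n d
  have card_p (k d : Fin 3) : Nat.card {x // p k d x} = if d = k then n d - 1 else n d := by
    split_ifs with h
    · simpa [p, h] using card_fin_subtype_succ_lt (n d) fun _ => True
    · simp [p, h]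
  let e : LatticeEdge n ≃ Σ k, {u : Vertex n // ∀ d, p k d (u d)} :=
    ⟨fun x => ⟨x.1.1, x.1.2, fun k hk => by subst hk; exact x.2⟩,
      fun x => ⟨(x.1, x.2.1), x.2.2 _ rfl⟩, fun _ => rfl, fun _ => rfl⟩
  rw [← Nat.card_eq_fintype_card, Nat.card_congr e, Nat.card_sigma]
  simp only [card_subtype_pi, card_p]

/-- An odd face is given by its type, its normal and its base. -/
def oddFaceEquiv (ho : IsCompactOrientation o) (hc : IsTypedBy o c) :
    (Σ (τ : Fin 2) (k : Fin 3), {u : Vertex n // ∀ d, d ≠ k →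
      (u d).val + 1 < n d ∧ edgeType c d (u d).val = τ.val}) ≃ {f : Face n // IsOddFace o f} := by
  refine Equiv.ofBijective (fun x => ⟨⟨(x.2.1, x.2.2.1), fun d hd => (x.2.2.2 d hd).1⟩,
    (isOddFace_iff ho hc _).mpr fun a b ha hb =>
      (x.2.2.2 a ha).2.trans (x.2.2.2 b hb).2.symm⟩) ⟨?_, ?_⟩
  · rintro ⟨τ, k, u, hu⟩ ⟨τ', k', u', hu'⟩ h
    obtain ⟨rfl, rfl⟩ : k = k' ∧ u = u' := Prod.ext_iff.mp (congrArg (fun f => f.1.1) h)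
    obtain ⟨a, -, -, ha, -, -⟩ := exists_other_axes k
    obtain rfl : τ = τ' := Fin.ext ((hu a ha.symm).2.symm.trans (hu' a ha.symm).2)
    rfl
  · rintro ⟨f, hf⟩
    obtain ⟨a, -, -, ha, -, -⟩ := exists_other_axes f.normal
    exact ⟨⟨⟨edgeType c a (f.base a).val, edgeType_lt _ _ _⟩, f.normal, f.base, fun d hd =>
      ⟨f.lt hd, (isOddFace_iff ho hc f).mp hf d a hd ha.symm⟩⟩, rfl⟩

theorem card_oddFace (ho : IsCompactOrientation o) (hc : IsTypedBy o c) :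
    Nat.card {f : Face n // IsOddFace o f} =
      ∑ τ : Fin 2, ∑ k, ∏ d, if d = k then n d else segmentCount n c d τ := by
  have card_axis (τ : Fin 2) (k d : Fin 3) : Nat.card {x : Fin (n d) // d ≠ k →
      x.val + 1 < n d ∧ edgeType c d x.val = τ.val} =
        if d = k then n d else segmentCount n c d τ := by
    split_ifs with h
    · simp [h]
    · simpa [h, segmentCount] using card_fin_subtype_succ_lt (n d) fun x => edgeType c d x = τ.val
  rw [← Nat.card_congr (oddFaceEquiv ho hc), Nat.card_sigma]
  refine Finset.sum_congr rfl fun τ _ => ?_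
  rw [Nat.card_sigma]
  refine Finset.sum_congr rfl fun k _ => ?_
  simp only [← card_axis]
  exact card_subtype_pi fun d (x : Fin (n d)) => d ≠ k →
    x.val + 1 < n d ∧ edgeType c d x.val = τ.val

/-- The cell at the corner `v` of the box; its value at other vertices is irrelevant. -/
def cornerCell (hn : ∀ d, 2 ≤ n d) (v : Vertex n) : Cell n :=
  ⟨fun d => ⟨if (v d).val = 0 then 0 else n d - 2, by have := hn d; split_ifs <;> omega⟩,
    fun d => by have := hn d; simp only; split_ifs <;> omega⟩

theorem isOddCorner_iff (hn : ∀ d, 2 ≤ n d) (ho : IsCompactOrientation o) (hc : IsTypedBy o c)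
    (v : Vertex n) : IsOddCorner o v ↔ ∃ τ : Fin 2, ∀ d, IsEnd n c d τ (v d) := by
  constructor
  · rintro ⟨hv, p, hvp, hp⟩
    rw [isOddCell_iff ho hc] at hp
    refine ⟨⟨edgeType c 0 (p.1 0).val, edgeType_lt _ _ _⟩, fun d => ?_⟩
    have lt := p.2 d
    have mem := hvp d
    refine (hv d).imp (fun h => ⟨h, ?_⟩) fun h => ⟨h, ?_⟩
    · rw [← show (p.1 d).val = 0 by omega]; exact hp d 0
    · rw [← show (p.1 d).val = n d - 2 by omega]; exact hp d 0
  · rintro ⟨τ, h⟩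
    refine ⟨fun d => (h d).imp And.left And.left, cornerCell hn v, fun d => ?_,
      (isOddCell_iff ho hc _).mpr ?_⟩
    · have hd := hn d
      rcases h d with ⟨first, -⟩ | ⟨last, -⟩
      · simp [cornerCell, first]
      · right
        rw [cornerCell]
        simp only
        split_ifs <;> omega
    · suffices ∀ d, edgeType c d ((cornerCell hn v).1 d).val = τ.val from
        fun a b => (this a).trans (this b).symm
      intro d
      have hd := hn d
      rcases h d with ⟨first, type_eq⟩ | ⟨last, type_eq⟩
      · simp [cornerCell, first, type_eq]
      · simp [cornerCell, show (v d).val ≠ 0 by omega, type_eq]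

theorem IsEnd.type_unique {d : Fin 3} {τ τ' x : ℕ} (hd : 2 ≤ n d) (h : IsEnd n c d τ x)
    (h' : IsEnd n c d τ' x) : τ = τ' := by
  rcases h with h | h <;> rcases h' with h' | h' <;> omega

theorem oddCornerCount_eq (hn : ∀ d, 2 ≤ n d) (ho : IsCompactOrientation o) (hc : IsTypedBy o c) :
    oddCornerCount o = ∑ τ : Fin 2, ∏ d, endCount n c d τ := by
  classical
  let e : (Σ τ : Fin 2, {v : Vertex n // ∀ d, IsEnd n c d τ (v d)}) ≃
      {v : Vertex n // IsOddCorner o v} := by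
    refine Equiv.ofBijective (fun x => ⟨x.2.1, (isOddCorner_iff hn ho hc _).mpr ⟨x.1, x.2.2⟩⟩)
      ⟨?_, fun ⟨v, hv⟩ => ?_⟩
    · rintro ⟨τ, u, hu⟩ ⟨τ', u', hu'⟩ h
      obtain rfl : u = u' := congrArg Subtype.val h
      obtain rfl : τ = τ' := Fin.ext ((hu 0).type_unique (hn 0) (hu' 0))
      rfl
    · obtain ⟨τ, hτ⟩ := (isOddCorner_iff hn ho hc v).mp hv
      exact ⟨⟨τ, v, hτ⟩, rfl⟩
  rw [oddCornerCount, ← Nat.card_congr e, Nat.card_sigma]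
  refine Finset.sum_congr rfl fun τ _ => ?_
  rw [card_subtype_pi fun d (x : Fin (n d)) => IsEnd n c d τ x]
  exact Finset.prod_congr rfl fun d _ => by rw [card_fin_subtype, endCount]

theorem oddCornerCount_mem (hn : ∀ d, 2 ≤ n d) (ho : IsCompactOrientation o)
    (hc : IsTypedBy o c) : oddCornerCount o ∈ ({0, 2, 4, 8} : Set ℕ) := by
  have ends (d : Fin 3) : (endCount n c d 0 = 0 ∧ endCount n c d 1 = 2) ∨
      (endCount n c d 0 = 1 ∧ endCount n c d 1 = 1) ∨
      (endCount n c d 0 = 2 ∧ endCount n c d 1 = 0) := by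
    have := endCount_add c (hn d)
    omega
  rw [oddCornerCount_eq hn ho hc]
  simp only [Fin.sum_univ_two, Fin.prod_univ_three, Fin.val_zero, Fin.val_one]
  rcases ends 0 with h₀ | h₀ | h₀ <;> rcases ends 1 with h₁ | h₁ | h₁ <;>
    rcases ends 2 with h₂ | h₂ | h₂ <;>
    rw [h₀.1, h₀.2, h₁.1, h₁.2, h₂.1, h₂.2] <;> simp

end Counting

section CellSpaceDimension

variable {n : Fin 3 → ℕ} {c : Fin 3 → ℕ}

/-! ### The dimension of the space of trivial cycles -/

open Classical in
/-- The axes of the edges at the lowest vertex of an odd cell, given by its type and its lowest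
vertex. -/
def cellAxes (c : Fin 3 → ℕ) (p : Fin 2 × Vertex n) : Finset (Fin 3) :=
  {d | IsCellEdge c p.1 p.2 d}

theorem card_supported_sum_eq_zero : ∀ s : Finset (Fin 3),
    Fintype.card {κ : Fin 3 → ZMod 2 // (∀ d, d ∉ s → κ d = 0) ∧ ∑ d, κ d = 0} =
      2 ^ (s.card - 1) := by
  decide

theorem card_cellSpace :
    Nat.card (cellSpace (n := n) c) = 2 ^ ∑ p : Fin 2 × Vertex n, ((cellAxes c p).card - 1) := by
  let e : cellSpace (n := n) c ≃ ∀ p : Fin 2 × Vertex n, {κ : Fin 3 → ZMod 2 //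
      (∀ d, d ∉ cellAxes c p → κ d = 0) ∧ ∑ d, κ d = 0} :=
    ⟨fun κ p => ⟨κ.1 p, by simpa [cellAxes] using κ.2 p⟩,
      fun κ => ⟨fun p => (κ p).1, fun p => by simpa [cellAxes] using (κ p).2⟩,
      fun _ => rfl, fun _ => rfl⟩
  rw [Nat.card_congr e, Nat.card_pi, ← Finset.prod_pow_eq_pow_sum]
  exact Finset.prod_congr rfl fun p _ => by
    rw [← card_supported_sum_eq_zero, Nat.card_eq_fintype_card]

theorem card_sub_one_add : ∀ s : Finset (Fin 3),
    s.card - 1 + (if ∀ d ∈ Finset.univ, d ∈ s then 1 else 0) =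
      ∑ k : Fin 3, if ∀ d ∈ ({k}ᶜ : Finset (Fin 3)), d ∈ s then 1 else 0 := by
  decide

theorem forall_mem_cellAxes_iff {τ : Fin 2} {O : Vertex n} {s : Finset (Fin 3)}
    (hs : s.Nonempty) : (∀ d ∈ s, d ∈ cellAxes c (τ, O)) ↔ ∀ d,
      if d ∈ s then (O d).val + 1 < n d ∧ edgeType c d (O d).val = τ
      else (O d).val = 0 ∨ edgeType c d (O d).val = τ := by
  simp only [cellAxes, Finset.mem_filter_univ]
  refine ⟨fun h d => ?_, fun h d hd => ?_⟩
  · obtain ⟨a, ha⟩ := hs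
    split_ifs with hd
    · exact ⟨(h d hd).lt, (h d hd).type_eq⟩
    · exact (h a ha).low d
  · have hdd := h d
    rw [if_pos hd] at hdd
    refine ⟨fun k => ?_, hdd.2, hdd.1⟩
    have hk := h k
    split_ifs at hk
    exacts [Or.inr hk.2, hk]

theorem sum_forall_mem_cellAxes (c : Fin 3 → ℕ) (τ : Fin 2) {s : Finset (Fin 3)}
    (hs : s.Nonempty) :
    (∑ O : Vertex n, if ∀ d ∈ s, d ∈ cellAxes c (τ, O) then 1 else 0) =
      ∏ d, if d ∈ s then segmentCount n c d τ else lowCount n c d τ := by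
  rw [← Finset.card_filter, ← Fintype.card_subtype, ← Nat.card_eq_fintype_card]
  simp only [forall_mem_cellAxes_iff hs]
  rw [card_subtype_pi fun d (x : Fin (n d)) => if d ∈ s then x.val + 1 < n d ∧
    edgeType c d x.val = τ else x.val = 0 ∨ edgeType c d x.val = τ]
  refine Finset.prod_congr rfl fun d _ => ?_
  split_ifs
  · exact card_fin_subtype_succ_lt (n d) fun x => edgeType c d x = τ.val
  · exact card_fin_subtype (n d) fun x => x = 0 ∨ edgeType c d x = τ.val

theorem sum_card_cellAxes_sub_one_add (c : Fin 3 → ℕ) :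
    ∑ p : Fin 2 × Vertex n, ((cellAxes c p).card - 1) +
      ∑ τ : Fin 2, ∏ d, segmentCount n c d τ =
    ∑ τ : Fin 2, ∑ k, ∏ d, if d = k then lowCount n c d τ else segmentCount n c d τ := by
  rw [Fintype.sum_prod_type, ← Finset.sum_add_distrib]
  refine Finset.sum_congr rfl fun τ _ => ?_
  have all := sum_forall_mem_cellAxes (n := n) c τ Finset.univ_nonempty
  have others (k : Fin 3) := sum_forall_mem_cellAxes (n := n) c τ (s := {k}ᶜ)
    ⟨k + 1, by simp⟩
  simp only [Finset.mem_univ, if_true, forall_true_left] at all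
  simp only [Finset.mem_compl, Finset.mem_singleton, ite_not] at others
  rw [← all, ← Finset.sum_add_distrib, ← Finset.sum_congr rfl fun k _ => others k,
    Finset.sum_comm]
  exact Finset.sum_congr rfl fun O _ => by simpa using card_sub_one_add (cellAxes c (τ, O))

end CellSpaceDimension

section Disparity

variable {n : Fin 3 → ℕ} {o : Vertex n → Vertex n → Prop} {c : Fin 3 → ℕ}

/-! ### The disparity -/

theorem card_qubit (o : Vertex n → Vertex n → Prop) :
    Fintype.card (Qubit o) = Fintype.card (Vertex n) + Nat.card {f : Face n // IsOddFace o f} := by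
  rw [← Nat.card_eq_fintype_card, ← Nat.card_eq_fintype_card, ← Nat.card_sum]

theorem two_mul_card_oddFace_add (hn : ∀ d, 2 ≤ n d) (ho : IsCompactOrientation o)
    (hc : IsTypedBy o c) :
    2 * (Nat.card {f : Face n // IsOddFace o f} +
      ∑ p : Fin 2 × Vertex n, ((cellAxes c p).card - 1) + Fintype.card (Vertex n)) =
    oddCornerCount o + 2 * Fintype.card (LatticeEdge n) := by
  have segments (d : Fin 3) := segmentCount_add n c d (zero_add 1)
  have low₀ (d : Fin 3) := lowCount_eq c (two_pos.trans_le (hn d)).ne' (zero_add 1)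
  have low₁ (d : Fin 3) := lowCount_eq c (two_pos.trans_le (hn d)).ne' (add_zero 1)
  have ends₀ (d : Fin 3) := endCount_add_segmentCount c (hn d) (zero_add 1)
  have ends₁ (d : Fin 3) := endCount_add_segmentCount c (hn d) (add_zero 1)
  have size (d : Fin 3) : n d = segmentCount n c d 0 + segmentCount n c d 1 + 1 := by
    have := hn d
    have := segments d
    omega
  have cells := sum_card_cellAxes_sub_one_add (n := n) c
  rw [card_oddFace ho hc, oddCornerCount_eq hn ho hc, card_vertex, card_latticeEdge]
  generalize ∑ p : Fin 2 × Vertex n, ((cellAxes c p).card - 1) = m at cells ⊢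
  simp only [← segments, Fin.sum_univ_two, Fin.sum_univ_three, Fin.prod_univ_three, Fin.val_zero,
    Fin.val_one, low₀, low₁, Fin.reduceEq, if_true, if_false] at cells ⊢
  generalize segmentCount n c = A at cells ends₀ ends₁ size ⊢
  zify at cells ends₀ ends₁ size ⊢
  replace ends₀ (d : Fin 3) : (endCount n c d 0 : ℤ) = A d 0 - A d 1 + 1 := by
    linear_combination ends₀ d
  replace ends₁ (d : Fin 3) : (endCount n c d 1 : ℤ) = A d 1 - A d 0 + 1 := by
    linear_combination ends₁ d
  simp only [size, ends₀, ends₁]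
  linear_combination 2 * cells

theorem two_mul_disparity_add_one (hn : ∀ d, 2 ≤ n d) (ho : IsCompactOrientation o)
    (hc : IsTypedBy o c) {pick : Face n → Vertex n × Vertex n} (hpick : IsEdgeChoice o pick)
    {σ : MG (lattice n) →* QubitOp (Qubit o)} (hσ : IsCubicEncoding o pick σ) :
    2 * (disparity σ + 1) = oddCornerCount o := by
  have generators := minGenerators_stabilizerGroup (fun d => (two_pos.trans_le (hn d)).ne')
    ho hc hpick hσ card_cellSpace
  have count := two_mul_card_oddFace_add hn ho hc
  rw [disparity, card_qubit]
  omega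

end Disparity

end

end CompactEncoding

/-- On a box-shaped cubic lattice with at least two vertices along each axis, for every admissible
edge orientation and every choice of edges for the isolated odd faces, the cubic compact encoding
exists, no cycle is mapped to `-1`, and its disparity is `OCV / 2 - 1 ∈ {-1, 0, 1, 3}`. -/
theorem mainTheorem1 (n : Fin 3 → ℕ) (hn : ∀ d, 2 ≤ n d)
    (o : Vertex n → Vertex n → Prop) (ho : IsCompactOrientation o)
    (pick : Face n → Vertex n × Vertex n) (hpick : IsEdgeChoice o pick) :
    (∃ σ : MG (lattice n) →* QubitOp (Qubit o), IsCubicEncoding o pick σ) ∧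
    ∀ σ : MG (lattice n) →* QubitOp (Qubit o), IsCubicEncoding o pick σ →
      (-1 : (QubitOp (Qubit o))ˣ) ∉ stabilizerGroup σ ∧
      (disparity σ : ℚ) = (oddCornerCount o : ℚ) / 2 - 1 ∧
      disparity σ ∈ ({-1, 0, 1, 3} : Set ℤ) := by
  obtain ⟨c, hc⟩ := ho.exists_isTypedBy hn
  refine ⟨exists_isCubicEncoding pick ho hc, fun σ hσ =>
    ⟨neg_one_notMem_stabilizerGroup ho hc hpick hσ, ?_, ?_⟩⟩
  · have h : 2 * ((disparity σ : ℚ) + 1) = oddCornerCount o := by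
      exact_mod_cast two_mul_disparity_add_one hn ho hc hpick hσ
    linarith
  · have h := two_mul_disparity_add_one hn ho hc hpick hσ
    have h' := oddCornerCount_mem hn ho hc
    simp only [Set.mem_insert_iff, Set.mem_singleton_iff] at h' ⊢
    omega
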